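/- **Setting.** Let $X$ be a topological space and $R$ a commutative ring. An *$R$-linear fibered category* $\mathcal F$ on $X$ is a contravariant pseudofunctor on the poset $\mathrm{Open}(X)$ with values in $R$-linear categories and $R$-linear functors: categories $\mathcal F(U)$, restriction functors $\mathcal F(U)\to\mathcal F(V)$, $F\mapsto F|_V$ for $V\subset U$, and coherent isomorphisms $F|_V|_W\cong F|_W$. A *morphism* $\varphi:\mathcal F\to\mathcal G$ is a pseudonatural transformation with $R$-linear components $\varphi_U:\mathcal F(U)\to\mathcal G(U)$; it is an *equivalence* if every $\varphi_U$ is an equivalence of categories. $\mathrm{Mod}(V)$ denotes the category of sheaves of $R$-modules on $V$. For an $R$-linear fibered category $\mathcal A$, a *sheaf on $\mathcal A|_U$* is a contravariant morphism of $R$-linear fibered categories from $\mathcal A|_U$ to $\mathrm{Mod}|_U$: $R$-linear functors $\mathcal A(V)^{\mathrm{op}}\to\mathrm{Mod}(V)$ for $V\subset U$, with coherent natural isomorphisms expressing compatibility with restriction. These form the category $\mathrm{Mod}(\mathcal A|_U)$, and $\mathcal{M}od(\mathcal A)$ is the fibered category $U\mapsto\mathrm{Mod}(\mathcal A|_U)$.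 For an abelian category $\mathcal D$ and $\mathcal S\subset\mathcal D$, let $\mathcal S^\perp=\{D\mid \mathrm{Hom}(\mathcal S,D)=0=\mathrm{Ext}^1(\mathcal S,D)\}$. A Serre subcategory $\mathcal S$ is *localizing* if $\mathcal D\to\mathcal D/\mathcal S$ has a right adjoint. $\mathcal S*\mathcal T$ consists of the objects $D$ with an exact sequence $0\to S\to D\to T\to 0$, $S\in\mathcal S$, $T\in\mathcal T$; $\mathcal S$ and $\mathcal T$ are *compatible* if $\mathcal S*\mathcal T=\mathcal T*\mathcal S$. A *complemented stack of localizations* is an $R$-linear stack $\mathcal C$ on $X$ such that every $\mathcal C(U)$ is a Grothendieck category; for $U\subset W$ the restriction $\mathcal C(W)\to\mathcal C(U)$ is (up to equivalence) the quotient of $\mathcal C(W)$ by its kernel $\mathcal Z_W(U)$, which is a localizing Serre subcategory; for $U,V\subset W$, $\mathcal Z_W(U)$ and $\mathcal Z_W(V)$ are compatible and $\mathcal Z_W(U\cap V)=\mathcal Z_W(U)*\mathcal Z_W(V)$; and for $U\subset W$ there is a localizing Serre subcategory $\mathcal S$ of $\mathcal C(W)$ with $\mathcal S^\perp=\mathcal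 Z_W(U)$. Then the restriction functor $\mathcal C(U)\to\mathcal C(V)$ has a left adjoint $j_!=j_{U,V,!}$ for all $V\subset U$. Let $\mathcal C$ be a complemented stack of localizations on $X$, $\mathcal A$ an $R$-linear fibered category on $X$ with all $\mathcal A(U)$ essentially small, and $\varphi:\mathcal A\to\mathcal C$ a morphism of $R$-linear fibered categories. It induces the morphism $$\mathcal C\to\mathcal{M}od(\mathcal A),\qquad \mathcal C(U)\ni C\ \longmapsto\ \bigl(\mathcal A(V)\ni A\mapsto \mathcal{H}om(\varphi_V(A),C|_V)\bigr)_{V\subset U},$$ where $\mathcal{H}om(D,D')$, for $D,D'\in\mathcal C(V)$, is the sheaf $T\mapsto\mathrm{Hom}_{\mathcal C(T)}(D|_T,D'|_T)$ on $V$. For an open $U$, let $\mathfrak a_U$ be the pre-additive category whose objects $A_V$ are the objects $A_V\in\mathcal A(V)$, $V\subset U$, with $\mathfrak a_U(A_W,A_V)=\mathcal A(W)(A_W,A_V|_W)$ if $W\subset V$ and $0$ otherwise. There is an additive functor $\mathfrak a_U\to\mathcal C(U)$, $A_V\mapsto j_{U,V,!}\varphi_V(A_V)$, whose action on morphisms for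 $W\subset V$ is $\mathcal A(W)(A_W,A_V|_W)\to\mathcal C(W)(\varphi_W A_W,(\varphi_V A_V)|_W)\to\mathcal C(W)(\varphi_W A_W,(j_!\varphi_V A_V)|_W)\cong\mathcal C(U)(j_!\varphi_W A_W,j_!\varphi_V A_V)$. A *covering system* on a category specifies for each object a collection of families of maps to it (coverings), containing the identities and closed under composition. A subfunctor of a representable additive functor $\mathfrak u(-,M)$ is covering for the topology of a covering system if each of its pullbacks along a map $N\to M$ contains a covering of $N$; two covering systems are *equivalent* if they define the same topology. Let $\mathcal T_{\mathrm{epi}}$ be the covering system of all (jointly) epimorphic families on $\mathcal C(U)$; $\mathcal T_{\mathrm{epi},U}$ the one on $\mathfrak a_U$ in which a family is covering if its image in $\mathcal C(U)$ is epimorphic; and $\mathcal T_U$ the one on $\mathfrak a_U$ whose coverings of $A_V$ are the families of cartesian morphisms $A_{V_i}\to A_V$ (i.e. given by isomorphisms $A_{V_i}\cong A_V|_{V_i}$, $V_i\subset V$) with $\bigcup_i V_i=V$. For an additive functor $u:(\mathfrak u,\mathcal T)\to(\mathfrak v,\mathcal T')$ between pre-additive categories with covering systems, consider: * (G) every object $v$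 of $\mathfrak v$ has a $\mathcal T'$-covering by a family of maps $u(N_i)\to v$; * (F) for every $y:u(N)\to u(M)$ there is a $\mathcal T$-covering $(f_i:N_i\to N)$ such that each $y\circ u(f_i)$ is of the form $u(x_i)$ with $x_i:N_i\to M$; * (FF) for every $x:N\to M$ with $u(x)=0$ there is a $\mathcal T$-covering $(f_i:N_i\to N)$ with $x\circ f_i=0$ for all $i$. An object $M\in\mathcal C(U)$ is *locally finitely presented* if $\mathcal{H}om(M,-):\mathcal C(U)\to\mathrm{Mod}(U)$ preserves filtered colimits, and *locally projective* if for every $N\in\mathcal C(U)$ the sheaf $\mathcal{E}xt^1(M,N)$ on $U$ associated to $V\mapsto\mathrm{Ext}^1_{\mathcal C(V)}(M|_V,N|_V)$ is zero. **Theorem.** In this setting, the following are equivalent: 1. $\varphi$ yields an equivalence of stacks $\mathcal{M}od(\mathcal A)\cong\mathcal C$, i.e. the induced functors $\mathcal C(U)\to\mathrm{Mod}(\mathcal A|_U)$ are equivalences for all open $U$. 2. (a) For every open $U$, $(\mathfrak a_U,\mathcal T_{\mathrm{epi},U})\to(\mathcal C(U),\mathcal T_{\mathrm{epi}})$ satisfies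 (G), (F) and (FF); and (b) for every open $U$, $\mathcal T_{\mathrm{epi},U}$ and $\mathcal T_U$ are equivalent. 3. (a) For every open $U$, $(\mathfrak a_U,\mathcal T_U)\to(\mathcal C(U),\mathcal T_{\mathrm{epi}})$ satisfies (G), (F) and (FF); and (b) for every open $U$ and $A\in\mathcal A(U)$, the object $\varphi_U(A)$ of $\mathcal C(U)$ is locally finitely presented and locally projective. -/

import Mathlib

open CategoryTheory Bicategory Opposite TopologicalSpace Limits Abelian
open CategoryTheory.Pseudofunctor.LocallyDiscreteOpToCat (pullHom pullHom_id pullHom_pullHom)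

set_option linter.unusedSectionVars false
set_option linter.style.longLine false

universe v u

noncomputable section

namespace FibCat

section

variable {X : Type v} [TopologicalSpace X]

/-- The category `F(U)` of sections over the open set `U` of a fibered category `F` on `X`. -/
abbrev Fib (F : LocallyDiscrete (Opens X)ᵒᵖ ⥤ᵖ Cat.{v, u}) (U : Opens X) : Type u :=
  F.obj (.mk (op U))

variable (F : LocallyDiscrete (Opens X)ᵒᵖ ⥤ᵖ Cat.{v, u})

/-- The restriction functor `F(U) ⥤ F(V)` for `V ≤ U`. -/
abbrev res {U V : Opens X} (h : V ≤ U) : Fib F U ⥤ Fib F V :=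
  (F.map (homOfLE h).op.toLoc).toFunctor

/-- The coherence isomorphism `M|_W ≅ (M|_V)|_W`. -/
def resComp {U V W : Opens X} (h : V ≤ U) (k : W ≤ V) (M : Fib F U) :
    (res F (k.trans h)).obj M ≅ (res F k).obj ((res F h).obj M) :=
  (Cat.Hom.toNatIso (F.mapComp' (homOfLE h).op.toLoc (homOfLE k).op.toLoc
    (homOfLE (k.trans h)).op.toLoc rfl)).app M

lemma resComp_assoc {U V W T : Opens X} (h : V ≤ U) (k : W ≤ V) (l : T ≤ W) (M : Fib F U) :
    (resComp F h (l.trans k) M).hom ≫ (resComp F k l ((res F h).obj M)).hom =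
      (resComp F (k.trans h) l M).hom ≫ (res F l).map ((resComp F h k M).hom) := by
  have := F.mapComp'₀₁₃_hom_comp_whiskerLeft_mapComp'_hom_app (homOfLE h).op.toLoc (homOfLE k).op.toLoc
    (homOfLE l).op.toLoc (homOfLE (k.trans h)).op.toLoc (homOfLE (l.trans k)).op.toLoc
    (homOfLE (l.trans (k.trans h))).op.toLoc rfl rfl rfl M
  simpa [resComp] using this

/-- The restriction functors of `F` are additive. -/
class IsAdditive [∀ U, Preadditive (Fib F U)] : Prop where
  additive {U V : Opens X} (h : V ≤ U) : (res F h).Additive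

/-- The restriction functors of `F` are compatible with the multiplication by scalars in `R`. -/
class IsLinear (R : Type v) [CommRing R] [∀ U, Preadditive (Fib F U)]
    [∀ U, Linear R (Fib F U)] : Prop where
  linear {U V : Opens X} (h : V ≤ U) : (res F h).Linear R

attribute [instance] IsAdditive.additive IsLinear.linear

section

variable {F} {U V T T' : Opens X} {M : Fib F V} {N : Fib F U}

/-- Restriction of morphisms `M|_T ⟶ N|_T` to `T' ≤ T`, for `M` in `F(V)` and `N` in `F(U)`. -/
def pull {hV : T ≤ V} {hU : T ≤ U} (k : T' ≤ T) (f : (res F hV).obj M ⟶ (res F hU).obj N) :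
    (res F (k.trans hV)).obj M ⟶ (res F (k.trans hU)).obj N :=
  (resComp F hV k M).hom ≫ (res F k).map f ≫ (resComp F hU k N).inv

lemma pull_eq {hV : T ≤ V} {hU : T ≤ U} (k : T' ≤ T)
    (f : (res F hV).obj M ⟶ (res F hU).obj N) :
    pull k f = pullHom f (homOfLE k) (homOfLE (k.trans hV)) (homOfLE (k.trans hU)) rfl rfl := rfl

lemma pull_refl {hV : T ≤ V} {hU : T ≤ U} (f : (res F hV).obj M ⟶ (res F hU).obj N) :
    pull le_rfl f = f := pullHom_id f

lemma pull_pull {T'' : Opens X} {hV : T ≤ V} {hU : T ≤ U} (k : T' ≤ T) (l : T'' ≤ T')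
    (f : (res F hV).obj M ⟶ (res F hU).obj N) :
    pull l (pull k f) = pull (l.trans k) f := pullHom_pullHom f _ _ _ _ _ _

lemma pull_add [∀ U, Preadditive (Fib F U)] [IsAdditive F] {hV : T ≤ V} {hU : T ≤ U} (k : T' ≤ T)
    (f g : (res F hV).obj M ⟶ (res F hU).obj N) : pull k (f + g) = pull k f + pull k g := by
  simp [pull, Functor.map_add]

lemma pull_smul (R : Type v) [CommRing R] [∀ U, Preadditive (Fib F U)]
    [∀ U, Linear R (Fib F U)] [IsLinear F R] {hV : T ≤ V} {hU : T ≤ U} (k : T' ≤ T) (r : R)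
    (f : (res F hV).obj M ⟶ (res F hU).obj N) : pull k (r • f) = r • pull k f := by
  simp [pull, Functor.map_smul]

end

section

variable {F} {U V W T T' : Opens X}

lemma resComp_naturality (h : V ≤ U) (k : W ≤ V) {M M' : Fib F U} (a : M ⟶ M') :
    (res F (k.trans h)).map a ≫ (resComp F h k M').hom =
      (resComp F h k M).hom ≫ (res F k).map ((res F h).map a) :=
  (Cat.Hom.toNatIso (F.mapComp' (homOfLE h).op.toLoc (homOfLE k).op.toLoc
    (homOfLE (k.trans h)).op.toLoc rfl)).hom.naturality a

lemma resComp_inv_naturality (h : V ≤ U) (k : W ≤ V) {M M' : Fib F U} (a : M ⟶ M') :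
    (res F k).map ((res F h).map a) ≫ (resComp F h k M').inv =
      (resComp F h k M).inv ≫ (res F (k.trans h)).map a :=
  (Cat.Hom.toNatIso (F.mapComp' (homOfLE h).op.toLoc (homOfLE k).op.toLoc
    (homOfLE (k.trans h)).op.toLoc rfl)).inv.naturality a

lemma resComp_hom_inv (h : V ≤ U) (k : W ≤ V) (M : Fib F U) :
    (resComp F h k M).hom ≫ (resComp F h k M).inv = 𝟙 _ :=
  (resComp F h k M).hom_inv_id

lemma resComp_inv_hom (h : V ≤ U) (k : W ≤ V) (M : Fib F U) :
    (resComp F h k M).inv ≫ (resComp F h k M).hom = 𝟙 _ :=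
  (resComp F h k M).inv_hom_id

lemma map_resComp_hom_inv (h : V ≤ U) (k : W ≤ V) (l : T ≤ W) (M : Fib F U) :
    (res F l).map ((resComp F h k M).hom) ≫ (res F l).map ((resComp F h k M).inv) =
      𝟙 _ := by
  rw [← Functor.map_comp, resComp_hom_inv, CategoryTheory.Functor.map_id]

lemma map_resComp_inv_hom (h : V ≤ U) (k : W ≤ V) (l : T ≤ W) (M : Fib F U) :
    (res F l).map ((resComp F h k M).inv) ≫ (res F l).map ((resComp F h k M).hom) =
      𝟙 _ := by
  rw [← Functor.map_comp, resComp_inv_hom, CategoryTheory.Functor.map_id]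

lemma resComp_assoc_inv (h : V ≤ U) (k : W ≤ V) (l : T ≤ W) (M : Fib F U) :
    (resComp F (k.trans h) l M).inv ≫ (resComp F h (l.trans k) M).hom =
      (res F l).map ((resComp F h k M).hom) ≫
        (resComp F k l ((res F h).obj M)).inv := by
  rw [← cancel_epi ((resComp F (k.trans h) l M).hom),
    ← cancel_mono ((resComp F k l ((res F h).obj M)).hom)]
  simp only [Category.assoc, reassoc_of% (resComp_hom_inv (F := F)), resComp_inv_hom, Category.comp_id]
  exact resComp_assoc F h k l M

lemma resComp_assoc_inv' (h : V ≤ U) (k : W ≤ V) (l : T ≤ W) (M : Fib F U) :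
    (resComp F h (l.trans k) M).inv ≫ (resComp F (k.trans h) l M).hom =
      (resComp F k l ((res F h).obj M)).hom ≫
        (res F l).map ((resComp F h k M).inv) := by
  rw [← cancel_epi ((resComp F h (l.trans k) M).hom),
    ← cancel_mono ((res F l).map ((resComp F h k M).hom))]
  simp only [Category.assoc, reassoc_of% (resComp_hom_inv (F := F)), map_resComp_inv_hom, Category.comp_id]
  exact (resComp_assoc F h k l M).symm

lemma resComp_assoc_inv_inv (h : V ≤ U) (k : W ≤ V) (l : T ≤ W) (M : Fib F U) :
    (resComp F k l ((res F h).obj M)).inv ≫ (resComp F h (l.trans k) M).inv =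
      (res F l).map (resComp F h k M).inv ≫ (resComp F (k.trans h) l M).inv :=
  congrArg Iso.inv (Iso.ext (resComp_assoc F h k l M) :
    resComp F h (l.trans k) _ ≪≫ resComp F k l _ =
      resComp F (k.trans h) l _ ≪≫ (res F l).mapIso (resComp F h k _))

lemma pull_comp_map {M : Fib F V} {N N' : Fib F U} {hV : T ≤ V} {hU : T ≤ U} (k : T' ≤ T)
    (f : (res F hV).obj M ⟶ (res F hU).obj N) (b : N ⟶ N') :
    pull k (f ≫ (res F hU).map b) = pull k f ≫ (res F (k.trans hU)).map b := by
  simp only [pull, Functor.map_comp, Category.assoc, resComp_inv_naturality]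

lemma pull_map_comp {M M' : Fib F V} {N : Fib F U} {hV : T ≤ V} {hU : T ≤ U} (k : T' ≤ T)
    (a : M ⟶ M') (f : (res F hV).obj M' ⟶ (res F hU).obj N) :
    pull k ((res F hV).map a ≫ f) = (res F (k.trans hV)).map a ≫ pull k f := by
  simp only [pull, Functor.map_comp, Category.assoc]
  rw [reassoc_of% (resComp_naturality hV k a)]

lemma pull_comp_resComp {M : Fib F W} {N : Fib F U} (h : V ≤ U) {hW : T ≤ W} {hV : T ≤ V}
    (k : T' ≤ T) (f : (res F hW).obj M ⟶ (res F (hV.trans h)).obj N) :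
    pull k (f ≫ (resComp F h hV N).hom) = pull k f ≫ (resComp F h (k.trans hV) N).hom := by
  simp only [pull, Functor.map_comp, Category.assoc]
  rw [resComp_assoc_inv h hV k]

lemma pull_comp_resComp_inv {M : Fib F W} {N : Fib F U} (h : V ≤ U) {hW : T ≤ W} {hV : T ≤ V}
    (k : T' ≤ T) (f : (res F hW).obj M ⟶ (res F hV).obj ((res F h).obj N)) :
    pull k (f ≫ (resComp F h hV N).inv) = pull k f ≫ (resComp F h (k.trans hV) N).inv := by
  have := pull_comp_resComp (M := M) (N := N) (hW := hW) (hV := hV) h k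
    (f ≫ (resComp F h hV N).inv)
  rw [Category.assoc, resComp_inv_hom, Category.comp_id] at this
  rw [this, Category.assoc, resComp_hom_inv, Category.comp_id]

lemma pull_resComp_comp {M : Fib F U} {N : Fib F W} (h : V ≤ U) {hW : T ≤ W} {hV : T ≤ V}
    (k : T' ≤ T) (f : (res F (hV.trans h)).obj M ⟶ (res F hW).obj N) :
    pull k ((resComp F h hV M).inv ≫ f) = (resComp F h (k.trans hV) M).inv ≫ pull k f := by
  simp only [pull, Functor.map_comp, Category.assoc]
  rw [reassoc_of% (resComp_assoc_inv' h hV k M)]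

end

/-! ### Sheaves of morphisms -/

section HomSheaf

variable (R : Type v) [CommRing R] [∀ U, Preadditive (Fib F U)] [∀ U, Linear R (Fib F U)]
  [IsAdditive F] [IsLinear F R] {U V : Opens X}

/-- For `M` in `F(V)` and `N` in `F(U)` with `V ≤ U`, the presheaf of `R`-modules
`T ↦ Hom(M|_T, N|_T)` on `V`. -/
def homPresheaf (h : V ≤ U) (M : Fib F V) (N : Fib F U) : (Over V)ᵒᵖ ⥤ ModuleCat.{v} R where
  obj T := ModuleCat.of R
    ((res F T.unop.hom.le).obj M ⟶ (res F (T.unop.hom.le.trans h)).obj N)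
  map {T T'} p := ModuleCat.ofHom
    { toFun := fun f ↦ pull (hV := T.unop.hom.le) (hU := T.unop.hom.le.trans h) p.unop.left.le f
      map_add' := pull_add _
      map_smul' := pull_smul R _ }
  map_id T := by
    ext f
    exact pull_refl f
  map_comp {T T' T''} p q := by
    ext f
    exact (pull_pull p.unop.left.le q.unop.left.le f).symm

/-- The underlying presheaf of sets of `homPresheaf` is the presheaf of morphisms from `M` to
`N|_V`. -/
def homPresheafForgetIso (h : V ≤ U) (M : Fib F V) (N : Fib F U) :
    homPresheaf F R h M N ⋙ forget (ModuleCat.{v} R) ≅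
      F.presheafHom M ((res F h).obj N) :=
  NatIso.ofComponents
    (fun T ↦ Equiv.toIso (Iso.homToEquiv (resComp F h T.unop.hom.le N)))
    (by
      intro T T' p
      ext f
      change pull (hV := T.unop.hom.le) (hU := T.unop.hom.le.trans h) p.unop.left.le f ≫
          (resComp F h T'.unop.hom.le N).hom =
        pull (hV := T.unop.hom.le) (hU := T.unop.hom.le) p.unop.left.le
          (f ≫ (resComp F h T.unop.hom.le N).hom)
      exact (pull_comp_resComp h _ f).symm)

lemma homPresheaf_isSheaf [F.IsPrestack (Opens.grothendieckTopology X)] (h : V ≤ U)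
    (M : Fib F V) (N : Fib F U) :
    Presheaf.IsSheaf ((Opens.grothendieckTopology X).over V) (homPresheaf F R h M N) := by
  rw [Presheaf.isSheaf_iff_isSheaf_forget _ _ (forget (ModuleCat.{v} R)),
    Presheaf.isSheaf_of_iso_iff (homPresheafForgetIso F R h M N)]
  exact Pseudofunctor.IsPrestack.isSheaf _ _ _

variable [F.IsPrestack (Opens.grothendieckTopology X)]

/-- For `V ≤ U`, the functor sending `M` in `F(V)` and `N` in `F(U)` to the sheaf of `R`-modules
`T ↦ Hom(M|_T, N|_T)` on `V`. -/
def homSheaf (h : V ≤ U) : (Fib F V)ᵒᵖ ⥤ Fib F U ⥤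
    Sheaf ((Opens.grothendieckTopology X).over V) (ModuleCat.{v} R) where
  obj M :=
    { obj N := ⟨homPresheaf F R h M.unop N, homPresheaf_isSheaf F R h M.unop N⟩
      map {N N'} b := ⟨
        { app T := ModuleCat.ofHom (Linear.rightComp R _
            ((res F (T.unop.hom.le.trans h)).map b))
          naturality T T' p := by
            ext f
            exact (pull_comp_map (hV := T.unop.hom.le) p.unop.left.le f b).symm }⟩
      map_id N := by
        ext T f
        exact (congrArg (f ≫ ·) (CategoryTheory.Functor.map_id _ _)).trans (Category.comp_id f)
      map_comp b b' := by
        ext T f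
        exact (congrArg (f ≫ ·) (Functor.map_comp _ _ _)).trans (Category.assoc _ _ _).symm }
  map {M M'} a :=
    { app N := ⟨
        { app T := ModuleCat.ofHom (Linear.leftComp R _ ((res F T.unop.hom.le).map a.unop))
          naturality T T' p := by
            ext f
            exact (pull_map_comp (hU := T.unop.hom.le.trans h) p.unop.left.le a.unop f).symm }⟩
      naturality N N' b := by
        ext T f
        exact (Category.assoc _ _ _).symm }
  map_id M := by
    ext N T f
    exact (congrArg (· ≫ f) (CategoryTheory.Functor.map_id _ _)).trans (Category.id_comp f)
  map_comp a a' := by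
    ext N T f
    exact (congrArg (· ≫ f) (Functor.map_comp _ _ _)).trans (Category.assoc _ _ _)

end HomSheaf

end

section

variable {X : Type v} [TopologicalSpace X]

section Morphisms

variable {A C : LocallyDiscrete (Opens X)ᵒᵖ ⥤ᵖ Cat.{v, u}} (φ : Pseudofunctor.StrongTrans A C)

/-- The component `A(U) ⥤ C(U)` of a morphism of fibered categories. -/
abbrev onFib (U : Opens X) : Fib A U ⥤ Fib C U := (φ.app (.mk (op U))).toFunctor

/-- The isomorphism `φ(M|_V) ≅ φ(M)|_V`. -/
def compRes {U V : Opens X} (h : V ≤ U) (M : Fib A U) :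
    (onFib φ V).obj ((res A h).obj M) ≅ (res C h).obj ((onFib φ U).obj M) :=
  (Cat.Hom.toNatIso (φ.naturality (homOfLE h).op.toLoc)).app M

lemma compRes_naturality {U V : Opens X} (h : V ≤ U) {M M' : Fib A U} (a : M ⟶ M') :
    (onFib φ V).map ((res A h).map a) ≫ (compRes φ h M').hom =
      (compRes φ h M).hom ≫ (res C h).map ((onFib φ U).map a) :=
  (Cat.Hom.toNatIso (φ.naturality (homOfLE h).op.toLoc)).hom.naturality a

lemma compRes_comp {U V W : Opens X} (h : V ≤ U) (k : W ≤ V) (M : Fib A U) :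
    (compRes φ (k.trans h) M).hom ≫ (resComp C h k ((onFib φ U).obj M)).hom =
      (onFib φ W).map (resComp A h k M).hom ≫ (compRes φ k ((res A h).obj M)).hom ≫
        (res C k).map (compRes φ h M).hom := by
  have := congr_arg (fun t ↦ t.toNatTrans.app M)
    (φ.naturality_comp (homOfLE h).op.toLoc (homOfLE k).op.toLoc)
  simp only [← Pseudofunctor.mapComp'_eq_mapComp] at this
  simp at this
  exact this

end Morphisms

section SheafOn

variable (A C : LocallyDiscrete (Opens X)ᵒᵖ ⥤ᵖ Cat.{v, u}) (R : Type v) [CommRing R]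
  [∀ U, Preadditive (Fib A U)] [∀ U, Linear R (Fib A U)]

/-- The category `Mod(V)` of sheaves of `R`-modules on `V`. -/
abbrev ModSh (V : Opens X) : Type _ :=
  Sheaf ((Opens.grothendieckTopology X).over V) (ModuleCat.{v} R)

/-- The restriction functor `Mod(V) ⥤ Mod(W)` for `W ≤ V`. -/
abbrev modRes {V W : Opens X} (k : W ≤ V) : ModSh R V ⥤ ModSh R W :=
  (Opens.grothendieckTopology X).overMapPullback (ModuleCat.{v} R) (homOfLE k)

/-- The canonical isomorphism `(F|_W)|_{W'} ≅ F|_{W'}` in `Mod(W')`. -/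
abbrev modResComp {V W W' : Opens X} (k : W ≤ V) (l : W' ≤ W) :
    modRes R k ⋙ modRes R l ≅ modRes R (l.trans k) :=
  (Opens.grothendieckTopology X).overMapPullbackComp (ModuleCat.{v} R) (homOfLE l) (homOfLE k)

/-- A sheaf on the restriction `A|_U` of the fibered category `A`: a (contravariant) morphism of
`R`-linear fibered categories from `A|_U` to `Mod|_U`. -/
structure SheafOn (U : Opens X) where
  sheaf {V : Opens X} (h : V ≤ U) : (Fib A V)ᵒᵖ ⥤ ModSh R V
  map_add {V : Opens X} (h : V ≤ U) {M M' : Fib A V} (a b : M ⟶ M') (T : (Over V)ᵒᵖ) :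
    ((sheaf h).map (a + b).op).hom.app T =
      ((sheaf h).map a.op).hom.app T + ((sheaf h).map b.op).hom.app T
  map_smul {V : Opens X} (h : V ≤ U) {M M' : Fib A V} (r : R) (a : M ⟶ M') (T : (Over V)ᵒᵖ) :
    ((sheaf h).map (r • a).op).hom.app T = r • ((sheaf h).map a.op).hom.app T
  resIso {V W : Opens X} (h : V ≤ U) (k : W ≤ V) :
    sheaf h ⋙ modRes R k ≅ (res A k).op ⋙ sheaf (k.trans h)
  resIso_comp {V W W' : Opens X} (h : V ≤ U) (k : W ≤ V) (l : W' ≤ W) (M : Fib A V) :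
    (modRes R l).map ((resIso h k).hom.app (op M)) ≫
        (resIso (k.trans h) l).hom.app (op ((res A k).obj M)) =
      (modResComp R k l).hom.app ((sheaf h).obj (op M)) ≫
        (resIso h (l.trans k)).hom.app (op M) ≫
          (sheaf ((l.trans k).trans h)).map (resComp A k l M).inv.op

namespace SheafOn

variable {A R} {U : Opens X}

/-- A morphism of sheaves on `A|_U`: natural transformations compatible with restriction. -/
@[ext]
structure Hom (F G : SheafOn A R U) where
  app {V : Opens X} (h : V ≤ U) : F.sheaf h ⟶ G.sheaf h
  resIso_app {V W : Opens X} (h : V ≤ U) (k : W ≤ V) (M : (Fib A V)ᵒᵖ) :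
    (F.resIso h k).hom.app M ≫ (app (k.trans h)).app ((res A k).op.obj M) =
      (modRes R k).map ((app h).app M) ≫ (G.resIso h k).hom.app M

instance : Category (SheafOn A R U) where
  Hom := Hom
  id F := { app h := 𝟙 _, resIso_app h k M := by simp }
  comp f g :=
    { app h := f.app h ≫ g.app h
      resIso_app h k M := by
        simp only [NatTrans.comp_app, Functor.map_comp, Category.assoc]
        rw [← g.resIso_app, ← Category.assoc, f.resIso_app, Category.assoc] }

@[ext]
lemma hom_ext {F G : SheafOn A R U} {f g : F ⟶ G}
    (w : ∀ {V : Opens X} (h : V ≤ U), f.app h = g.app h) : f = g :=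
  Hom.ext (by ext V h : 2; exact w h)

/-- The restriction functor `Mod(A|_U) ⥤ Mod(A|_V)`. -/
def restrict {U V : Opens X} (h : V ≤ U) : SheafOn A R U ⥤ SheafOn A R V where
  obj F :=
    { sheaf k := F.sheaf (k.trans h)
      map_add k := F.map_add (k.trans h)
      map_smul k := F.map_smul (k.trans h)
      resIso k l := F.resIso (k.trans h) l
      resIso_comp k := F.resIso_comp (k.trans h) }
  map f :=
    { app k := f.app (k.trans h)
      resIso_app k := f.resIso_app (k.trans h) }

end SheafOn

variable {A C} (φ : Pseudofunctor.StrongTrans A C)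
  [∀ U, Preadditive (Fib C U)] [∀ U, Linear R (Fib C U)] [IsAdditive C] [IsLinear C R]
  [hadd : ∀ U, (onFib φ U).Additive] [hlin : ∀ U, (onFib φ U).Linear R]
  [C.IsPrestack (Opens.grothendieckTopology X)] (U : Opens X)

/-- The isomorphism `φ(M|_W)|_T ≅ φ(M)|_T`. -/
def compResRes {V W T : Opens X} (k : W ≤ V) (l : T ≤ W) (M : Fib A V) :
    (res C l).obj ((onFib φ W).obj ((res A k).obj M)) ≅
      (res C (l.trans k)).obj ((onFib φ V).obj M) :=
  (res C l).mapIso (compRes φ k M) ≪≫ (resComp C k l ((onFib φ V).obj M)).symm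

lemma pull_compResRes_comp {V W T T' : Opens X} {h : V ≤ U} {k : W ≤ V} {l : T ≤ W} (l' : T' ≤ T)
    {M : Fib A V} {N : Fib C U}
    (f : (res C (l.trans k)).obj ((onFib φ V).obj M) ⟶ (res C (l.trans (k.trans h))).obj N) :
    pull l' ((compResRes φ k l M).hom ≫ f) =
      (compResRes φ k (l'.trans l) M).hom ≫ pull (hV := l.trans k) l' f := by
  simp only [compResRes, Iso.trans_hom, Iso.symm_hom, Functor.mapIso_hom, Category.assoc]
  rw [pull_map_comp, pull_resComp_comp]

/-- The isomorphism of sheaves of `R`-modules on `W` given by precomposition with the canonical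
isomorphisms `φ(M|_W)|_T ≅ φ(M)|_T`, for `M` in `A(V)` and `N` in `C(U)`. -/
def homSheafResIso {V W : Opens X} (h : V ≤ U) (k : W ≤ V) (N : Fib C U) (M : Fib A V) :
    (modRes R k).obj (((homSheaf C R h).obj (op ((onFib φ V).obj M))).obj N) ≅
      ((homSheaf C R (k.trans h)).obj (op ((onFib φ W).obj ((res A k).obj M)))).obj N :=
  (fullyFaithfulSheafToPresheaf _ _).preimageIso (NatIso.ofComponents (fun T ↦
    { hom := ModuleCat.ofHom (Linear.leftComp R _ (compResRes φ k T.unop.hom.le M).hom)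
      inv := ModuleCat.ofHom (Linear.leftComp R _ (compResRes φ k T.unop.hom.le M).inv)
      hom_inv_id := by
        ext f
        exact Iso.inv_hom_id_assoc _ _
      inv_hom_id := by
        ext f
        exact Iso.hom_inv_id_assoc _ _ }) (by
      intro T T' p
      ext f
      exact (pull_compResRes_comp φ U (h := h) p.unop.left.le f).symm))

lemma compResRes_naturality {V W T : Opens X} (k : W ≤ V) (l : T ≤ W) {M M' : Fib A V}
    (a : M ⟶ M') :
    (res C l).map ((onFib φ W).map ((res A k).map a)) ≫ (compResRes φ k l M').hom =
      (compResRes φ k l M).hom ≫ (res C (l.trans k)).map ((onFib φ V).map a) := by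
  simp only [compResRes, Iso.trans_hom, Iso.symm_hom, Functor.mapIso_hom, Category.assoc]
  rw [← Functor.map_comp_assoc, compRes_naturality, Functor.map_comp_assoc,
    resComp_inv_naturality]

lemma compResRes_comp {V W W' T : Opens X} (k : W ≤ V) (l : W' ≤ W) (t : T ≤ W') (M : Fib A V) :
    (compResRes φ l t ((res A k).obj M)).hom ≫ (compResRes φ k (t.trans l) M).hom =
      (res C t).map ((onFib φ W').map (resComp A k l M).inv) ≫
        (compResRes φ (l.trans k) t M).hom := by
  have h1 : (onFib φ W').map (resComp A k l M).inv ≫ (compRes φ (l.trans k) M).hom =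
      (compRes φ l ((res A k).obj M)).hom ≫ (res C l).map (compRes φ k M).hom ≫
        (resComp C k l ((onFib φ V).obj M)).inv := by
    rw [← cancel_mono (resComp C k l ((onFib φ V).obj M)).hom]
    simp only [Category.assoc, resComp_inv_hom, Category.comp_id]
    rw [compRes_comp, ← Functor.map_comp_assoc, resComp_inv_hom,
      CategoryTheory.Functor.map_id, Category.id_comp]
  simp only [compResRes, Iso.trans_hom, Iso.symm_hom, Functor.mapIso_hom, Category.assoc]
  rw [← Functor.map_comp_assoc, h1]
  simp only [Functor.map_comp, Category.assoc]
  congr 1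
  rw [← reassoc_of% (resComp_inv_naturality l t (compRes φ k M).hom)]
  refine congrArg (_ ≫ ·) ?_
  exact resComp_assoc_inv_inv k l t ((onFib φ V).obj M)

/-- The functor `C(U) ⥤ Mod(A|_U)` sending `N` to the sheaf `M ↦ Hom(φ(M), N|_V)`, `M` in
`A(V)`. -/
def restrictedYoneda : Fib C U ⥤ SheafOn A R U where
  obj N :=
    { sheaf h := (onFib φ _).op ⋙ (homSheaf C R h).flip.obj N
      map_add h M M' a b T := by
        ext f
        change (res C _).map ((onFib φ _).map (a + b)) ≫ f =
          (res C _).map ((onFib φ _).map a) ≫ f + (res C _).map ((onFib φ _).map b) ≫ f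
        rw [Functor.map_add, Functor.map_add]
        exact Preadditive.add_comp _ _ _ _ _ _
      map_smul h M M' r a T := by
        ext f
        change (res C _).map ((onFib φ _).map (r • a)) ≫ f =
          r • ((res C _).map ((onFib φ _).map a) ≫ f)
        rw [Functor.map_smul, Functor.map_smul]
        exact Linear.smul_comp _ _ _ _ _ _
      resIso h k := NatIso.ofComponents (fun M ↦ homSheafResIso R φ U h k N M.unop) (by
        intro M M' a
        ext T f
        exact ((reassoc_of% (compResRes_naturality φ k T.unop.hom.le a.unop)) f).symm)
      resIso_comp h k l M := by
        ext T f
        exact (Category.assoc _ _ _).symm.trans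
          ((congrArg (· ≫ f) (compResRes_comp φ k l T.unop.hom.le M)).trans
            ((Category.assoc _ _ _).trans (congrArg (fun t ↦ _ ≫ _ ≫ t) (pull_refl f).symm))) }
  map b :=
    { app h := Functor.whiskerLeft (onFib φ _).op ((homSheaf C R h).flip.map b)
      resIso_app h k M := by
        ext T f
        exact (Category.assoc _ _ _) }
  map_id N := by
    ext V h : 1
    exact congrArg (Functor.whiskerLeft (onFib φ V).op) ((homSheaf C R h).flip.map_id N)
  map_comp b b' := by
    ext V h : 1
    exact congrArg (Functor.whiskerLeft (onFib φ V).op) ((homSheaf C R h).flip.map_comp b b')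

/-- The isomorphism of sheaves on `W` with values on `T` the bijection
`Hom(M|_T, (N|_V)|_T) ≅ Hom(M|_T, N|_T)`. -/
def homSheafCompResIso {V W : Opens X} (h : V ≤ U) (k : W ≤ V) (M : Fib C W) (N : Fib C U) :
    ((homSheaf C R k).obj (op M)).obj ((res C h).obj N) ≅
      ((homSheaf C R (k.trans h)).obj (op M)).obj N :=
  (fullyFaithfulSheafToPresheaf _ _).preimageIso (NatIso.ofComponents (fun T ↦
    { hom := ModuleCat.ofHom (Linear.rightComp R _ (resComp C h (T.unop.hom.le.trans k) N).inv)
      inv := ModuleCat.ofHom (Linear.rightComp R _ (resComp C h (T.unop.hom.le.trans k) N).hom)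
      hom_inv_id := by
        ext f
        exact (Category.assoc _ _ _).trans
          ((congrArg (f ≫ ·) (resComp_inv_hom h _ N)).trans (Category.comp_id f))
      inv_hom_id := by
        ext f
        exact (Category.assoc _ _ _).trans
          ((congrArg (f ≫ ·) (resComp_hom_inv h _ N)).trans (Category.comp_id f)) }) (by
      intro T T' p
      ext f
      exact (pull_comp_resComp_inv (hW := T.unop.hom.le) h p.unop.left.le f).symm))

/-- The functors `C(U) ⥤ Mod(A|_U)` are the components of a morphism of fibered categories: they
are compatible with restriction. -/
def restrictedYonedaRes {V : Opens X} (h : V ≤ U) :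
    res C h ⋙ restrictedYoneda R φ V ≅ restrictedYoneda R φ U ⋙ SheafOn.restrict h :=
  NatIso.ofComponents (fun N ↦
    { hom :=
        { app k :=
            { app M := (homSheafCompResIso R U h k ((onFib φ _).obj M.unop) N).hom
              naturality M M' a := by
                ext T f
                exact Category.assoc _ _ _ }
          resIso_app k l M := by
            ext T f
            exact Category.assoc _ _ _ }
      inv :=
        { app k :=
            { app M := (homSheafCompResIso R U h k ((onFib φ _).obj M.unop) N).inv
              naturality M M' a := by
                ext T f
                exact Category.assoc _ _ _ }
          resIso_app k l M := by
            ext T f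
            exact Category.assoc _ _ _ }
      hom_inv_id := by
        ext W k : 1
        refine NatTrans.ext (funext fun M ↦ ?_)
        exact (homSheafCompResIso R U h k ((onFib φ _).obj M.unop) N).hom_inv_id
      inv_hom_id := by
        ext W k : 1
        refine NatTrans.ext (funext fun M ↦ ?_)
        exact (homSheafCompResIso R U h k ((onFib φ _).obj M.unop) N).inv_hom_id })
    (by
      intro N N' b
      ext W k : 1
      refine NatTrans.ext (funext fun M ↦ ?_)
      ext T f
      exact (Category.assoc _ _ _).trans ((congrArg (f ≫ ·)
        (resComp_inv_naturality h (T.unop.hom.le.trans k) b)).trans (Category.assoc _ _ _).symm))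

end SheafOn

end

section

/-! ### Localizing Serre subcategories -/

section Serre

universe w v' u'

open scoped ZeroObject

variable {D : Type u} [Category.{v} D] [Abelian D]

/-- A Serre subcategory is localizing if the quotient functor has a right adjoint. -/
class IsLocalizingSerre (S : ObjectProperty D) : Prop extends S.IsSerreClass where
  isLeftAdjoint : S.isoModSerre.Q.IsLeftAdjoint

/-- The right orthogonal `S^⊥ = {C | Hom(S, C) = 0 = Ext¹(S, C)}`. -/
def rightPerp [HasExt.{w} D] (S : ObjectProperty D) : ObjectProperty D :=
  fun M ↦ ∀ N, S N → (∀ f : N ⟶ M, f = 0) ∧ ∀ e : Ext N M 1, e = 0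

/-- `S ∗ T`: the objects `M` with an exact sequence `0 ⟶ M₁ ⟶ M ⟶ M₂ ⟶ 0`, `M₁` in `S` and
`M₂` in `T`. -/
def extensionProduct (S T : ObjectProperty D) : ObjectProperty D :=
  fun M ↦ ∃ (E : ShortComplex D), E.ShortExact ∧ E.X₂ = M ∧ S E.X₁ ∧ T E.X₃

variable {D' : Type u'} [Category.{v'} D'] (L : D ⥤ D')
  (P S : ObjectProperty D)

lemma exists_lift_of_ext_eq_zero [HasExt.{w} D] {E : ShortComplex D} (hE : E.ShortExact) {M : D}
    (h : ∀ e : Ext M E.X₁ 1, e = 0) (f : M ⟶ E.X₃) : ∃ g : M ⟶ E.X₂, g ≫ E.g = f := by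
  obtain ⟨x, hx⟩ := Ext.covariant_sequence_exact₃ M hE (Ext.mk₀ f) (zero_add 1) (h _)
  obtain ⟨g, rfl⟩ := (Ext.mk₀_bijective M E.X₂).2 x
  rw [Ext.mk₀_comp_mk₀] at hx
  exact ⟨g, (Ext.mk₀_bijective _ _).1 hx⟩

/-- Morphisms which are invertible modulo `P` and whose target is left orthogonal to `P` have a
section. -/
lemma exists_section [HasExt.{w} D] [P.IsSerreClass] {M N : D} (s : N ⟶ M)
    (hs : P.isoModSerre s)
    (hM : ∀ Z, P Z → (∀ f : M ⟶ Z, f = 0) ∧ ∀ e : Ext M Z 1, e = 0) :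
    ∃ t, t ≫ s = 𝟙 M := by
  have : Epi s := Preadditive.epi_of_cokernel_zero ((hM _ hs.2).1 _)
  let E : ShortComplex D := .mk (kernel.ι s) s (by simp)
  have hE : E.ShortExact :=
    { exact := ShortComplex.exact_of_f_is_kernel _ (kernelIsKernel s)
      mono_f := by dsimp [E]; infer_instance
      epi_g := by dsimp [E]; infer_instance }
  exact exists_lift_of_ext_eq_zero hE (hM _ hs.1).2 (𝟙 M)

lemma map_bijective_of_colocal [HasExt.{w} D] [P.IsSerreClass] [L.IsLocalization P.isoModSerre]
    {M : D} (hM : ∀ Z, P Z → (∀ f : M ⟶ Z, f = 0) ∧ ∀ e : Ext M Z 1, e = 0) (N : D) :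
    Function.Bijective (fun f : M ⟶ N ↦ L.map f) := by
  constructor
  · intro f g hfg
    obtain ⟨Y, s, hs, h⟩ := (MorphismProperty.map_eq_iff_precomp L P.isoModSerre f g).1 hfg
    obtain ⟨t, ht⟩ := exists_section P s hs hM
    have := t ≫= h
    rwa [reassoc_of% ht, reassoc_of% ht] at this
  · intro f
    obtain ⟨φ, hφ⟩ := Localization.exists_rightFraction L P.isoModSerre f
    obtain ⟨t, ht⟩ := exists_section P φ.s φ.hs hM
    refine ⟨t ≫ φ.f, ?_⟩
    have h1 : L.map φ.s ≫ f = L.map φ.f := by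
      rw [hφ, MorphismProperty.RightFraction.map_s_comp_map]
    simp only [L.map_comp, ← h1]
    rw [← L.map_comp_assoc, ht, L.map_id, Category.id_comp]

lemma prop_rightPerp_rightAdjoint [HasExt.{w} D] [EnoughInjectives D] [S.IsSerreClass]
    {E : Type u'} [Category.{v'} E] {Q : D ⥤ E} [Q.IsLocalization S.isoModSerre]
    [Preadditive E] [Q.Additive] {G : E ⥤ D} (adj : Q ⊣ G) (Y : E) :
    rightPerp S (G.obj Y) := by
  intro N hN
  refine ⟨fun f ↦ ?_, fun e ↦ ?_⟩
  · apply (adj.homEquiv N Y).symm.injective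
    exact (((ObjectProperty.SerreClassLocalization.isZero_obj_iff Q S N).2 hN).eq_of_src _ _)
  · let K : ShortComplex D := .mk (Injective.ι (G.obj Y)) (cokernel.π (Injective.ι (G.obj Y)))
      (by simp)
    have hK : K.ShortExact :=
      { exact := ShortComplex.exact_of_g_is_cokernel _ (cokernelIsCokernel _)
        mono_f := by dsimp [K]; infer_instance
        epi_g := by dsimp [K]; infer_instance }
    obtain ⟨x, rfl⟩ := Ext.covariant_sequence_exact₁ N hK e (Ext.eq_zero_of_injective _) rfl
    obtain ⟨f, rfl⟩ := (Ext.mk₀_bijective N K.X₃).2 x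
    let j : G.obj Y ⟶ pullback K.g f := pullback.lift K.f 0 (by simp)
    have := hK.mono_f
    have := hK.epi_g
    have hfac {W : D} (k : W ⟶ pullback K.g f) (hk : k ≫ pullback.snd K.g f = 0) :
        ∃ k', k' ≫ j = k :=
      ⟨hK.exact.lift (k ≫ pullback.fst K.g f)
        (by rw [Category.assoc, pullback.condition, reassoc_of% hk, zero_comp]), by
        apply pullback.hom_ext
        · simp only [j, Category.assoc, pullback.lift_fst, ShortComplex.Exact.lift_f]
        · simp only [j, Category.assoc, pullback.lift_snd, comp_zero, hk]⟩
    have : Mono j := mono_of_mono_fac (pullback.lift_fst K.f 0 (by simp))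
    have sq : IsPullback j (0 : G.obj Y ⟶ (0 : D)) (pullback.snd K.g f) (0 : (0 : D) ⟶ N) :=
      ⟨⟨(pullback.lift_snd _ _ _).trans comp_zero.symm⟩, ⟨PullbackCone.IsLimit.mk _
        (fun s ↦ (hfac s.fst (by rw [s.condition, comp_zero])).choose)
        (fun s ↦ (hfac s.fst (by rw [s.condition, comp_zero])).choose_spec)
        (fun s ↦ (isZero_zero D).eq_of_tgt _ _)
        (fun s m hm _ ↦ by
          rw [← cancel_mono j, hm, (hfac s.fst (by rw [s.condition, comp_zero])).choose_spec])⟩⟩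
    have hj : S.isoModSerre j := MorphismProperty.of_isPullback sq.flip
      ((S.isoModSerre_zero_iff _ _).2 ⟨S.prop_of_isZero (isZero_zero D), hN⟩)
    have := Localization.inverts Q S.isoModSerre j hj
    let r : pullback K.g f ⟶ G.obj Y :=
      adj.homEquiv _ _ (inv (Q.map j) ≫ (adj.homEquiv _ _).symm (𝟙 (G.obj Y)))
    have hr : j ≫ r = 𝟙 _ := by
      rw [← adj.homEquiv_naturality_left, IsIso.hom_inv_id_assoc, Equiv.apply_symm_apply]
    obtain ⟨k, hk⟩ := hfac (kernel.ι (pullback.snd K.g f)) (kernel.condition _)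
    have hk' : kernel.ι (pullback.snd K.g f) ≫ (pullback.fst K.g f - r ≫ K.f) = 0 := by
      rw [← hk, Category.assoc, Preadditive.comp_sub, reassoc_of% hr, pullback.lift_fst, sub_self,
        comp_zero]
    have hE : (ShortComplex.mk _ _ (kernel.condition (pullback.snd K.g f))).Exact :=
      ShortComplex.exact_of_f_is_kernel _ (kernelIsKernel _)
    have : Epi (ShortComplex.mk _ _ (kernel.condition (pullback.snd K.g f))).g := by
      dsimp; infer_instance
    have hl : hE.desc _ hk' ≫ K.g = f := by
      rw [← cancel_epi (pullback.snd K.g f)]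
      have := hE.g_desc _ hk'
      dsimp at this
      rw [reassoc_of% this, Preadditive.sub_comp, Category.assoc, K.zero, comp_zero, sub_zero,
        pullback.condition]
    rw [← hl, ← Ext.mk₀_comp_mk₀_assoc, hK.comp_extClass, Ext.comp_zero]

lemma exists_colocal_subobject [HasExt.{w} D] [EnoughInjectives D] [P.IsSerreClass]
    [hS : IsLocalizingSerre S] (h : rightPerp S = P) (N : D) :
    ∃ (M : D) (i : M ⟶ N), S M ∧ P.isoModSerre i := by
  have := hS.isLeftAdjoint
  let adj := Adjunction.ofIsLeftAdjoint S.isoModSerre.Q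
  let η := adj.unit.app N
  refine ⟨kernel η, kernel.ι η, ?_, P.isoModSerre_of_mono _ ?_⟩
  · have h0 : S.isoModSerre.Q.map (kernel.ι η) = 0 := by
      rw [← S.isoModSerre.Q.map_zero]
      apply (adj.homEquiv _ _).injective
      rw [adj.homEquiv_unit, adj.homEquiv_unit]
      have h1 := adj.unit.naturality (kernel.ι η)
      have h2 := adj.unit.naturality (0 : kernel η ⟶ N)
      exact h1.symm.trans (((kernel.condition η).trans zero_comp.symm).trans h2)
    rw [ObjectProperty.SerreClassLocalization.map_eq_zero_iff S.isoModSerre.Q S] at h0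
    exact S.prop_of_iso (asIso (Abelian.factorThruImage (kernel.ι η))).symm h0
  · exact P.prop_of_mono (Abelian.factorThruCoimage η)
      (h ▸ prop_rightPerp_rightAdjoint S adj _)

/-- A localization functor with kernel `P` has a left adjoint when `P` is the right orthogonal of
a localizing Serre subcategory. -/
lemma isRightAdjoint_of_complement [HasExt.{w} D] [EnoughInjectives D] [P.IsSerreClass]
    [L.IsLocalization P.isoModSerre] [IsLocalizingSerre S] (h : rightPerp S = P) :
    L.IsRightAdjoint := by
  apply Functor.isRightAdjoint_of_leftAdjointObjIsDefined_eq_top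
  ext E
  simp only [Pi.top_apply, Prop.top_eq_true, iff_true]
  have := Localization.essSurj L P.isoModSerre
  obtain ⟨M, i, hM, hi⟩ := exists_colocal_subobject P S h (L.objPreimage E)
  have := Localization.inverts L P.isoModSerre i hi
  let e : L.obj M ≅ E := asIso (L.map i) ≪≫ L.objObjPreimageIso E
  have hM' := map_bijective_of_colocal L P (M := M) (fun Z hZ ↦ by
    rw [← h] at hZ
    exact hZ M hM)
  exact (Functor.CorepresentableBy.mk (F := L ⋙ coyoneda.obj (op E)) (X := M)
    (fun {N} ↦ (Equiv.ofBijective _ (hM' N)).trans (e.homFromEquiv (Z := L.obj N))) (by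
      intro N N' g f
      simp)).isCorepresentable

end Serre

end

section

variable {X : Type v} [TopologicalSpace X]

/-! ### Fibered categories of localizations -/

section Localizations

variable (C : LocallyDiscrete (Opens X)ᵒᵖ ⥤ᵖ Cat.{v, u}) [∀ U, Abelian (Fib C U)]

/-- The kernel of the restriction functor `C(U) ⥤ C(V)`. -/
abbrev resKernel {U V : Opens X} (h : V ≤ U) : ObjectProperty (Fib C U) := (res C h).kernel

instance (U : Opens X) : HasExt.{max u v} (Fib C U) := HasExt.standard _

/-- Fibered categories of localizations: the categories `C(W)` are Grothendieck, the restriction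
functors `C(W) ⥤ C(U)` are the localizations at their kernels `Z(U)`, which are localizing Serre
subcategories, `Z(U)` and `Z(V)` are compatible and `Z(U ∩ V) = Z(U) ∗ Z(V)`. -/
class IsFiberedCategoryOfLocalizations : Prop where
  isGrothendieckAbelian (U : Opens X) : IsGrothendieckAbelian.{v} (Fib C U)
  isLocalizingSerre {W U : Opens X} (h : U ≤ W) : IsLocalizingSerre (resKernel C h)
  isLocalization {W U : Opens X} (h : U ≤ W) : (res C h).IsLocalization (resKernel C h).isoModSerre
  compatible {W U V : Opens X} (h : U ≤ W) (k : V ≤ W) :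
    extensionProduct (resKernel C h) (resKernel C k) =
      extensionProduct (resKernel C k) (resKernel C h)
  resKernel_inf {W U V : Opens X} (h : U ≤ W) (k : V ≤ W) :
    resKernel C (inf_le_left.trans h : U ⊓ V ≤ W) =
      extensionProduct (resKernel C h) (resKernel C k)

/-- A fibered category of localizations is complemented if each kernel is the right orthogonal of
some localizing Serre subcategory. -/
class IsComplemented : Prop extends IsFiberedCategoryOfLocalizations C where
  exists_complement {W U : Opens X} (h : U ≤ W) :
    ∃ S : ObjectProperty (Fib C W), IsLocalizingSerre S ∧ rightPerp S = resKernel C h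

attribute [instance] IsFiberedCategoryOfLocalizations.isGrothendieckAbelian
  IsFiberedCategoryOfLocalizations.isLocalizingSerre
  IsFiberedCategoryOfLocalizations.isLocalization

variable {U V : Opens X} (h : V ≤ U)

instance [IsFiberedCategoryOfLocalizations C] [IsAdditive C] : PreservesFiniteLimits (res C h) :=
  ObjectProperty.SerreClassLocalization.preservesFiniteLimits (res C h) (resKernel C h)

instance [IsFiberedCategoryOfLocalizations C] [IsAdditive C] : PreservesFiniteColimits (res C h) :=
  ObjectProperty.SerreClassLocalization.preservesFiniteColimits (res C h) (resKernel C h)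

instance res_isRightAdjoint [hC : IsComplemented C] : (res C h).IsRightAdjoint := by
  obtain ⟨S, hS, h'⟩ := hC.exists_complement h
  exact isRightAdjoint_of_complement (res C h) (resKernel C h) S h'

/-- The extension functor `j_!`, left adjoint to the restriction functor. -/
abbrev extendByZero [IsComplemented C] : Fib C V ⥤ Fib C U := (res C h).leftAdjoint

/-- The adjunction between `j_!` and restriction. -/
abbrev extendAdj [IsComplemented C] : extendByZero C h ⊣ res C h :=
  Adjunction.ofIsRightAdjoint (res C h)

end Localizations

end

section

variable {X : Type v} [TopologicalSpace X]

/-! ### The additive category associated to a fibered category -/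

section Additive

section

variable (F : LocallyDiscrete (Opens X)ᵒᵖ ⥤ᵖ Cat.{v, u}) {U V : Opens X}

/-- The isomorphism `M|_U ≅ M` for `M` in `F(U)`. -/
def resId (M : Fib F U) : (res F le_rfl).obj M ≅ M :=
  (Cat.Hom.toNatIso (F.mapId (.mk (op U)))).app M

lemma resId_naturality {M M' : Fib F U} (a : M ⟶ M') :
    (resId F M).inv ≫ (res F le_rfl).map a = a ≫ (resId F M').inv :=
  ((Cat.Hom.toNatIso (F.mapId (.mk (op U)))).inv.naturality a).symm

lemma resId_inv_resComp_inv (h : V ≤ U) (M : Fib F U) :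
    (resId F ((res F h).obj M)).inv ≫ (resComp F h le_rfl M).inv = 𝟙 _ := by
  have := F.mapComp'_comp_id_inv_app (homOfLE h).op.toLoc M
  have h2 : (resComp F h le_rfl M).inv = (resId F ((res F h).obj M)).hom := by
    simp at this
    exact this
  rw [h2, Iso.inv_hom_id]

lemma map_resId_inv_resComp_inv (h : V ≤ U) (M : Fib F U) :
    (res F h).map (resId F M).inv ≫ (resComp F le_rfl h M).inv = 𝟙 _ := by
  have := F.mapComp'_id_comp_inv_app (homOfLE h).op.toLoc M
  have h2 : (resComp F le_rfl h M).inv = (res F h).map (resId F M).hom := by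
    simp at this
    exact this
  rw [h2, ← Functor.map_comp, Iso.inv_hom_id, CategoryTheory.Functor.map_id]

end

lemma compRes_id {A C : LocallyDiscrete (Opens X)ᵒᵖ ⥤ᵖ Cat.{v, u}} (φ : Pseudofunctor.StrongTrans A C)
    {U : Opens X} (M : Fib A U) :
    (onFib φ U).map (resId A M).inv ≫ (compRes φ le_rfl M).hom = (resId C ((onFib φ U).obj M)).inv := by
  have h1 : (compRes φ le_rfl M).hom ≫ (resId C ((onFib φ U).obj M)).hom =
      (onFib φ U).map (resId A M).hom := by
    have := congr_arg (fun t ↦ t.toNatTrans.app M) (φ.naturality_id (.mk (op U)))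
    simp [-Pseudofunctor.StrongTrans.naturality_id] at this
    exact this
  rw [← cancel_mono (resId C ((onFib φ U).obj M)).hom, Category.assoc, h1, ← Functor.map_comp,
    Iso.inv_hom_id, Iso.inv_hom_id, CategoryTheory.Functor.map_id]

variable (A : LocallyDiscrete (Opens X)ᵒᵖ ⥤ᵖ Cat.{v, u})

/-- The objects of the additive category `𝔞_U` associated to `A|_U`: pairs of an open set
`V ≤ U` and an object of `A(V)`. -/
structure Tot (U : Opens X) where
  V : Opens X
  le : V ≤ U
  obj : Fib A V

namespace Tot

variable {A} {U : Opens X} [∀ U, Preadditive (Fib A U)]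

/-- Morphisms in `𝔞_U`: the group `A(W)(A_W, A_V|_W)` if `W ≤ V`, and zero otherwise. -/
@[ext]
structure Hom (x y : Tot A U) where
  hom (h : x.V ≤ y.V) : x.obj ⟶ (res A h).obj y.obj

/-- Composition in `𝔞_U`. -/
def Hom.comp {x y z : Tot A U} (f : Hom x y) (g : Hom y z) : Hom x z where
  hom _ := open Classical in if hh : x.V ≤ y.V ∧ y.V ≤ z.V then
    f.hom hh.1 ≫ (res A hh.1).map (g.hom hh.2) ≫ (resComp A hh.2 hh.1 z.obj).inv else 0

lemma Hom.comp_hom {x y z : Tot A U} (f : Hom x y) (g : Hom y z) (h : x.V ≤ y.V) (k : y.V ≤ z.V) :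
    (f.comp g).hom (h.trans k) =
      f.hom h ≫ (res A h).map (g.hom k) ≫ (resComp A k h z.obj).inv :=
  dif_pos ⟨h, k⟩

lemma Hom.comp_hom_eq_zero {x y z : Tot A U} (f : Hom x y) (g : Hom y z) (h : x.V ≤ z.V)
    (hh : ¬ (x.V ≤ y.V ∧ y.V ≤ z.V)) : (f.comp g).hom h = 0 :=
  dif_neg hh

end Tot

namespace Tot

variable {A} {U : Opens X} [∀ U, Preadditive (Fib A U)] [IsAdditive A]

instance : Category (Tot A U) where
  Hom := Hom
  id x := { hom _ := (resId A x.obj).inv }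
  comp := Hom.comp
  id_comp {x y} f := by
    ext h
    refine (Hom.comp_hom (y := x) _ f le_rfl h).trans ?_
    dsimp only
    rw [← Category.assoc, resId_naturality, Category.assoc, resId_inv_resComp_inv, Category.comp_id]
  comp_id {x y} f := by
    ext h
    refine (Hom.comp_hom (y := y) f _ h le_rfl).trans ?_
    dsimp only
    rw [map_resId_inv_resComp_inv, Category.comp_id]
  assoc {x y z t} f g k := by
    ext h
    by_cases hh : x.V ≤ y.V ∧ y.V ≤ z.V ∧ z.V ≤ t.V
    · obtain ⟨h₁, h₂, h₃⟩ := hh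
      refine ((f.comp g).comp_hom k (h₁.trans h₂) h₃).trans
        (Eq.trans ?_ (f.comp_hom (g.comp k) h₁ (h₂.trans h₃)).symm)
      rw [Hom.comp_hom f g h₁ h₂, Hom.comp_hom g k h₂ h₃]
      simp only [Functor.map_comp, Category.assoc]
      refine congrArg (_ ≫ ·) (congrArg (_ ≫ ·) ?_)
      rw [← reassoc_of% (resComp_inv_naturality h₂ h₁ (k.hom h₃))]
      refine congrArg (_ ≫ ·) ?_
      exact resComp_assoc_inv_inv h₃ h₂ h₁ t.obj
    · refine Eq.trans (b := 0) ?_ (Eq.symm ?_)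
      · by_cases h' : x.V ≤ z.V ∧ z.V ≤ t.V
        · refine (Hom.comp_hom _ k h'.1 h'.2).trans ?_
          rw [Hom.comp_hom_eq_zero f g h'.1 (fun h'' ↦ hh ⟨h''.1, h''.2, h'.2⟩), zero_comp]
        · exact Hom.comp_hom_eq_zero _ k h h'
      · by_cases h' : x.V ≤ y.V ∧ y.V ≤ t.V
        · refine (Hom.comp_hom f _ h'.1 h'.2).trans ?_
          rw [Hom.comp_hom_eq_zero g k h'.2 (fun h'' ↦ hh ⟨h'.1, h''⟩), Functor.map_zero,
            zero_comp, comp_zero]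
        · exact Hom.comp_hom_eq_zero f _ h h'

@[ext]
lemma hom_ext {x y : Tot A U} {f g : x ⟶ y} (w : ∀ h, f.hom h = g.hom h) : f = g :=
  Hom.ext (funext w)

lemma comp_hom {x y z : Tot A U} (f : x ⟶ y) (g : y ⟶ z) (h : x.V ≤ y.V) (k : y.V ≤ z.V) :
    (f ≫ g).hom (h.trans k) =
      f.hom h ≫ (res A h).map (g.hom k) ≫ (resComp A k h z.obj).inv :=
  dif_pos ⟨h, k⟩

lemma comp_hom_eq_zero {x y z : Tot A U} (f : x ⟶ y) (g : y ⟶ z) (h : x.V ≤ z.V)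
    (hh : ¬ (x.V ≤ y.V ∧ y.V ≤ z.V)) : (f ≫ g).hom h = 0 :=
  dif_neg hh

instance (x y : Tot A U) : Add (x ⟶ y) := ⟨fun f g ↦ ⟨fun h ↦ f.hom h + g.hom h⟩⟩

instance (x y : Tot A U) : Zero (x ⟶ y) := ⟨⟨fun _ ↦ 0⟩⟩

instance (x y : Tot A U) : Neg (x ⟶ y) := ⟨fun f ↦ ⟨fun h ↦ -f.hom h⟩⟩

instance (x y : Tot A U) : AddCommGroup (x ⟶ y) where
  add_assoc _ _ _ := hom_ext fun _ ↦ add_assoc _ _ _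
  zero_add _ := hom_ext fun _ ↦ zero_add _
  add_zero _ := hom_ext fun _ ↦ add_zero _
  add_comm _ _ := hom_ext fun _ ↦ add_comm _ _
  neg_add_cancel _ := hom_ext fun _ ↦ neg_add_cancel _
  nsmul := nsmulRec
  zsmul := zsmulRec

lemma add_hom {x y : Tot A U} (f g : x ⟶ y) (h : x.V ≤ y.V) :
    (f + g).hom h = f.hom h + g.hom h := rfl

lemma zero_hom {x y : Tot A U} (h : x.V ≤ y.V) : (0 : x ⟶ y).hom h = 0 := rfl

instance : Preadditive (Tot A U) where
  add_comp x y z f f' g := by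
    ext h
    by_cases hh : x.V ≤ y.V ∧ y.V ≤ z.V
    · rw [add_hom, comp_hom _ _ hh.1 hh.2, comp_hom _ _ hh.1 hh.2, comp_hom _ _ hh.1 hh.2, add_hom,
        Preadditive.add_comp]
    · rw [add_hom, comp_hom_eq_zero _ _ _ hh, comp_hom_eq_zero _ _ _ hh, comp_hom_eq_zero _ _ _ hh,
        add_zero]
  comp_add x y z f g g' := by
    ext h
    by_cases hh : x.V ≤ y.V ∧ y.V ≤ z.V
    · rw [add_hom, comp_hom _ _ hh.1 hh.2, comp_hom _ _ hh.1 hh.2, comp_hom _ _ hh.1 hh.2, add_hom,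
        Functor.map_add, Preadditive.add_comp, Preadditive.comp_add]
    · rw [add_hom, comp_hom_eq_zero _ _ _ hh, comp_hom_eq_zero _ _ _ hh, comp_hom_eq_zero _ _ _ hh,
        add_zero]

/-- Cartesian morphisms of `𝔞_U`: those lying over an inclusion `W ≤ V` and such that, for every
`W' ≤ W`, composition induces a bijection on morphisms from objects over `W'`. -/
def IsCartesian {x y : Tot A U} (f : x ⟶ y) : Prop :=
  x.V ≤ y.V ∧ ∀ z : Tot A U, z.V ≤ x.V → Function.Bijective (fun g : z ⟶ x ↦ g ≫ f)

lemma isCartesian_id (x : Tot A U) : IsCartesian (𝟙 x) :=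
  ⟨le_rfl, fun z _ ↦ by simpa using! Function.bijective_id⟩

lemma IsCartesian.comp {x y z : Tot A U} {f : x ⟶ y} {g : y ⟶ z} (hf : IsCartesian f)
    (hg : IsCartesian g) : IsCartesian (f ≫ g) :=
  ⟨hf.1.trans hg.1, fun t ht ↦ by
    simpa [Function.comp_def] using (hg.2 t (ht.trans hf.1)).comp (hf.2 t ht)⟩

end Tot

section

variable {A} {C : LocallyDiscrete (Opens X)ᵒᵖ ⥤ᵖ Cat.{v, u}} [∀ U, Preadditive (Fib A U)]
  [IsAdditive A] [∀ U, Abelian (Fib C U)] [IsComplemented C] (φ : Pseudofunctor.StrongTrans A C)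
  [∀ U, (onFib φ U).Additive] {U : Opens X}

/-- The morphism `φ(A_W) ⟶ (j_! φ(A_V))|_W` adjoint to `totMap φ f`. -/
def totTranspose {x y : Tot A U} (f : x ⟶ y) (h : x.V ≤ y.V) :
    (onFib φ x.V).obj x.obj ⟶
      (res C x.le).obj ((extendByZero C y.le).obj ((onFib φ y.V).obj y.obj)) :=
  (onFib φ x.V).map (f.hom h) ≫ (compRes φ h y.obj).hom ≫
    (res C h).map ((extendAdj C y.le).unit.app _) ≫ (resComp C y.le h _).inv

/-- For `f` in `𝔞_U(A_W, A_V)`, the corresponding morphism `j_! φ(A_W) ⟶ j_! φ(A_V)` in `C(U)`: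
it is adjoint to the composition `φ(A_W) ⟶ φ(A_V|_W) ≅ φ(A_V)|_W ⟶ (j_! φ(A_V))|_W`, if
`W ≤ V`. -/
def totMap {x y : Tot A U} (f : x ⟶ y) :
    (extendByZero C x.le).obj ((onFib φ x.V).obj x.obj) ⟶
      (extendByZero C y.le).obj ((onFib φ y.V).obj y.obj) :=
  open Classical in if h : x.V ≤ y.V then
    ((extendAdj C x.le).homEquiv _ _).symm (totTranspose φ f h) else 0

lemma totMap_eq_zero {x y : Tot A U} (f : x ⟶ y) (h : ¬ x.V ≤ y.V) : totMap φ f = 0 :=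
  dif_neg h

lemma homEquiv_totMap {x y : Tot A U} (f : x ⟶ y) (h : x.V ≤ y.V) :
    (extendAdj C x.le).homEquiv _ _ (totMap φ f) = totTranspose φ f h := by
  rw [totMap, dif_pos h, Equiv.apply_symm_apply]

lemma totTranspose_comp {x y z : Tot A U} (f : x ⟶ y) (g : y ⟶ z) (h : x.V ≤ y.V) (k : y.V ≤ z.V) :
    totTranspose φ (f ≫ g) (h.trans k) =
      totTranspose φ f h ≫ (res C x.le).map (totMap φ g) := by
  have h1 : (extendAdj C y.le).unit.app _ ≫ (res C y.le).map (totMap φ g) =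
      totTranspose φ g k := by
    rw [← homEquiv_totMap φ g k, Adjunction.homEquiv_unit]
  have h2 : (resComp C y.le h _).inv ≫ (res C x.le).map (totMap φ g) =
      (res C h).map ((res C y.le).map (totMap φ g)) ≫ (resComp C y.le h _).inv :=
    (resComp_inv_naturality y.le h (totMap φ g)).symm
  conv_rhs =>
    rw [totTranspose, Category.assoc, Category.assoc, Category.assoc, h2,
      ← Functor.map_comp_assoc, h1]
  have h3 : (onFib φ x.V).map (resComp A k h z.obj).inv ≫ (compRes φ (h.trans k) z.obj).hom =
      (compRes φ h ((res A k).obj z.obj)).hom ≫ (res C h).map (compRes φ k z.obj).hom ≫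
        (resComp C k h _).inv := by
    rw [← cancel_mono (resComp C k h _).hom, Category.assoc, compRes_comp, ← Functor.map_comp_assoc]
    simp
  rw [totTranspose, totTranspose, Tot.comp_hom f g h k]
  simp only [Functor.map_comp, Category.assoc]
  rw [reassoc_of% h3, reassoc_of% (compRes_naturality φ h (g.hom k))]
  refine congrArg (_ ≫ ·) (congrArg (_ ≫ ·) (congrArg (_ ≫ ·) (congrArg (_ ≫ ·) ?_)))
  rw [← reassoc_of% (resComp_inv_naturality k h)]
  exact congrArg (_ ≫ ·) (resComp_assoc_inv_inv z.le k h _)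

variable (U) in
/-- The functor `𝔞_U ⥤ C(U)` sending `A_V` to `j_! φ(A_V)`. -/
def totFunctor : Tot A U ⥤ Fib C U where
  obj x := (extendByZero C x.le).obj ((onFib φ x.V).obj x.obj)
  map f := totMap φ f
  map_id x := by
    apply ((extendAdj C x.le).homEquiv _ _).injective
    rw [homEquiv_totMap φ _ le_rfl, Adjunction.homEquiv_id]
    refine ((reassoc_of% (compRes_id φ x.obj)) _).trans ?_
    rw [reassoc_of% resId_naturality]
    exact (congrArg (_ ≫ ·) (resId_inv_resComp_inv C x.le _)).trans (Category.comp_id _)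
  map_comp {x y z} f g := by
    by_cases h : x.V ≤ z.V
    · by_cases hh : x.V ≤ y.V ∧ y.V ≤ z.V
      · apply ((extendAdj C x.le).homEquiv _ _).injective
        rw [homEquiv_totMap φ _ h, Adjunction.homEquiv_naturality_right,
          homEquiv_totMap φ _ hh.1, totTranspose_comp φ f g hh.1 hh.2]
      · refine Eq.trans (b := 0) ?_ (Eq.symm ?_)
        · rw [totMap, dif_pos h, totTranspose, Tot.comp_hom_eq_zero f g h hh, Functor.map_zero,
            zero_comp, Adjunction.homEquiv_counit, Functor.map_zero, zero_comp]
        · by_cases h' : x.V ≤ y.V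
          · rw [totMap_eq_zero φ g (fun h'' ↦ hh ⟨h', h''⟩), comp_zero]
          · rw [totMap_eq_zero φ f h', zero_comp]
    · rw [totMap, dif_neg h]
      by_cases h' : x.V ≤ y.V
      · rw [totMap_eq_zero φ g (fun h'' ↦ h (h'.trans h'')), comp_zero]
      · rw [totMap_eq_zero φ f h', zero_comp]

end

end Additive

end

section

variable {X : Type v} [TopologicalSpace X]

/-! ### Covering systems and the conditions (G), (F), (FF) -/

section Coverings

universe v₁ v₂ u₁ u₂

/-- A covering system: a choice of families of maps called coverings, containing the identity
morphisms and closed under composition of coverings. -/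
structure CoveringSystem (𝔲 : Type u₁) [Category.{v₁} 𝔲] where
  coverings (M : 𝔲) : Set (Presieve M)
  id_mem (M : 𝔲) : Presieve.singleton (𝟙 M) ∈ coverings M
  bind_mem {M : 𝔲} {P : Presieve M} (hP : P ∈ coverings M)
    (Q : ∀ ⦃N : 𝔲⦄ ⦃f : N ⟶ M⦄, P f → Presieve N)
    (hQ : ∀ ⦃N : 𝔲⦄ ⦃f : N ⟶ M⦄ (hf : P f), Q hf ∈ coverings N) :
    Presieve.bind P Q ∈ coverings M

/-- A subfunctor of the additive functor `𝔲(-, M)`. -/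
structure AdditiveSieve {𝔲 : Type u₁} [Category.{v₁} 𝔲] [Preadditive 𝔲] (M : 𝔲) where
  arrows (N : 𝔲) : AddSubgroup (N ⟶ M)
  comp_mem {N N' : 𝔲} (g : N' ⟶ N) {f : N ⟶ M} (hf : f ∈ arrows N) : g ≫ f ∈ arrows N'

variable {𝔲 : Type u₁} [Category.{v₁} 𝔲] {𝔳 : Type u₂} [Category.{v₂} 𝔳]

/-- The additive sieve `S` on `M` is covering for the topology defined by `T`: each pullback of
`S` contains a `T`-covering. -/
def CoveringSystem.Covers [Preadditive 𝔲] (T : CoveringSystem 𝔲) {M : 𝔲} (S : AdditiveSieve M) :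
    Prop :=
  ∀ ⦃N : 𝔲⦄ (f : N ⟶ M), ∃ P ∈ T.coverings N,
    ∀ ⦃N' : 𝔲⦄ ⦃g : N' ⟶ N⦄, P g → g ≫ f ∈ S.arrows N'

/-- Two covering systems are equivalent if they define the same additive topology. -/
def CoveringSystem.Equivalent [Preadditive 𝔲] (T T' : CoveringSystem 𝔲) : Prop :=
  ∀ ⦃M : 𝔲⦄ (S : AdditiveSieve M), T.Covers S ↔ T'.Covers S

/-- The covering system on `𝔲` induced along the functor `F : 𝔲 ⥤ 𝔳` by the covering system on `𝔳`
of all epimorphic families: a family is covering if its image under `F` is jointly epimorphic. For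
`F = 𝟭 𝔳`, this is the covering system on `𝔳` of all epimorphic families. -/
def epiCoverings (F : 𝔲 ⥤ 𝔳) : CoveringSystem 𝔲 where
  coverings M := {P | ∀ ⦃Z : 𝔳⦄ (a b : F.obj M ⟶ Z),
    (∀ ⦃N : 𝔲⦄ ⦃f : N ⟶ M⦄, P f → F.map f ≫ a = F.map f ≫ b) → a = b}
  id_mem M Z a b h := by simpa using h (Presieve.singleton.mk)
  bind_mem {M P} hP Q hQ Z a b h := hP a b fun N f hf ↦ hQ hf _ _ fun N' g hg ↦ by
    simpa using h (Presieve.bind_comp f hf hg)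

/-- Condition (G) for `F : 𝔲 ⥤ (𝔳, T)`: each object of `𝔳` has a `T`-covering by objects in the
image of `F`. -/
def SatisfiesG (F : 𝔲 ⥤ 𝔳) (T : CoveringSystem 𝔳) : Prop :=
  ∀ M : 𝔳, ∃ (ι : Type (max u₁ v₂)) (N : ι → 𝔲) (f : ∀ i, F.obj (N i) ⟶ M),
    Presieve.ofArrows (fun i ↦ F.obj (N i)) f ∈ T.coverings M

/-- Condition (F) for `F : (𝔲, T) ⥤ 𝔳`: each morphism `F N ⟶ F M` is in the image of `F` locally
on `N`. -/
def SatisfiesF (F : 𝔲 ⥤ 𝔳) (T : CoveringSystem 𝔲) : Prop :=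
  ∀ ⦃N M : 𝔲⦄ (y : F.obj N ⟶ F.obj M), ∃ P ∈ T.coverings N,
    ∀ ⦃N' : 𝔲⦄ ⦃f : N' ⟶ N⦄, P f → ∃ x : N' ⟶ M, F.map x = F.map f ≫ y

/-- Condition (FF) for `F : (𝔲, T) ⥤ 𝔳`: each morphism `N ⟶ M` sent to zero by `F` is zero
locally on `N`. -/
def SatisfiesFF [HasZeroMorphisms 𝔲] [HasZeroMorphisms 𝔳] (F : 𝔲 ⥤ 𝔳) (T : CoveringSystem 𝔲) :
    Prop :=
  ∀ ⦃N M : 𝔲⦄ (x : N ⟶ M), F.map x = 0 → ∃ P ∈ T.coverings N,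
    ∀ ⦃N' : 𝔲⦄ ⦃f : N' ⟶ N⦄, P f → f ≫ x = 0

end Coverings

section

variable (A : LocallyDiscrete (Opens X)ᵒᵖ ⥤ᵖ Cat.{v, u}) [∀ U, Preadditive (Fib A U)]
  [IsAdditive A] (U : Opens X)

/-- The covering system on `𝔞_U` induced by the open coverings: a covering of `A_V` is a family
of cartesian morphisms to `A_V` whose supports cover `V`. -/
def openCoverings : CoveringSystem (Tot A U) where
  coverings M := {P | (∀ ⦃N : Tot A U⦄ ⦃f : N ⟶ M⦄, P f → Tot.IsCartesian f) ∧
    ∀ p ∈ M.V, ∃ (N : Tot A U) (f : N ⟶ M), P f ∧ p ∈ N.V}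
  id_mem M := ⟨by rintro _ _ ⟨⟩; exact Tot.isCartesian_id M,
    fun p hp ↦ ⟨M, 𝟙 M, Presieve.singleton.mk, hp⟩⟩
  bind_mem {M P} hP Q hQ := by
    refine ⟨?_, fun p hp ↦ ?_⟩
    · rintro N _ ⟨N', g, f, hf, hg, rfl⟩
      exact ((hQ hf).1 hg).comp (hP.1 hf)
    · obtain ⟨N, f, hf, hp⟩ := hP.2 p hp
      obtain ⟨N', g, hg, hp⟩ := (hQ hf).2 p hp
      exact ⟨N', g ≫ f, Presieve.bind_comp f hf hg, hp⟩

end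

/-! ### Locally finitely presented and locally projective objects -/

section

variable (C : LocallyDiscrete (Opens X)ᵒᵖ ⥤ᵖ Cat.{v, u}) [∀ U, Abelian (Fib C U)]
  [IsAdditive C] {U : Opens X}

/-- `M` in `C(U)` is locally finitely presented if the functor `Hom(M, -) : C(U) ⥤ Mod(U)` to
sheaves of `R`-modules on `U` preserves filtered colimits. -/
def IsLocallyFinitelyPresented (R : Type v) [CommRing R] [∀ U, Linear R (Fib C U)] [IsLinear C R]
    [C.IsPrestack (Opens.grothendieckTopology X)] (M : Fib C U) : Prop :=
  PreservesFilteredColimitsOfSize.{v, v} ((homSheaf C R (le_refl U)).obj (op M))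

/-- `M` in `C(U)` is locally projective if, for `N` in `C(U)`, the sheaf associated to the presheaf
`V ↦ Ext¹(M|_V, N|_V)` on `U` is zero, i.e. the sections of this presheaf are locally zero. -/
def IsLocallyProjective [IsFiberedCategoryOfLocalizations C] (M : Fib C U) : Prop :=
  ∀ (N : Fib C U) ⦃V : Opens X⦄ (h : V ≤ U) (e : Ext ((res C h).obj M) ((res C h).obj N) 1),
    ∀ p ∈ V, ∃ (W : Opens X) (k : W ≤ V), p ∈ W ∧ e.mapExactFunctor (res C k) = 0

end

end

end FibCat

end

open FibCat

/-!
# Stacks of localizations as stacks of sheaves on a fibered category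

Write `G : 𝔞_U ⥤ C(U)` for the functor `A_V ↦ j_! φ(A_V)`. By adjunction, the sheaf on `A|_U`
induced by `N` in `C(U)` has the group `Hom(G x, N)` as its value at an object `x` of `𝔞_U`
(`valEquiv`), and a sheaf on `A|_U` is the same as an additive presheaf on `𝔞_U` satisfying the
gluing condition for open coverings (`SheafOn.homMk`, `SheafOn.isoMk`, `SheafOn.Sub`,
`SheafOn.existsUnique_glue`). The functor `C(U) ⥤ Mod(A|_U)` is thus the restricted Yoneda functor
of `G`. Since `C` is a prestack, open coverings are sent by `G` to epimorphic families
(`mem_epiCoverings_of_mem_openCoverings`). The three conditions are compared as follows.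

*From epimorphic families to the equivalence* (`isEquivalence_of_satisfies`). This is the additive
form of the recognition of sheaf categories. Given an additive presheaf `Φ` on `𝔞_U`, the tensor
product `Φ ⊗ G` is a cokernel of coproducts of objects `G x`; the conditions (G), (F) and (FF) for
epimorphic families imply that `Φ x ⟶ Hom(G x, Φ ⊗ G)` is locally injective and locally surjective
(`exists_tensor`). When epimorphic families and open coverings define the same topology, and `Φ` is
a sheaf, these maps are bijective by gluing.

*From the equivalence to the local conditions.* Let `K` be a family of morphisms `G x ⟶ N`, stable
under composition with `𝔞_U`, which is jointly epimorphic. The sections that belong to `K` locally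
are a subsheaf of the sheaf induced by `N`, so they correspond to a subobject of `N`, and this
subobject is `N` (`locallyMem_of_isEquivalence`). Suitable choices of `K` give (F), and the fact
that morphisms from restrictions of `φ(M)` lift locally along epimorphic families, as finite sums
(`HasLocalLifts`). Condition (FF) follows by looking at the sheaf on `A|_U` associated to
`Hom(-, N)` for `N` in `A(U)` (`satisfiesFF_of_isEquivalence`).

*Local lifts, finite presentation and projectivity.* Local lifts along epimorphic families exist
for an object that is locally finitely presented and locally projective
(`hasLocalLifts_of_isLocallyFinitelyPresented`), and conversely they imply these two properties when
they exist for all restrictions of the object (`isLocallyFinitelyPresented_of_hasLocalLifts`,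
`isLocallyProjective_of_hasLocalLifts`). In one direction, the target is the filtered colimit of the
images of the finite subfamilies, so that a morphism factors locally through such an image, and
`Ext¹` against the kernel obstructs the lifting. In the other direction, a filtered colimit is
covered by its stages, the kernel of a coprojection is covered by the kernels of the transition
morphisms, and `Ext¹` is effaceable.

*From the local conditions to epimorphic families* (`epiCoverings_equivalent_openCoverings`). If
`G z_i ⟶ G x` is an epimorphic family, lifting the identity of `G x` locally and using (F) and (FF)
shows that the restrictions of `x` to the members of an open covering belong to the additive sieve
generated by the morphisms `z_i ⟶ x`.
-/

noncomputable section

namespace FibCat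

section

variable {X : Type v} [TopologicalSpace X]

/-! ### Sections of sheaves on a fibered category -/

namespace SheafOn
variable {A : LocallyDiscrete (Opens X)ᵒᵖ ⥤ᵖ Cat.{v, u}} {R : Type v} [CommRing R]
  [∀ U, Preadditive (Fib A U)] [∀ U, Linear R (Fib A U)] {U V W T : Opens X} (F : SheafOn A R U)

/-- The module of sections of `F` over `T ≤ V` at the object `M` of `A(V)`. -/
abbrev secOver (h : V ≤ U) (M : Fib A V) (k : T ≤ V) : Type v :=
  (((F.sheaf h).obj (op M)).obj.obj (op (Over.mk (homOfLE k))) : ModuleCat.{v} R)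

/-- The module `F(M)(V)` of global sections of `F` at the object `M` of `A(V)`. -/
abbrev sec (h : V ≤ U) (M : Fib A V) : Type v := F.secOver h M (le_refl V)

/-- Restriction of sections over `T ≤ V` to `W ≤ T`, for a fixed object of `A(V)`. -/
def shrink (h : V ≤ U) (M : Fib A V) (k : T ≤ V) (l : W ≤ T) :
    F.secOver h M k →ₗ[R] F.secOver h M (l.trans k) :=
  (((F.sheaf h).obj (op M)).obj.map
    (Quiver.Hom.op (Over.homMk (homOfLE l) : Over.mk (homOfLE (l.trans k)) ⟶
      Over.mk (homOfLE k)))).hom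

/-- The action of a morphism of `A(V)` on sections over `T ≤ V`. -/
def actOver (h : V ≤ U) {M M' : Fib A V} (a : M ⟶ M') (k : T ≤ V) :
    F.secOver h M' k →ₗ[R] F.secOver h M k :=
  (((F.sheaf h).map a.op).hom.app (op (Over.mk (homOfLE k)))).hom

/-- The action of a morphism of `A(V)` on global sections. -/
abbrev act (h : V ≤ U) {M M' : Fib A V} (a : M ⟶ M') : F.sec h M' →ₗ[R] F.sec h M :=
  F.actOver h a le_rfl

/-- The isomorphism `F(M)|_W ≅ F(M|_W)` on sections over `T ≤ W`. -/
def comparison (h : V ≤ U) (M : Fib A V) (k : W ≤ V) (l : T ≤ W) :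
    F.secOver h M (l.trans k) ≃ₗ[R] F.secOver (k.trans h) ((res A k).obj M) l :=
  (((sheafToPresheaf _ _).mapIso ((F.resIso h k).app (op M))).app
    (op (Over.mk (homOfLE l)))).toLinearEquiv

/-- The identification of sections over `T ≤ V` at `M` with global sections at `M|_T`. -/
def germ (h : V ≤ U) (M : Fib A V) (k : T ≤ V) :
    F.secOver h M k ≃ₗ[R] F.sec (k.trans h) ((res A k).obj M) :=
  F.comparison h M k le_rfl

lemma actOver_comp (h : V ≤ U) {M M' M'' : Fib A V} (a : M ⟶ M') (b : M' ⟶ M'') (k : T ≤ V)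
    (s : F.secOver h M'' k) : F.actOver h (a ≫ b) k s = F.actOver h a k (F.actOver h b k s) := by
  simp [actOver]

lemma actOver_id (h : V ≤ U) {M : Fib A V} (k : T ≤ V)
    (s : F.secOver h M k) : F.actOver h (𝟙 M) k s = s := by
  simp [actOver]

lemma actOver_add (h : V ≤ U) {M M' : Fib A V} (a b : M ⟶ M') (k : T ≤ V)
    (s : F.secOver h M' k) : F.actOver h (a + b) k s = F.actOver h a k s + F.actOver h b k s := by
  have := F.map_add h a b (op (Over.mk (homOfLE k)))
  exact congrArg (fun f ↦ f.hom s) this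

lemma actOver_smul (h : V ≤ U) {M M' : Fib A V} (r : R) (a : M ⟶ M') (k : T ≤ V)
    (s : F.secOver h M' k) : F.actOver h (r • a) k s = r • F.actOver h a k s := by
  simp [actOver, F.map_smul]

lemma shrink_shrink (h : V ≤ U) (M : Fib A V) {T' : Opens X} (k : T ≤ V) (l : W ≤ T) (l' : T' ≤ W)
    (s : F.secOver h M k) :
    F.shrink h M (l.trans k) l' (F.shrink h M k l s) = F.shrink h M k (l'.trans l) s := by
  simp only [shrink, ← LinearMap.comp_apply, ← ModuleCat.hom_comp, ← Functor.map_comp]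
  rfl

lemma shrink_refl (h : V ≤ U) (M : Fib A V) (k : T ≤ V)
    (s : F.secOver h M k) :
    F.shrink h M k le_rfl s = s :=
  congrArg (fun f ↦ f.hom s) (((F.sheaf h).obj (op M)).obj.map_id _)

lemma shrink_actOver (h : V ≤ U) {M M' : Fib A V} (a : M ⟶ M') (k : T ≤ V) (l : W ≤ T)
    (s : F.secOver h M' k) :
    F.shrink h M k l (F.actOver h a k s) = F.actOver h a (l.trans k) (F.shrink h M' k l s) :=
  (congrArg (fun f ↦ f.hom s) (((F.sheaf h).map a.op).hom.naturality
    (Quiver.Hom.op (Over.homMk (homOfLE l) : Over.mk (homOfLE (l.trans k)) ⟶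
      Over.mk (homOfLE k))))).symm

lemma comparison_shrink (h : V ≤ U) (M : Fib A V) (k : W ≤ V) {T' : Opens X} (l : T ≤ W)
    (l' : T' ≤ T)
    (s : F.secOver h M (l.trans k)) :
    F.comparison h M k (l'.trans l) (F.shrink h M (l.trans k) l' s) =
      F.shrink (k.trans h) ((res A k).obj M) l l' (F.comparison h M k l s) :=
  (congrArg (fun f ↦ f.hom s) (((F.resIso h k).hom.app (op M)).hom.naturality
    (Quiver.Hom.op (Over.homMk (homOfLE l') : Over.mk (homOfLE (l'.trans l)) ⟶
      Over.mk (homOfLE l)))))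

lemma comparison_actOver (h : V ≤ U) {M M' : Fib A V} (a : M ⟶ M') (k : W ≤ V) (l : T ≤ W)
    (s : F.secOver h M' (l.trans k)) :
    F.comparison h M k l (F.actOver h a (l.trans k) s) =
      F.actOver (k.trans h) ((res A k).map a) l (F.comparison h M' k l s) :=
  congrArg (fun f ↦ (f.hom.app (op (Over.mk (homOfLE l)))).hom s)
    ((F.resIso h k).hom.naturality a.op)

lemma comparison_comparison (h : V ≤ U) (M : Fib A V) (k : W ≤ V) {T' : Opens X} (l : T ≤ W)
    (l' : T' ≤ T)
    (s : F.secOver h M (l'.trans (l.trans k))) :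
    F.comparison (k.trans h) ((res A k).obj M) l l' (F.comparison h M k (l'.trans l) s) =
      F.actOver ((l.trans k).trans h) (resComp A k l M).inv l'
        (F.comparison h M (l.trans k) l' s) :=
  (congrArg (fun f ↦ (f.hom.app (op (Over.mk (homOfLE l')))).hom s) (F.resIso_comp h k l M)).trans
    (congrArg (fun t ↦ F.actOver ((l.trans k).trans h) (resComp A k l M).inv l'
      (F.comparison h M (l.trans k) l' t)) (F.shrink_refl h M _ s))

/-- Restriction `F(M)(V) ⟶ F(M|_W)(W)`. -/
def restr (h : V ≤ U) (M : Fib A V) (k : W ≤ V) :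
    F.sec h M →ₗ[R] F.sec (k.trans h) ((res A k).obj M) :=
  (F.germ h M k).toLinearMap ∘ₗ F.shrink h M le_rfl k

lemma restr_act (h : V ≤ U) {M M' : Fib A V} (a : M ⟶ M') (k : W ≤ V) (s : F.sec h M') :
    F.restr h M k (F.act h a s) = F.act (k.trans h) ((res A k).map a) (F.restr h M' k s) := by
  have h1 := F.shrink_actOver h a le_rfl k s
  have h2 := F.comparison_actOver h a k le_rfl (F.shrink h M' le_rfl k s)
  exact (congrArg (F.comparison h M k le_rfl) h1).trans h2

lemma restr_germ (h : V ≤ U) (M : Fib A V) (k : T ≤ V) (l : W ≤ T) (s : F.secOver h M k) :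
    F.restr (k.trans h) ((res A k).obj M) l (F.germ h M k s) =
      F.act ((l.trans k).trans h) (resComp A k l M).inv
        (F.germ h M (l.trans k) (F.shrink h M k l s)) := by
  have h1 := F.comparison_shrink h M k le_rfl l s
  have h2 := F.comparison_comparison h M k l le_rfl (F.shrink h M k l s)
  exact (congrArg (F.comparison (k.trans h) _ l le_rfl) h1).symm.trans h2

lemma restr_restr (h : V ≤ U) (M : Fib A V) (k : W ≤ V) (l : T ≤ W) (s : F.sec h M) :
    F.restr (k.trans h) ((res A k).obj M) l (F.restr h M k s) =
      F.act ((l.trans k).trans h) (resComp A k l M).inv (F.restr h M (l.trans k) s) := by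
  refine (F.restr_germ h M k l _).trans (congrArg _ (congrArg _ ?_))
  exact F.shrink_shrink h M le_rfl k l s

lemma germ_comparison (h : V ≤ U) (M : Fib A V) (k : W ≤ V) (l : T ≤ W)
    (s : F.secOver h M (l.trans k)) :
    F.germ (k.trans h) ((res A k).obj M) l (F.comparison h M k l s) =
      F.act ((l.trans k).trans h) (resComp A k l M).inv (F.germ h M (l.trans k) s) :=
  F.comparison_comparison h M k l le_rfl s

lemma germ_actOver (h : V ≤ U) {M M' : Fib A V} (a : M ⟶ M') (k : T ≤ V) (s : F.secOver h M' k) :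
    F.germ h M k (F.actOver h a k s) = F.act (k.trans h) ((res A k).map a) (F.germ h M' k s) :=
  F.comparison_actOver h a k le_rfl s

lemma germ_eq_restr (h : V ≤ U) (M : Fib A V) (s : F.sec h M) :
    F.germ h M le_rfl s = F.restr h M le_rfl s :=
  congrArg (F.germ h M le_rfl) (F.shrink_refl h M le_rfl s).symm

end SheafOn

/-! ### The presheaf on the total category defined by a sheaf -/

namespace Tot
variable {A : LocallyDiscrete (Opens X)ᵒᵖ ⥤ᵖ Cat.{v, u}}
  [∀ U, Preadditive (Fib A U)] [IsAdditive A] {U V W T : Opens X}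

/-- The restriction of an object of `𝔞_U` to a smaller open set. -/
abbrev restrict (x : Tot A U) (k : W ≤ x.V) : Tot A U := ⟨W, k.trans x.le, (res A k).obj x.obj⟩

/-- The morphism of `𝔞_U` lying over `V ≤ W` given by a morphism of `A(V)`. -/
def homMk {x y : Tot A U} (h : x.V ≤ y.V) (a : x.obj ⟶ (res A h).obj y.obj) : x ⟶ y :=
  Hom.mk fun _ ↦ a

/-- The canonical morphism `A_V|_W ⟶ A_V`. -/
def ι (x : Tot A U) (k : W ≤ x.V) : x.restrict k ⟶ x := homMk (x := x.restrict k) k (𝟙 _)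

lemma id_hom (x : Tot A U) (h : x.V ≤ x.V) : Hom.hom (𝟙 x) h = (resId A x.obj).inv := rfl

lemma hom_ext' {x y : Tot A U} (h : x.V ≤ y.V) {f g : x ⟶ y} (w : f.hom h = g.hom h) : f = g :=
  hom_ext fun _ ↦ w

lemma eq_zero_of_not_le {x y : Tot A U} (h : ¬ x.V ≤ y.V) (f : x ⟶ y) : f = 0 :=
  hom_ext fun h' ↦ (h h').elim

end Tot

namespace SheafOn
variable {A : LocallyDiscrete (Opens X)ᵒᵖ ⥤ᵖ Cat.{v, u}} {R : Type v} [CommRing R]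
  [∀ U, Preadditive (Fib A U)] [∀ U, Linear R (Fib A U)] [IsAdditive A]
  {U V W T : Opens X} (F : SheafOn A R U)

/-- The value of `F` at an object of `𝔞_U`. -/
abbrev val (x : Tot A U) : Type v := F.sec x.le x.obj

/-- The restriction map of `F` along a morphism of `𝔞_U`. There are no nonzero morphisms to `y` if the
support of `x` is not contained in the support of `y`. -/
def pb {x y : Tot A U} (f : x ⟶ y) : F.val y →ₗ[R] F.val x :=
  open Classical in
  if h : x.V ≤ y.V then F.act x.le (f.hom h) ∘ₗ F.restr y.le y.obj h else 0

lemma pb_apply {x y : Tot A U} (f : x ⟶ y) (h : x.V ≤ y.V) (s : F.val y) :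
    F.pb f s = F.act x.le (f.hom h) (F.restr y.le y.obj h s) := by
  rw [pb, dif_pos h]; rfl

lemma actOver_zero (h : V ≤ U) {M M' : Fib A V} (k : T ≤ V)
    (s : F.secOver h M' k) : F.actOver h (0 : M ⟶ M') k s = 0 := by
  have := F.actOver_add h (0 : M ⟶ M') 0 k s
  simpa using this

lemma pb_zero {x y : Tot A U} (s : F.val y) : F.pb (0 : x ⟶ y) s = 0 := by
  by_cases h : x.V ≤ y.V
  · rw [F.pb_apply _ h]; exact F.actOver_zero _ _ _
  · rw [pb, dif_neg h]; rfl

lemma pb_add {x y : Tot A U} (f g : x ⟶ y) (s : F.val y) :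
    F.pb (f + g) s = F.pb f s + F.pb g s := by
  by_cases h : x.V ≤ y.V
  · rw [F.pb_apply _ h, F.pb_apply _ h, F.pb_apply _ h]; exact F.actOver_add _ _ _ _ _
  · simp [pb, h]

lemma pb_comp {x y z : Tot A U} (f : x ⟶ y) (g : y ⟶ z) (s : F.val z) :
    F.pb (f ≫ g) s = F.pb f (F.pb g s) := by
  by_cases h : x.V ≤ y.V
  · by_cases k : y.V ≤ z.V
    · rw [F.pb_apply _ h, F.pb_apply _ k, F.pb_apply _ (h.trans k), restr_act, restr_restr,
        Tot.comp_hom f g h k, act, actOver_comp, actOver_comp]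
    · rw [Tot.eq_zero_of_not_le k g, comp_zero, pb_zero, pb_zero, map_zero]
  · rw [Tot.eq_zero_of_not_le h f, zero_comp, pb_zero, pb_zero]

/-- The identity acts trivially: it acts by an idempotent which is injective, as it is the composition
of two coherence isomorphisms. -/
lemma pb_id (x : Tot A U) (s : F.val x) : F.pb (𝟙 x) s = s := by
  have h1 : Function.Injective (F.pb (𝟙 x)) := by
    intro s t hst
    rw [F.pb_apply _ le_rfl, F.pb_apply _ le_rfl] at hst
    have h2 : Function.Injective (F.act x.le (Tot.Hom.hom (𝟙 x) le_rfl)) := by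
      refine Function.LeftInverse.injective (g := F.act x.le (resId A x.obj).hom) fun s ↦ ?_
      rw [Tot.id_hom, act, ← actOver_comp, Iso.hom_inv_id, actOver_id]
    have h3 := h2 hst
    rw [← germ_eq_restr, ← germ_eq_restr] at h3
    exact (F.germ _ _ _).injective h3
  apply h1
  rw [← pb_comp, Category.comp_id]

lemma restr_eq_pb (x : Tot A U) (k : W ≤ x.V) (s : F.val x) :
    F.restr x.le x.obj k s = F.pb (x.ι k) s := by
  rw [F.pb_apply (x := x.restrict k) _ k]
  exact (F.actOver_id _ _ _).symm

/-- The action of a morphism of `A(V)` in terms of `𝔞_U`. -/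
lemma act_eq_pb (h : V ≤ U) {M M' : Fib A V} (a : M ⟶ M') (s : F.sec h M') :
    F.act h a s = F.pb (x := ⟨V, h, M⟩) (y := ⟨V, h, M'⟩)
      (Tot.homMk (x := ⟨V, h, M⟩) (y := ⟨V, h, M'⟩) le_rfl (a ≫ (resId A M').inv)) s := by
  refine Eq.trans ?_ (F.pb_apply (x := ⟨V, h, M⟩) (y := ⟨V, h, M'⟩) _ le_rfl s).symm
  refine Eq.trans ?_ (F.actOver_comp _ _ _ _ _).symm
  refine congrArg _ ?_
  refine (F.pb_id ⟨V, h, M'⟩ s).symm.trans ?_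
  rw [F.pb_apply _ le_rfl]
  rfl

/-- The canonical morphism `A_V|_W ⟶ A_V|_T` for `W ≤ T ≤ V`. -/
def _root_.FibCat.Tot.ιι (h : V ≤ U) (M : Fib A V) (k : T ≤ V) (l : W ≤ T) :
    (⟨W, (l.trans k).trans h, (res A (l.trans k)).obj M⟩ : Tot A U) ⟶
      ⟨T, k.trans h, (res A k).obj M⟩ :=
  Tot.homMk (x := ⟨W, (l.trans k).trans h, (res A (l.trans k)).obj M⟩)
    (y := ⟨T, k.trans h, (res A k).obj M⟩) l (resComp A k l M).hom

lemma germ_shrink (h : V ≤ U) (M : Fib A V) (k : T ≤ V) (l : W ≤ T) (s : F.secOver h M k) :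
    F.germ h M (l.trans k) (F.shrink h M k l s) =
      F.pb (Tot.ιι h M k l) (F.germ h M k s) := by
  rw [F.pb_apply (Tot.ιι h M k l) l, restr_germ]
  refine Eq.trans ?_ (F.actOver_comp _ _ _ _ _)
  change _ = F.actOver _ ((resComp A k l M).hom ≫ _) _ _
  rw [Iso.hom_inv_id, actOver_id]

lemma germ_eq_pb (x : Tot A U) (k : W ≤ x.V) (s : F.val x) :
    F.germ x.le x.obj k (F.shrink x.le x.obj le_rfl k s) = F.pb (x.ι k) s :=
  F.restr_eq_pb x k s

section

variable {F} {G : SheafOn A R U} (θ : F ⟶ G)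

/-- The map induced by a morphism of sheaves on sections over `T ≤ V`. -/
def mapOver (h : V ≤ U) (M : Fib A V) (k : T ≤ V) : F.secOver h M k →ₗ[R] G.secOver h M k :=
  (((Hom.app θ h).app (op M)).hom.app (op (Over.mk (homOfLE k)))).hom

/-- The map induced by a morphism of sheaves on the values at an object of `𝔞_U`. -/
abbrev mapVal (x : Tot A U) : F.val x →ₗ[R] G.val x := mapOver θ x.le x.obj le_rfl

lemma mapOver_shrink (h : V ≤ U) (M : Fib A V) (k : T ≤ V) (l : W ≤ T) (s : F.secOver h M k) :
    mapOver θ h M (l.trans k) (F.shrink h M k l s) = G.shrink h M k l (mapOver θ h M k s) :=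
  (congrArg (fun f ↦ f.hom s) (((Hom.app θ h).app (op M)).hom.naturality
    (Quiver.Hom.op (Over.homMk (homOfLE l) : Over.mk (homOfLE (l.trans k)) ⟶ Over.mk (homOfLE k)))))

lemma mapOver_actOver (h : V ≤ U) {M M' : Fib A V} (a : M ⟶ M') (k : T ≤ V)
    (s : F.secOver h M' k) :
    mapOver θ h M k (F.actOver h a k s) = G.actOver h a k (mapOver θ h M' k s) :=
  congrArg (fun f ↦ (f.hom.app (op (Over.mk (homOfLE k)))).hom s) ((Hom.app θ h).naturality a.op)

lemma mapOver_comparison (h : V ≤ U) (M : Fib A V) (k : W ≤ V) (l : T ≤ W)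
    (s : F.secOver h M (l.trans k)) :
    mapOver θ (k.trans h) ((res A k).obj M) l (F.comparison h M k l s) =
      G.comparison h M k l (mapOver θ h M (l.trans k) s) :=
  congrArg (fun f ↦ (f.hom.app (op (Over.mk (homOfLE l)))).hom s) (Hom.resIso_app θ h k (op M))

lemma mapOver_germ (h : V ≤ U) (M : Fib A V) (k : T ≤ V) (s : F.secOver h M k) :
    mapOver θ (k.trans h) ((res A k).obj M) le_rfl (F.germ h M k s) =
      G.germ h M k (mapOver θ h M k s) :=
  mapOver_comparison θ h M k le_rfl s

lemma mapVal_pb {x y : Tot A U} (f : x ⟶ y) (s : F.val y) :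
    mapVal θ x (F.pb f s) = G.pb f (mapVal θ y s) := by
  by_cases h : x.V ≤ y.V
  · rw [F.pb_apply f h, G.pb_apply f h, mapVal, act, mapOver_actOver]
    refine congrArg _ ?_
    exact (mapOver_germ θ y.le y.obj h _).trans (congrArg _ (mapOver_shrink θ _ _ _ _ _))
  · rw [Tot.eq_zero_of_not_le h f, pb_zero, pb_zero, map_zero]

lemma mapVal_comp {H : SheafOn A R U} (θ : F ⟶ G) (θ' : G ⟶ H) (x : Tot A U) (s : F.val x) :
    mapVal (θ ≫ θ') x s = mapVal θ' x (mapVal θ x s) := rfl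

lemma mapVal_id (x : Tot A U) (s : F.val x) : mapVal (𝟙 F) x s = s := rfl

/-- A morphism of sheaves is determined by its effect on global sections, since sections over `T ≤ V`
at `M` are global sections at `M|_T`. -/
lemma hom_ext_val {θ θ' : F ⟶ G} (w : ∀ x (s : F.val x), mapVal θ x s = mapVal θ' x s) :
    θ = θ' := by
  ext V h : 1
  refine NatTrans.ext (funext fun M ↦ ?_)
  ext T s
  have h1 (θ : F ⟶ G) := mapOver_germ θ h M.unop T.unop.hom.le s
  have h2 := w ⟨T.unop.left, T.unop.hom.le.trans h, (res A T.unop.hom.le).obj M.unop⟩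
     (F.germ h M.unop T.unop.hom.le s)
  rw [mapVal, mapVal, h1 θ, h1 θ'] at h2
  exact (G.germ h M.unop T.unop.hom.le).injective h2

end

end SheafOn

end

section

variable {X : Type v} [TopologicalSpace X]

/-! ### Morphisms of sheaves defined on the total category -/

namespace SheafOn
variable {A : LocallyDiscrete (Opens X)ᵒᵖ ⥤ᵖ Cat.{v, u}} {R : Type v} [CommRing R]
  [∀ U, Preadditive (Fib A U)] [∀ U, Linear R (Fib A U)] [IsAdditive A]
  {U V W T : Opens X} {F G : SheafOn A R U}

section homMk

variable (α : ∀ x : Tot A U, F.val x →+ G.val x)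
  (hα : ∀ {x y : Tot A U} (f : x ⟶ y) (s : F.val y), α x (F.pb f s) = G.pb f (α y s))

include hα

lemma map_act_of_pb (h : V ≤ U) {M M' : Fib A V} (a : M ⟶ M') (s : F.sec h M') :
    α ⟨V, h, M⟩ (F.act h a s) = G.act h a (α ⟨V, h, M'⟩ s) := by
  rw [act_eq_pb, act_eq_pb]
  exact hα (x := ⟨V, h, M⟩) (y := ⟨V, h, M'⟩) _ s

/-- Additive maps commuting with the restriction maps along the morphisms of `𝔞_U` are linear, as
scalars act through the endomorphisms of the objects of `A(V)`. -/
lemma map_smul_of_pb (x : Tot A U) (r : R) (s : F.val x) : α x (r • s) = r • α x s := by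
  have := map_act_of_pb α hα x.le (r • 𝟙 x.obj) s
  rwa [act, act, actOver_smul, actOver_smul, actOver_id, actOver_id] at this

/-- The linear map on sections over `T ≤ V` induced by `α`. -/
def homMkOver (h : V ≤ U) (M : Fib A V) (k : T ≤ V) : F.secOver h M k →ₗ[R] G.secOver h M k :=
  (G.germ h M k).symm.toLinearMap ∘ₗ
    { toFun := α ⟨T, k.trans h, (res A k).obj M⟩
      map_add' := _root_.map_add _
      map_smul' := map_smul_of_pb α hα _ } ∘ₗ (F.germ h M k).toLinearMap

lemma germ_homMkOver (h : V ≤ U) (M : Fib A V) (k : T ≤ V) (s : F.secOver h M k) :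
    G.germ h M k (homMkOver α hα h M k s) =
      α ⟨T, k.trans h, (res A k).obj M⟩ (F.germ h M k s) :=
  (G.germ h M k).apply_symm_apply _

lemma homMkOver_shrink (h : V ≤ U) (M : Fib A V) (k : T ≤ V) (l : W ≤ T) (s : F.secOver h M k) :
    homMkOver α hα h M (l.trans k) (F.shrink h M k l s) =
      G.shrink h M k l (homMkOver α hα h M k s) := by
  apply (G.germ h M _).injective
  rw [germ_homMkOver, germ_shrink, germ_shrink, germ_homMkOver, hα]

lemma homMkOver_actOver (h : V ≤ U) {M M' : Fib A V} (a : M ⟶ M') (k : T ≤ V)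
    (s : F.secOver h M' k) :
    homMkOver α hα h M k (F.actOver h a k s) = G.actOver h a k (homMkOver α hα h M' k s) := by
  apply (G.germ h M _).injective
  rw [germ_homMkOver, germ_actOver, germ_actOver, germ_homMkOver]
  exact map_act_of_pb α hα _ _ _

lemma homMkOver_comparison (h : V ≤ U) (M : Fib A V) (k : W ≤ V) (l : T ≤ W)
    (s : F.secOver h M (l.trans k)) :
    homMkOver α hα (k.trans h) ((res A k).obj M) l (F.comparison h M k l s) =
      G.comparison h M k l (homMkOver α hα h M (l.trans k) s) := by
  apply (G.germ _ _ _).injective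
  rw [germ_homMkOver, germ_comparison, germ_comparison, germ_homMkOver]
  exact map_act_of_pb α hα _ _ _

lemma homMkOver_self (x : Tot A U) (s : F.val x) :
    homMkOver α hα x.le x.obj le_rfl s = α x s := by
  apply (G.germ _ _ _).injective
  rw [germ_homMkOver, germ_eq_restr, germ_eq_restr, restr_eq_pb, restr_eq_pb]
  exact hα _ _

/-- The morphism of sheaves on `A|_U` given by additive maps between their values at the objects
of `𝔞_U`, compatible with the restriction maps along the morphisms of `𝔞_U`. -/
def homMk : F ⟶ G where
  app h :=
    { app M := ⟨
        { app T := ModuleCat.ofHom (homMkOver α hα h M.unop T.unop.hom.le)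
          naturality T T' p := by
            ext s
            exact homMkOver_shrink α hα h M.unop T.unop.hom.le p.unop.left.le s }⟩
      naturality M M' a := by
        ext T s
        exact homMkOver_actOver α hα h a.unop T.unop.hom.le s }
  resIso_app h k M := by
    ext T s
    exact homMkOver_comparison α hα h M.unop k T.unop.hom.le s

lemma mapVal_homMk (x : Tot A U) (s : F.val x) : mapVal (homMk α hα) x s = α x s :=
  homMkOver_self α hα x s

end homMk

lemma homMk_inv_pb (e : ∀ x : Tot A U, F.val x ≃+ G.val x)
    (he : ∀ {x y : Tot A U} (f : x ⟶ y) (s : F.val y), e x (F.pb f s) = G.pb f (e y s))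
    {x y : Tot A U} (f : x ⟶ y) (t : G.val y) :
    (e x).symm (G.pb f t) = F.pb f ((e y).symm t) := by
  apply (e x).injective
  rw [AddEquiv.apply_symm_apply, he, AddEquiv.apply_symm_apply]

/-- The isomorphism of sheaves on `A|_U` given by bijective additive maps between their values. -/
def isoMk (e : ∀ x : Tot A U, F.val x ≃+ G.val x)
    (he : ∀ {x y : Tot A U} (f : x ⟶ y) (s : F.val y), e x (F.pb f s) = G.pb f (e y s)) :
    F ≅ G where
  hom := homMk (fun x ↦ (e x).toAddMonoidHom) he
  inv := homMk (fun x ↦ (e x).symm.toAddMonoidHom) (homMk_inv_pb e he)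
  hom_inv_id := hom_ext_val fun x s ↦
    (mapVal_homMk (fun x ↦ (e x).symm.toAddMonoidHom) (homMk_inv_pb e he) x _).trans
      ((congrArg (e x).symm (mapVal_homMk (fun x ↦ (e x).toAddMonoidHom) he x s)).trans
        ((e x).symm_apply_apply s))
  inv_hom_id := hom_ext_val fun x s ↦
    (mapVal_homMk (fun x ↦ (e x).toAddMonoidHom) he x _).trans
      ((congrArg (e x)
        (mapVal_homMk (fun x ↦ (e x).symm.toAddMonoidHom) (homMk_inv_pb e he) x s)).trans
        ((e x).apply_symm_apply s))

/-! ### Subsheaves -/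

variable (F) in
/-- A subsheaf of a sheaf `F` on `A|_U`, as a subpresheaf of the presheaf on `𝔞_U` given by the
values of `F`, containing all sections that belong to it locally. -/
structure Sub where
  carrier (x : Tot A U) : AddSubgroup (F.val x)
  pb_mem {x y : Tot A U} (f : x ⟶ y) {s : F.val y} (hs : s ∈ carrier y) : F.pb f s ∈ carrier x
  local_mem {x : Tot A U} (s : F.val x)
    (hs : ∀ p ∈ x.V, ∃ (W : Opens X) (k : W ≤ x.V), p ∈ W ∧
      F.pb (x.ι k) s ∈ carrier (x.restrict k)) :
    s ∈ carrier x

namespace Sub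

variable (I : Sub F)

lemma act_mem (h : V ≤ U) {M M' : Fib A V} (a : M ⟶ M') {s : F.sec h M'}
    (hs : s ∈ I.carrier ⟨V, h, M'⟩) : F.act h a s ∈ I.carrier ⟨V, h, M⟩ := by
  rw [act_eq_pb]
  exact I.pb_mem _ hs

lemma smul_mem (x : Tot A U) (r : R) {s : F.val x} (hs : s ∈ I.carrier x) :
    r • s ∈ I.carrier x := by
  have := I.act_mem x.le (r • 𝟙 x.obj) hs
  rwa [act, actOver_smul, actOver_id] at this

/-- The submodule of sections over `T ≤ V` that belong to the subsheaf. -/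
def sections (h : V ≤ U) (M : Fib A V) (k : T ≤ V) : Submodule R (F.secOver h M k) :=
  Submodule.comap (F.germ h M k).toLinearMap
    { __ := I.carrier ⟨T, k.trans h, (res A k).obj M⟩
      smul_mem' := fun r _ hs ↦ I.smul_mem _ r hs }

lemma mem_sections (h : V ≤ U) (M : Fib A V) (k : T ≤ V) (s : F.secOver h M k) :
    s ∈ I.sections h M k ↔ F.germ h M k s ∈ I.carrier ⟨T, k.trans h, (res A k).obj M⟩ := Iff.rfl

lemma mem_carrier_iff_ι (x : Tot A U) (s : F.val x) :
    s ∈ I.carrier x ↔ F.pb (x.ι le_rfl) s ∈ I.carrier (x.restrict le_rfl) := by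
  refine ⟨I.pb_mem _, fun h ↦ ?_⟩
  exact I.local_mem s fun p hp ↦ ⟨x.V, le_rfl, hp, h⟩

lemma mem_sections_self (x : Tot A U) (s : F.val x) :
    s ∈ I.sections x.le x.obj le_rfl ↔ s ∈ I.carrier x := by
  refine Iff.trans ?_ (I.mem_carrier_iff_ι x s).symm
  rw [mem_sections, germ_eq_restr, restr_eq_pb]

lemma shrink_mem (h : V ≤ U) (M : Fib A V) (k : T ≤ V) (l : W ≤ T) {s : F.secOver h M k}
    (hs : s ∈ I.sections h M k) : F.shrink h M k l s ∈ I.sections h M (l.trans k) := by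
  rw [mem_sections, germ_shrink]
  exact I.pb_mem _ hs

lemma actOver_mem (h : V ≤ U) {M M' : Fib A V} (a : M ⟶ M') (k : T ≤ V) {s : F.secOver h M' k}
    (hs : s ∈ I.sections h M' k) : F.actOver h a k s ∈ I.sections h M k := by
  rw [mem_sections, germ_actOver]
  exact I.act_mem _ _ hs

lemma comparison_mem_iff (h : V ≤ U) (M : Fib A V) (k : W ≤ V) (l : T ≤ W)
    (s : F.secOver h M (l.trans k)) :
    F.comparison h M k l s ∈ I.sections (k.trans h) ((res A k).obj M) l ↔
      s ∈ I.sections h M (l.trans k) := by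
  rw [mem_sections, mem_sections, germ_comparison]
  refine ⟨fun hs ↦ ?_, fun hs ↦ I.act_mem _ _ hs⟩
  have := I.act_mem _ (resComp A k l M).hom hs
  rwa [act, act, ← actOver_comp, Iso.hom_inv_id, actOver_id] at this

/-- The presheaf of modules underlying a subsheaf, at an object of `A(V)`. -/
def presheaf (h : V ≤ U) (M : Fib A V) : (Over V)ᵒᵖ ⥤ ModuleCat.{v} R where
  obj T := ModuleCat.of R (I.sections h M T.unop.hom.le)
  map {T T'} p := ModuleCat.ofHom
    ((F.shrink h M T.unop.hom.le p.unop.left.le).restrict fun _ hs ↦ I.shrink_mem h M _ _ hs)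
  map_id T := by
    ext s
    exact F.shrink_refl h M T.unop.hom.le s.1
  map_comp {T T' T''} p q := by
    ext s
    exact (F.shrink_shrink h M T.unop.hom.le p.unop.left.le q.unop.left.le s.1).symm

/-- The subpresheaf of sets underlying a subsheaf, at an object of `A(V)`. -/
def subfunctor (h : V ≤ U) (M : Fib A V) :
    Subfunctor (((F.sheaf h).obj (op M)).obj ⋙ forget (ModuleCat.{v} R)) where
  obj T := {s : F.secOver h M T.unop.hom.le | s ∈ I.sections h M T.unop.hom.le}
  map p _ hs := I.shrink_mem h M _ p.unop.left.le hs

lemma isSheaf_presheaf (h : V ≤ U) (M : Fib A V) :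
    Presheaf.IsSheaf ((Opens.grothendieckTopology X).over V) (I.presheaf h M) := by
  rw [Presheaf.isSheaf_iff_isSheaf_forget _ _ (forget (ModuleCat.{v} R))]
  rw [isSheaf_iff_isSheaf_of_type]
  change Presieve.IsSheaf _ (I.subfunctor h M).toFunctor
  have h0 : Presieve.IsSheaf ((Opens.grothendieckTopology X).over V)
      (((F.sheaf h).obj (op M)).obj ⋙ forget (ModuleCat.{v} R)) := by
    rw [← isSheaf_iff_isSheaf_of_type, ← Presheaf.isSheaf_iff_isSheaf_forget]
    exact ((F.sheaf h).obj (op M)).property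
  rw [Subfunctor.isSheaf_iff _ h0]
  intro T s hs
  let s' : F.secOver h M T.unop.hom.le := s
  change s' ∈ I.sections h M T.unop.hom.le
  rw [mem_sections]
  refine I.local_mem _ fun p hp ↦ ?_
  rw [GrothendieckTopology.mem_over_iff] at hs
  obtain ⟨W, f, hf, hpW⟩ := hs p hp
  rw [Sieve.overEquiv_iff] at hf
  refine ⟨W, f.le, hpW, ?_⟩
  change F.shrink h M T.unop.hom.le f.le s' ∈ I.sections h M _ at hf
  rw [← restr_eq_pb]
  exact (congrArg (· ∈ I.carrier _) (F.restr_germ h M T.unop.hom.le f.le s')).mpr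
    (I.act_mem _ _ hf)

/-- The component over `V` of a subsheaf as a sheaf on `A|_U`. -/
def functor (h : V ≤ U) : (Fib A V)ᵒᵖ ⥤ ModSh R V where
  obj M := ⟨I.presheaf h M.unop, I.isSheaf_presheaf h M.unop⟩
  map {M M'} a := ⟨
    { app T := ModuleCat.ofHom
        ((F.actOver h a.unop T.unop.hom.le).restrict fun _ hs ↦ I.actOver_mem h _ _ hs)
      naturality T T' p := by
        ext s
        exact Subtype.ext (F.shrink_actOver h a.unop T.unop.hom.le p.unop.left.le s.1).symm }⟩
  map_id M := by
    ext T s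
    exact Subtype.ext (F.actOver_id h T.unop.hom.le s.1)
  map_comp a b := by
    ext T s
    exact Subtype.ext (F.actOver_comp h b.unop a.unop T.unop.hom.le s.1)

/-- The comparison isomorphisms of `F` restrict to a subsheaf. -/
def comparisonEquiv (h : V ≤ U) (M : Fib A V) (k : W ≤ V) (l : T ≤ W) :
    I.sections h M (l.trans k) ≃ₗ[R] I.sections (k.trans h) ((res A k).obj M) l :=
  LinearEquiv.ofSubmodules (F.comparison h M k l) _ _ (by
    ext t
    obtain ⟨s, rfl⟩ := (F.comparison h M k l).surjective t
    rw [comparison_mem_iff]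
    refine ⟨?_, fun hs ↦ ⟨s, hs, rfl⟩⟩
    rintro ⟨s', hs', e⟩
    rwa [← (F.comparison h M k l).injective e])

/-- The compatibility of a subsheaf with restriction. -/
def functorResIso (h : V ≤ U) (k : W ≤ V) :
    I.functor h ⋙ modRes R k ≅ (res A k).op ⋙ I.functor (k.trans h) :=
  NatIso.ofComponents
    (fun M ↦ (fullyFaithfulSheafToPresheaf _ _).preimageIso (NatIso.ofComponents
      (fun T ↦ (I.comparisonEquiv h M.unop k T.unop.hom.le).toModuleIso)
      (by
        intro T T' p
        ext s
        exact Subtype.ext (F.comparison_shrink h M.unop k T.unop.hom.le p.unop.left.le s.1))))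
    (by
      intro M M' a
      ext T s
      exact Subtype.ext (F.comparison_actOver h a.unop k T.unop.hom.le s.1))

/-- A subsheaf as a sheaf on `A|_U`. -/
def toSheafOn : SheafOn A R U where
  sheaf h := I.functor h
  map_add h M M' a b T := by
    ext s
    exact Subtype.ext (F.actOver_add h a b T.unop.hom.le s.1)
  map_smul h M M' r a T := by
    ext s
    exact Subtype.ext (F.actOver_smul h r a T.unop.hom.le s.1)
  resIso h k := I.functorResIso h k
  resIso_comp h k l M := by
    ext T s
    refine Subtype.ext ?_
    refine (F.comparison_comparison h M k l T.unop.hom.le s.1).trans ?_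
    exact congrArg (fun t ↦ F.actOver _ (resComp A k l M).inv _ (F.comparison h M _ _ t))
      (F.shrink_refl h M _ s.1).symm

/-- The inclusion of a subsheaf. -/
def incl : I.toSheafOn ⟶ F where
  app h :=
    { app M := ⟨
        { app T := ModuleCat.ofHom (I.sections h M.unop T.unop.hom.le).subtype
          naturality T T' p := by
            ext s
            rfl }⟩
      naturality M M' a := by
        ext T s
        rfl }
  resIso_app h k M := by
    ext T s
    rfl

lemma mapVal_incl_injective (x : Tot A U) : Function.Injective (mapVal I.incl x) :=
  Subtype.val_injective

lemma mapVal_incl_mem (x : Tot A U) (s : I.toSheafOn.val x) : mapVal I.incl x s ∈ I.carrier x :=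
  (I.mem_sections_self x _).1 s.2

lemma exists_mapVal_incl {x : Tot A U} {s : F.val x} (hs : s ∈ I.carrier x) :
    ∃ t, mapVal I.incl x t = s :=
  ⟨⟨s, (I.mem_sections_self x _).2 hs⟩, rfl⟩

instance : Mono I.incl := ⟨fun _ _ h ↦ hom_ext_val fun x s ↦ I.mapVal_incl_injective x
  (congrArg (fun t ↦ mapVal t x s) h)⟩

end Sub

end SheafOn

end

section

variable {X : Type v} [TopologicalSpace X]

/-! ### Cartesian morphisms and gluing -/

namespace Tot
variable {A : LocallyDiscrete (Opens X)ᵒᵖ ⥤ᵖ Cat.{v, u}}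
  [∀ U, Preadditive (Fib A U)] [IsAdditive A] {U V W T : Opens X}

lemma comp_ι_hom {x z : Tot A U} (k : W ≤ x.V) (g : z ⟶ x.restrict k) (h : z.V ≤ W) :
    (g ≫ x.ι k).hom (h.trans k) = g.hom h ≫ (resComp A k h x.obj).inv := by
  refine (comp_hom (y := x.restrict k) g (x.ι k) h k).trans ?_
  refine congrArg (g.hom h ≫ ·) ?_
  exact (congrArg (· ≫ _) ((res A h).map_id _)).trans (Category.id_comp _)

/-- The canonical morphisms `A_V|_W ⟶ A_V` are cartesian. -/
lemma isCartesian_ι (x : Tot A U) (k : W ≤ x.V) : IsCartesian (x.ι k) := by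
  refine ⟨k, fun z (h : z.V ≤ W) ↦ ⟨fun g g' e ↦ ?_, fun g ↦ ?_⟩⟩
  · refine hom_ext' (y := x.restrict k) h ?_
    have := congrArg (fun t ↦ Hom.hom t (h.trans k)) e
    dsimp only at this
    rw [comp_ι_hom k g h, comp_ι_hom k g' h] at this
    exact (cancel_mono _).1 this
  · refine ⟨homMk (y := x.restrict k) h (g.hom (h.trans k) ≫ (resComp A k h x.obj).hom), ?_⟩
    refine hom_ext' (h.trans k) ((comp_ι_hom k _ h).trans ?_)
    exact (Category.assoc _ _ _).trans (by rw [Iso.hom_inv_id, Category.comp_id])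

/-- A cartesian morphism is isomorphic to a canonical one. -/
lemma IsCartesian.exists_iso {x y : Tot A U} {f : x ⟶ y} (hf : IsCartesian f) :
    ∃ e : x ≅ y.restrict hf.1, e.hom ≫ y.ι hf.1 = f := by
  obtain ⟨a, ha : a ≫ y.ι hf.1 = f⟩ := ((isCartesian_ι y hf.1).2 x le_rfl).2 f
  obtain ⟨b, hb : b ≫ f = _⟩ := (hf.2 (y.restrict hf.1) le_rfl).2 (y.ι hf.1)
  refine ⟨⟨a, b, (hf.2 x le_rfl).1 ?_, ((isCartesian_ι y hf.1).2 _ le_rfl).1 ?_⟩, ha⟩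
  · change (a ≫ b) ≫ f = 𝟙 _ ≫ f
    rw [Category.assoc, hb, ha, Category.id_comp]
  · change (b ≫ a) ≫ _ = 𝟙 _ ≫ _
    rw [Category.assoc, ha, hb, Category.id_comp]

lemma ιι_comp_ι (x : Tot A U) (k : T ≤ x.V) (l : W ≤ T) :
    ιι x.le x.obj k l ≫ x.ι k = x.ι (l.trans k) := by
  refine hom_ext' (l.trans k) ((comp_ι_hom k _ l).trans ?_)
  exact Iso.hom_inv_id _

lemma ι_comp_ι (x : Tot A U) (k : T ≤ x.V) (l : W ≤ T) :
    ∃ a : (x.restrict k).restrict l ≅ x.restrict (l.trans k),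
      a.hom ≫ x.ι (l.trans k) = (x.restrict k).ι l ≫ x.ι k :=
  ((isCartesian_ι (x.restrict k) l).comp (isCartesian_ι x k)).exists_iso

/-- A property that holds for the restrictions of `x` to the members of an open covering gives a
covering of `x`. -/
lemma exists_openCovering (x : Tot A U) (Q : ∀ W : Opens X, W ≤ x.V → Prop)
    (hQ : ∀ p ∈ x.V, ∃ (W : Opens X) (k : W ≤ x.V), p ∈ W ∧ Q W k) :
    ∃ P ∈ (openCoverings A U).coverings x, ∀ ⦃y : Tot A U⦄ ⦃f : y ⟶ x⦄, P f →
      ∃ (k : y.V ≤ x.V) (e : y ≅ x.restrict k), Q y.V k ∧ f = e.hom ≫ x.ι k := by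
  refine ⟨fun y f ↦ IsCartesian f ∧ ∃ (k : y.V ≤ x.V) (e : y ≅ x.restrict k),
      Q y.V k ∧ f = e.hom ≫ x.ι k,
    ⟨fun y f hf ↦ hf.1, fun p hp ↦ ?_⟩, fun y f hf ↦ hf.2⟩
  obtain ⟨W, k, hpW, hW⟩ := hQ p hp
  exact ⟨x.restrict k, x.ι k, ⟨isCartesian_ι x k, k, Iso.refl _, hW, (Category.id_comp _).symm⟩,
    hpW⟩

/-- The members of an open covering of `x` are isomorphic to restrictions of `x`. -/
lemma exists_mem_of_openCovering {x : Tot A U} {P : Presieve x}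
    (hP : P ∈ (openCoverings A U).coverings x) {p : X} (hp : p ∈ x.V) :
    ∃ (W : Opens X) (k : W ≤ x.V), p ∈ W ∧ ∃ (y : Tot A U) (f : y ⟶ x) (e : y ≅ x.restrict k),
      P f ∧ e.hom ≫ x.ι k = f := by
  obtain ⟨y, f, hf, hpy⟩ := hP.2 p hp
  obtain ⟨e, he⟩ := (hP.1 hf).exists_iso
  exact ⟨y.V, _, hpy, y, f, e, hf, he⟩

end Tot

namespace SheafOn
variable {A : LocallyDiscrete (Opens X)ᵒᵖ ⥤ᵖ Cat.{v, u}} {R : Type v} [CommRing R]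
  [∀ U, Preadditive (Fib A U)] [∀ U, Linear R (Fib A U)] [IsAdditive A]
  {U V W T : Opens X} (F : SheafOn A R U)

/-- Sections of a sheaf on `A|_U` over the restrictions of an object of `𝔞_U` to the members of an
open covering glue uniquely. -/
lemma existsUnique_glue (x : Tot A U) {I : Type*} (W : I → Opens X) (k : ∀ i, W i ≤ x.V)
    (hW : ∀ p ∈ x.V, ∃ i, p ∈ W i) (s : ∀ i, F.val (x.restrict (k i)))
    (hs : ∀ (i j : I) (z : Tot A U) (a : z ⟶ x.restrict (k i)) (b : z ⟶ x.restrict (k j)),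
      a ≫ x.ι (k i) = b ≫ x.ι (k j) → F.pb a (s i) = F.pb b (s j)) :
    ∃! t : F.val x, ∀ i, F.pb (x.ι (k i)) t = s i := by
  have h0 : Presieve.IsSheaf ((Opens.grothendieckTopology X).over x.V)
      (((F.sheaf x.le).obj (op x.obj)).obj ⋙ forget (ModuleCat.{v} R)) := by
    rw [← isSheaf_iff_isSheaf_of_type, ← Presheaf.isSheaf_iff_isSheaf_forget]
    exact ((F.sheaf x.le).obj (op x.obj)).property
  let Y (i : I) : Over x.V := Over.mk (homOfLE (k i))
  let π (i : I) : Y i ⟶ Over.mk (homOfLE (le_refl x.V)) := Over.homMk (homOfLE (k i))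
  have h1 : Presieve.IsSheafFor (((F.sheaf x.le).obj (op x.obj)).obj ⋙ forget (ModuleCat.{v} R))
      (Presieve.ofArrows Y π) := by
    rw [Presieve.isSheafFor_iff_generate]
    apply h0
    rw [GrothendieckTopology.mem_over_iff]
    intro p hp
    obtain ⟨i, hi⟩ := hW p hp
    refine ⟨W i, homOfLE (k i), ?_, hi⟩
    rw [Sieve.overEquiv_iff]
    exact Sieve.le_generate (Presieve.ofArrows Y π) _ _ (Presieve.ofArrows.mk i)
  rw [Presieve.isSheafFor_arrows_iff] at h1
  obtain ⟨t, ht, ht'⟩ := h1 (fun i ↦ (F.germ x.le x.obj (k i)).symm (s i)) (by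
    intro i j Z gi gj _
    apply (F.germ x.le x.obj Z.hom.le).injective
    refine (F.germ_shrink x.le x.obj (k i) gi.left.le _).trans
      (Eq.trans ?_ (F.germ_shrink x.le x.obj (k j) gj.left.le _).symm)
    rw [LinearEquiv.apply_symm_apply, LinearEquiv.apply_symm_apply]
    exact hs i j _ _ _ ((Tot.ιι_comp_ι _ _ _).trans (Tot.ιι_comp_ι _ _ _).symm))
  refine ⟨t, fun i ↦ ?_, fun t' h ↦ ht' t' fun i ↦ ?_⟩
  · rw [← germ_eq_pb]
    exact (congrArg (F.germ x.le x.obj (k i)) (ht i)).trans (LinearEquiv.apply_symm_apply _ _)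
  · apply (F.germ x.le x.obj (k i)).injective
    rw [LinearEquiv.apply_symm_apply, ← h i, ← germ_eq_pb]
    rfl

/-- A section which is locally zero is zero. -/
lemma eq_zero_of_locally (x : Tot A U) (s : F.val x)
    (hs : ∀ p ∈ x.V, ∃ (W : Opens X) (k : W ≤ x.V), p ∈ W ∧ F.pb (x.ι k) s = 0) : s = 0 := by
  choose W k hp h using hs
  refine (F.existsUnique_glue x (I := x.V) (fun i ↦ W i.1 i.2) (fun i ↦ k i.1 i.2)
    (fun p hpx ↦ ⟨⟨p, hpx⟩, hp _ _⟩) (fun _ ↦ 0) fun _ _ _ _ _ _ ↦ ?_).unique (fun i ↦ h _ _)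
    (fun i ↦ ?_)
  · rw [map_zero, map_zero]
  · rw [map_zero]

end SheafOn

end

section

variable {X : Type v} [TopologicalSpace X]

/-! ### Values of the sheaf induced by an object of the stack -/

section
variable {F : LocallyDiscrete (Opens X)ᵒᵖ ⥤ᵖ Cat.{v, u}} {U V : Opens X}

lemma resComp_refl_inv (h : V ≤ U) (M : Fib F U) :
    (resComp F h le_rfl M).inv = (resId F ((res F h).obj M)).hom := by
  rw [← cancel_epi (resId F ((res F h).obj M)).inv, resId_inv_resComp_inv, Iso.inv_hom_id]

lemma resComp_refl_left_hom (h : V ≤ U) (M : Fib F U) :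
    (resComp F le_rfl h M).hom ≫ (res F h).map (resId F M).hom = 𝟙 _ := by
  have := map_resId_inv_resComp_inv F h M
  have h1 : (resComp F le_rfl h M).inv = (res F h).map (resId F M).hom := by
    rw [← cancel_epi ((res F h).map (resId F M).inv), this, ← Functor.map_comp, Iso.inv_hom_id,
      CategoryTheory.Functor.map_id]
  rw [← h1, Iso.hom_inv_id]

lemma resId_hom_naturality {M M' : Fib F U} (a : M ⟶ M') :
    (res F le_rfl).map a ≫ (resId F M').hom = (resId F M).hom ≫ a := by
  rw [← cancel_epi (resId F M).inv, ← Category.assoc, resId_naturality]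
  simp

end

section

variable {A C : LocallyDiscrete (Opens X)ᵒᵖ ⥤ᵖ Cat.{v, u}} (R : Type v) [CommRing R]
  [∀ U, Preadditive (Fib A U)] [∀ U, Linear R (Fib A U)] [IsAdditive A]
  [∀ U, Abelian (Fib C U)] [∀ U, Linear R (Fib C U)] [IsAdditive C] [IsLinear C R]
  [C.IsPrestack (Opens.grothendieckTopology X)] [IsComplemented C]
  (φ : Pseudofunctor.StrongTrans A C)
  [∀ U, (onFib φ U).Additive] [∀ U, (onFib φ U).Linear R] {U : Opens X}

lemma restrictedYoneda_act (N : Fib C U) {V : Opens X} (h : V ≤ U) {M M' : Fib A V} (a : M ⟶ M')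
    (s : ((restrictedYoneda R φ U).obj N).sec h M') :
    ((restrictedYoneda R φ U).obj N).act h a s = (res C le_rfl).map ((onFib φ V).map a) ≫ s := rfl

lemma restrictedYoneda_restr (N : Fib C U) {V W : Opens X} (h : V ≤ U) (k : W ≤ V) (M : Fib A V)
    (s : (res C le_rfl).obj ((onFib φ V).obj M) ⟶ (res C (le_rfl.trans h)).obj N) :
    ((restrictedYoneda R φ U).obj N).restr h M k s = (compResRes φ k le_rfl M).hom ≫ pull k s := rfl

lemma totMap_add {x y : Tot A U} (f g : x ⟶ y) : totMap φ (f + g) = totMap φ f + totMap φ g := by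
  by_cases h : x.V ≤ y.V
  · apply ((extendAdj C x.le).homEquiv _ _).injective
    rw [homEquiv_totMap φ _ h, Adjunction.homEquiv_unit, Functor.map_add, Preadditive.comp_add,
      ← Adjunction.homEquiv_unit, ← Adjunction.homEquiv_unit, homEquiv_totMap φ _ h,
      homEquiv_totMap φ _ h]
    simp only [totTranspose, Tot.add_hom, Functor.map_add, Preadditive.add_comp]
  · rw [totMap_eq_zero φ _ h, totMap_eq_zero φ _ h, totMap_eq_zero φ _ h, add_zero]

instance : (totFunctor φ U).Additive where
  map_add := totMap_add φ _ _

lemma homEquiv_add {D E : Type*} [Category D] [Category E] [Preadditive D] [Preadditive E]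
    {L : D ⥤ E} {G : E ⥤ D} [G.Additive] (adj : L ⊣ G) {Y : D} {Z : E} (f g : L.obj Y ⟶ Z) :
    adj.homEquiv Y Z (f + g) = adj.homEquiv Y Z f + adj.homEquiv Y Z g := by
  simp only [Adjunction.homEquiv_unit, Functor.map_add, Preadditive.comp_add]

/-- The adjunction bijection `Hom(j_! φ(A_V), N) ≃ Hom(φ(A_V), N|_V)`, as an isomorphism of groups. -/
def transpose (N : Fib C U) (x : Tot A U) :
    ((totFunctor φ U).obj x ⟶ N) ≃+ ((onFib φ x.V).obj x.obj ⟶ (res C x.le).obj N) where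
  toEquiv := (extendAdj C x.le).homEquiv _ _
  map_add' := homEquiv_add (extendAdj C x.le)

lemma transpose_comp {N N' : Fib C U} (x : Tot A U) (n : (totFunctor φ U).obj x ⟶ N) (b : N ⟶ N') :
    transpose φ N' x (n ≫ b) = transpose φ N x n ≫ (res C x.le).map b :=
  (extendAdj C x.le).homEquiv_naturality_right n b

lemma homEquiv_totMap_comp {N : Fib C U} {x y : Tot A U} (f : x ⟶ y) (h : x.V ≤ y.V)
    (n : (extendByZero C y.le).obj ((onFib φ y.V).obj y.obj) ⟶ N) :
    (extendAdj C x.le).homEquiv _ _ (totMap φ f ≫ n) =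
      (onFib φ x.V).map (f.hom h) ≫ (compRes φ h y.obj).hom ≫
        (res C h).map ((extendAdj C y.le).homEquiv _ _ n) ≫ (resComp C y.le h N).inv := by
  rw [Adjunction.homEquiv_naturality_right, homEquiv_totMap φ f h, totTranspose,
    Adjunction.homEquiv_unit]
  simp only [Functor.map_comp, Category.assoc]
  rw [← resComp_inv_naturality y.le h n]

/-- The effect of composition with a morphism of `𝔞_U` on transposes. -/
lemma transpose_map_comp (N : Fib C U) {x y : Tot A U} (f : x ⟶ y) (h : x.V ≤ y.V)
    (n : (totFunctor φ U).obj y ⟶ N) :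
    transpose φ N x ((totFunctor φ U).map f ≫ n) =
      (onFib φ x.V).map (f.hom h) ≫ (compRes φ h y.obj).hom ≫
        (res C h).map (transpose φ N y n) ≫ (resComp C y.le h N).inv :=
  homEquiv_totMap_comp φ f h n

/-- The values of the sheaf on `A|_U` induced by an object `N` of `C(U)` are the groups of morphisms
from the objects `j_! φ(A_V)` to `N`. -/
def valEquiv (N : Fib C U) (x : Tot A U) :
    ((totFunctor φ U).obj x ⟶ N) ≃+ ((restrictedYoneda R φ U).obj N).val x :=
  (transpose φ N x).trans
    { toEquiv := Iso.homFromEquiv (Z := (res C x.le).obj N) (resId C ((onFib φ x.V).obj x.obj)).symm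
      map_add' := fun _ _ ↦ Preadditive.comp_add _ _ _ _ _ _ }

lemma valEquiv_apply (N : Fib C U) (x : Tot A U) (n : (totFunctor φ U).obj x ⟶ N) :
    valEquiv R φ N x n = (resId C _).hom ≫ transpose φ N x n := rfl

/-- `valEquiv` is natural with respect to the morphisms of `𝔞_U`. -/
lemma valEquiv_pb (N : Fib C U) {x y : Tot A U} (f : x ⟶ y) (n : (totFunctor φ U).obj y ⟶ N) :
    valEquiv R φ N x ((totFunctor φ U).map f ≫ n) =
      ((restrictedYoneda R φ U).obj N).pb f (valEquiv R φ N y n) := by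
  by_cases h : x.V ≤ y.V
  · rw [SheafOn.pb_apply _ f h, valEquiv_apply, transpose_map_comp φ N f h]
    refine Eq.trans ?_ (restrictedYoneda_act R φ N x.le (f.hom h) _).symm
    rw [valEquiv_apply]
    refine Eq.trans ?_ (congrArg (_ ≫ ·) (restrictedYoneda_restr R φ N y.le h y.obj _).symm)
    set g := transpose φ N y n
    have h1 : pull (hV := le_rfl) (hU := le_rfl.trans y.le) h
      ((resId C ((onFib φ y.V).obj y.obj)).hom ≫ g) =
        (res C h).map g ≫ (resComp C y.le h N).inv := by
      rw [pull, Functor.map_comp, Category.assoc, reassoc_of% (resComp_refl_left_hom (F := C))]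
    refine Eq.trans ?_ (congrArg (fun t ↦ _ ≫ _ ≫ t) h1.symm)
    rw [compResRes, Iso.trans_hom, Iso.symm_hom, Functor.mapIso_hom, resComp_refl_inv,
      Category.assoc, reassoc_of% (resId_hom_naturality (F := C)),
      reassoc_of% (resId_hom_naturality (F := C))]
  · rw [Tot.eq_zero_of_not_le h f, Functor.map_zero, zero_comp, SheafOn.pb_zero, map_zero]

lemma valEquiv_naturality {N N' : Fib C U} (b : N ⟶ N') (x : Tot A U)
    (n : (totFunctor φ U).obj x ⟶ N) :
    valEquiv R φ N' x (n ≫ b) =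
      SheafOn.mapVal ((restrictedYoneda R φ U).map b) x (valEquiv R φ N x n) := by
  rw [valEquiv_apply, transpose_comp]
  exact (Category.assoc _ _ _).symm

end

end

section

/-! ### Morphisms to coproducts and local properties -/

section

universe u₁

variable {D : Type u} [Category.{v} D] [Abelian D] [IsGrothendieckAbelian.{v} D]

open CoproductsFromFiniteFiltered in
attribute [local instance] IsFiltered.isConnected in
/-- A morphism from `Y` vanishes if it vanishes on the morphisms to `Y` whose composition with a
given morphism from `Y` to a coproduct factors through a finite subcoproduct. -/
lemma eq_zero_of_finite_factorization {α : Type v} (f : α → D) {Y Z : D} (g : Y ⟶ ∐ f) (a : Y ⟶ Z)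
    (h : ∀ (E : Finset α) (K : D) (m : K ⟶ Y) (t : ∀ s, K ⟶ f s),
      m ≫ g = ∑ s ∈ E, t s ≫ Sigma.ι f s → m ≫ a = 0) : a = 0 := by
  classical
  -- The coproduct is the filtered colimit of the finite subcoproducts, and this colimit is stable
  -- under base change along `g`.
  let hc := isColimitFiniteSubproductsCocone f
  refine (hc.pullbackOfHasExactColimitsOfShape (X := Y) g).hom_ext fun E ↦ ?_
  rw [← cancel_epi (pullbackObjIso _ _ _).inv]
  suffices h1 : pullback.snd ((finiteSubcoproductsCocone f).ι.app E) g ≫ a = 0 by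
    simpa using! h1
  refine h (E.image Discrete.as) _ _ (fun s ↦ if hs : Discrete.mk s ∈ E then
    pullback.fst ((finiteSubcoproductsCocone f).ι.app E) g ≫
      Sigma.π (fun x : E ↦ (Discrete.functor f).obj x.1) ⟨Discrete.mk s, hs⟩ else 0) ?_
  refine (pullback.condition (f := (finiteSubcoproductsCocone f).ι.app E) (g := g)).symm.trans ?_
  refine (congrArg (pullback.fst _ _ ≫ ·) (finiteSubcoproductsCocone_ι_app_eq_sum f E)).trans ?_
  refine (Preadditive.comp_sum _ _ _).trans ?_
  rw [Finset.sum_image (fun _ _ _ _ h ↦ Discrete.ext h), ← Finset.sum_attach E]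
  refine Finset.sum_congr rfl fun s _ ↦ ?_
  rw [dif_pos s.2]
  exact (Category.assoc _ _ _).symm

variable {𝔲 : Type u₁} [Category.{v} 𝔲] [Preadditive 𝔲] (G : 𝔲 ⥤ D)

/-- The property `Q` of morphisms to `y` in `𝔲` holds locally: the images under `G` of the morphisms
satisfying `Q` form an epimorphic family. -/
def EpiLocally {y : 𝔲} (Q : ∀ ⦃z : 𝔲⦄, (z ⟶ y) → Prop) : Prop :=
  ∀ ⦃Z : D⦄ (a : G.obj y ⟶ Z), (∀ ⦃z : 𝔲⦄ (f : z ⟶ y), Q f → G.map f ≫ a = 0) → a = 0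

variable {G}

lemma epiLocally_of_mem_epiCoverings {y : 𝔲} {P : Presieve y}
    (hP : P ∈ (epiCoverings G).coverings y)
    {Q : ∀ ⦃z : 𝔲⦄, (z ⟶ y) → Prop} (hQ : ∀ ⦃z : 𝔲⦄ ⦃f : z ⟶ y⦄, P f → Q f) : EpiLocally G Q :=
  fun Z a ha ↦ hP a 0 fun z f hf ↦ by rw [ha f (hQ hf), comp_zero]

lemma EpiLocally.exists_mem {y : 𝔲} {Q : ∀ ⦃z : 𝔲⦄, (z ⟶ y) → Prop} (hQ : EpiLocally G Q) :
    ∃ P ∈ (epiCoverings G).coverings y, ∀ ⦃z : 𝔲⦄ ⦃f : z ⟶ y⦄, P f → Q f := by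
  refine ⟨fun z f ↦ Q f, fun Z a b h ↦ ?_, fun z f hf ↦ hf⟩
  rw [← sub_eq_zero]
  exact hQ _ fun z f hf ↦ by rw [Preadditive.comp_sub, h hf, sub_self]

lemma EpiLocally.bind {y : 𝔲} {Q Q' : ∀ ⦃z : 𝔲⦄, (z ⟶ y) → Prop} (hQ : EpiLocally G Q)
    (h : ∀ ⦃z : 𝔲⦄ (f : z ⟶ y), Q f → EpiLocally G fun _ g ↦ Q' (g ≫ f)) : EpiLocally G Q' :=
  fun Z a ha ↦ hQ _ fun z f hf ↦ h f hf _ fun w g hg ↦ by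
    rw [← Category.assoc, ← G.map_comp, ha _ hg]

lemma EpiLocally.mono {y : 𝔲} {Q Q' : ∀ ⦃z : 𝔲⦄, (z ⟶ y) → Prop} (hQ : EpiLocally G Q)
    (h : ∀ ⦃z : 𝔲⦄ (f : z ⟶ y), Q f → Q' f) : EpiLocally G Q' :=
  fun _ _ ha ↦ hQ _ fun _ f hf ↦ ha f (h f hf)

/-- If (F) holds, finitely many morphisms `G N ⟶ G M` are simultaneously in the image of `G`,
locally on `N`. -/
lemma SatisfiesF.finset {T : CoveringSystem 𝔲} (hF : SatisfiesF G T) {σ : Type*} (E : Finset σ)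
    (M : σ → 𝔲) {N : 𝔲} (y : ∀ s, G.obj N ⟶ G.obj (M s)) :
    ∃ P ∈ T.coverings N, ∀ ⦃N' : 𝔲⦄ ⦃f : N' ⟶ N⦄, P f →
      ∀ s ∈ E, ∃ x : N' ⟶ M s, G.map x = G.map f ≫ y s := by
  classical
  induction E using Finset.induction_on with
  | empty => exact ⟨_, T.id_mem N, by simp⟩
  | insert s E hs ih =>
    obtain ⟨P, hP, h⟩ := ih
    choose Q hQ h' using fun (N' : 𝔲) (f : N' ⟶ N) ↦ hF (G.map f ≫ y s)
    refine ⟨_, T.bind_mem hP (fun N' f _ ↦ Q N' f) (fun N' f _ ↦ hQ N' f), ?_⟩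
    rintro N' _ ⟨N'', g, f, hf, hg, rfl⟩ t ht
    rw [Finset.mem_insert] at ht
    obtain rfl | ht := ht
    · obtain ⟨x, hx⟩ := h' _ _ hg
      exact ⟨x, by rw [hx, G.map_comp, Category.assoc]⟩
    · obtain ⟨x, hx⟩ := h hf t ht
      exact ⟨g ≫ x, by rw [G.map_comp, hx, G.map_comp, Category.assoc]⟩

/-- If (FF) holds, finitely many morphisms sent to zero by `G` are simultaneously zero, locally on
the source. -/
lemma SatisfiesFF.finset {T : CoveringSystem 𝔲} (hFF : SatisfiesFF G T) {σ : Type*}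
    (E : Finset σ) (M : σ → 𝔲) {N : 𝔲} (x : ∀ s, N ⟶ M s) (hx : ∀ s ∈ E, G.map (x s) = 0) :
    ∃ P ∈ T.coverings N, ∀ ⦃N' : 𝔲⦄ ⦃f : N' ⟶ N⦄, P f → ∀ s ∈ E, f ≫ x s = 0 := by
  classical
  induction E using Finset.induction_on with
  | empty => exact ⟨_, T.id_mem N, by simp⟩
  | insert s E hs ih =>
    obtain ⟨P, hP, h⟩ := ih fun t ht ↦ hx t (Finset.mem_insert_of_mem ht)
    obtain ⟨P', hP', h'⟩ := hFF (x s) (hx s (Finset.mem_insert_self _ _))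
    choose Q hQ h'' using fun (N' : 𝔲) (f : N' ⟶ N) ↦
      hFF (f ≫ x s) (by rw [G.map_comp, hx s (Finset.mem_insert_self _ _), comp_zero])
    refine ⟨_, T.bind_mem hP (fun N' f _ ↦ Q N' f) (fun N' f _ ↦ hQ N' f), ?_⟩
    rintro N' _ ⟨N'', g, f, hf, hg, rfl⟩ t ht
    rw [Finset.mem_insert] at ht
    obtain rfl | ht := ht
    · rw [Category.assoc, h'' _ _ hg]
    · rw [Category.assoc, h hf t ht, comp_zero]

section

variable (hG : SatisfiesG G (epiCoverings (𝟭 D)))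

include hG

lemma SatisfiesG.eq_zero {M Z : D} (m : M ⟶ Z) (h : ∀ (x : 𝔲) (f : G.obj x ⟶ M), f ≫ m = 0) :
    m = 0 := by
  obtain ⟨ι, N, f, hf⟩ := hG M
  refine hf m 0 fun Y g hg ↦ ?_
  obtain ⟨i⟩ := hg
  rw [comp_zero]
  exact h _ _

variable (hF : SatisfiesF G (epiCoverings G))

include hF

/-- Morphisms to `y` whose image under `G` factors through `m : K ⟶ G y` are an epimorphic family
on the image of `m`. -/
lemma comp_eq_zero_of_factorization {y : 𝔲} {K Z : D} (m : K ⟶ G.obj y) (a : G.obj y ⟶ Z)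
    (h : ∀ ⦃z : 𝔲⦄ (f : z ⟶ y) (t : G.obj z ⟶ K), t ≫ m = G.map f → G.map f ≫ a = 0) :
    m ≫ a = 0 := by
  refine hG.eq_zero _ fun w g ↦ ?_
  obtain ⟨P, hP, h'⟩ := hF (g ≫ m)
  refine hP _ 0 fun z f hf ↦ ?_
  obtain ⟨x, hx⟩ := h' hf
  rw [comp_zero, ← Category.assoc g, ← Category.assoc (G.map f), ← hx]
  exact h x (G.map f ≫ g) (by rw [Category.assoc, hx])

end

/-! ### The tensor product of a presheaf with a functor -/

section Finsupp

variable [G.Additive] {S : Type v} (o : S → 𝔲)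

/-- The morphism to a coproduct of objects in the image of `G` whose components are the images of the
members of a finite family of morphisms in `𝔲`. -/
def can (z : 𝔲) : (Π₀ s, z ⟶ o s) →+ (G.obj z ⟶ ∐ fun s ↦ G.obj (o s)) :=
  open Classical in
  DFinsupp.sumAddHom fun s ↦
    (Preadditive.rightComp _ (Sigma.ι (fun s ↦ G.obj (o s)) s)).comp G.mapAddHom

/-- Composition of a finite family of morphisms with a morphism. -/
def precompFinsupp {z z' : 𝔲} (f : z' ⟶ z) : (Π₀ s, z ⟶ o s) →+ (Π₀ s, z' ⟶ o s) :=
  DFinsupp.mapRange.addMonoidHom fun s ↦ Preadditive.leftComp (o s) f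

lemma can_single [DecidableEq S] {z : 𝔲} (s : S) (c : z ⟶ o s) :
    can (G := G) o z (DFinsupp.single s c) = G.map c ≫ Sigma.ι (fun s ↦ G.obj (o s)) s := by
  obtain rfl : ‹DecidableEq S› = fun a b ↦ Classical.propDecidable _ := Subsingleton.elim _ _
  simp [can]
  rfl

lemma precompFinsupp_single [DecidableEq S] {z z' : 𝔲} (f : z' ⟶ z) (s : S) (c : z ⟶ o s) :
    precompFinsupp o f (DFinsupp.single s c) =
      (DFinsupp.single s (f ≫ c) : Π₀ s, z' ⟶ o s) := by
  obtain rfl : ‹DecidableEq S› = fun a b ↦ Classical.propDecidable _ := Subsingleton.elim _ _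
  simp [precompFinsupp]
  rfl

lemma can_precompFinsupp {z z' : 𝔲} (f : z' ⟶ z) (c : Π₀ s, z ⟶ o s) :
    can (G := G) o z' (precompFinsupp o f c) = G.map f ≫ can (G := G) o z c := by
  classical
  induction c using DFinsupp.induction with
  | h0 => simp
  | ha s b c _ _ ih =>
    rw [map_add, map_add, map_add, Preadditive.comp_add, ih, precompFinsupp_single, can_single,
      can_single, G.map_comp, Category.assoc]

lemma can_comp_π {z : 𝔲} (c : Π₀ s, z ⟶ o s) (s : S) :
    open Classical in can (G := G) o z c ≫ Sigma.π (fun s ↦ G.obj (o s)) s = G.map (c s) := by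
  classical
  induction c using DFinsupp.induction with
  | h0 => simp
  | ha t b c _ _ ih =>
    rw [map_add, Preadditive.add_comp, ih, can_single, DFinsupp.add_apply, G.map_add,
      Category.assoc]
    by_cases h : t = s
    · subst h
      rw [Sigma.ι_π_eq_id, Category.comp_id, DFinsupp.single_eq_same]
    · rw [Sigma.ι_π_of_ne _ h, comp_zero, DFinsupp.single_eq_of_ne (Ne.symm h), G.map_zero]

/-- If (FF) holds, a finite family with trivial image in the coproduct is locally zero. -/
lemma epiLocally_precompFinsupp_eq_zero (hFF : SatisfiesFF G (epiCoverings G)) {z : 𝔲}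
    (c : Π₀ s, z ⟶ o s) (hc : can (G := G) o z c = 0) :
    EpiLocally G fun _ (f : _ ⟶ z) ↦ precompFinsupp o f c = 0 := by
  classical
  obtain ⟨P, hP, h⟩ := hFF.finset c.support o c
    (fun s _ ↦ by rw [← can_comp_π, hc, zero_comp])
  refine epiLocally_of_mem_epiCoverings hP fun w f hf ↦ ?_
  ext s
  by_cases hs : s ∈ c.support
  · exact h hf s hs
  · rw [DFinsupp.notMem_support_iff] at hs
    simp [precompFinsupp, hs]

/-- If (G) and (F) hold, a morphism from an object `G y` to a coproduct is locally given by a finite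
family of morphisms in `𝔲`. -/
lemma epiLocally_exists_can (hG : SatisfiesG G (epiCoverings (𝟭 D)))
    (hF : SatisfiesF G (epiCoverings G)) {y : 𝔲} (g : G.obj y ⟶ ∐ fun s ↦ G.obj (o s)) :
    EpiLocally G fun z (f : z ⟶ y) ↦ ∃ c, can (G := G) o z c = G.map f ≫ g := by
  classical
  intro Z a ha
  refine eq_zero_of_finite_factorization _ g a fun E K m t hm ↦ ?_
  refine comp_eq_zero_of_factorization hG hF m a fun z f t' ht' ↦ ?_
  obtain ⟨P, hP, h⟩ := hF.finset E o fun s ↦ t' ≫ t s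
  refine epiLocally_of_mem_epiCoverings hP (Q := fun w f' ↦
    ∃ c, can (G := G) o w c = G.map (f' ≫ f) ≫ g) (fun w f' hf' ↦ ?_) _ fun w f' hf' ↦ ?_
  · choose! x hx using h hf'
    refine ⟨∑ s ∈ E, DFinsupp.single s (x s), ?_⟩
    rw [map_sum, G.map_comp, ← ht', Category.assoc, Category.assoc, hm, Preadditive.comp_sum,
      Preadditive.comp_sum]
    refine Finset.sum_congr rfl fun s hs ↦ ?_
    rw [can_single, hx s hs]
    simp only [Category.assoc]
  · rw [← Category.assoc, ← G.map_comp]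
    exact ha _ hf'

section Tensor

variable (Φ : 𝔲 → Type v) [∀ x, AddCommGroup (Φ x)] (r : ∀ ⦃x y : 𝔲⦄, (x ⟶ y) → Φ y →+ Φ x)
  (r_add : ∀ ⦃x y : 𝔲⦄ (f g : x ⟶ y) (s : Φ y), r (f + g) s = r f s + r g s)

/-- The element `∑ r (c s) s` defined by a finite family `c` of morphisms. -/
def evalFinsupp {S : Type v} (o : S → 𝔲) (t : ∀ s, Φ (o s)) (z : 𝔲) : (Π₀ s, z ⟶ o s) →+ Φ z :=
  open Classical in
  DFinsupp.sumAddHom fun s ↦ AddMonoidHom.mk' (fun f ↦ r f (t s)) fun f g ↦ r_add f g (t s)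

section

variable {S : Type v} (o : S → 𝔲) (t : ∀ s, Φ (o s))

lemma evalFinsupp_single [DecidableEq S] {z : 𝔲} (s : S) (c : z ⟶ o s) :
    evalFinsupp Φ r r_add o t z (DFinsupp.single s c) = r c (t s) := by
  obtain rfl : ‹DecidableEq S› = fun a b ↦ Classical.propDecidable _ := Subsingleton.elim _ _
  simp [evalFinsupp]

lemma evalFinsupp_precompFinsupp
    (r_comp : ∀ ⦃x y z : 𝔲⦄ (f : x ⟶ y) (g : y ⟶ z) (s : Φ z), r (f ≫ g) s = r f (r g s))
    {z z' : 𝔲} (f : z' ⟶ z) (c : Π₀ s, z ⟶ o s) :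
    evalFinsupp Φ r r_add o t z' (precompFinsupp o f c) = r f (evalFinsupp Φ r r_add o t z c) := by
  classical
  induction c using DFinsupp.induction with
  | h0 => simp
  | ha s b c _ _ ih =>
    rw [map_add, map_add, map_add, map_add, ih, precompFinsupp_single, evalFinsupp_single,
      evalFinsupp_single, r_comp]

lemma can_comp_desc {N : D} (β : ∀ x, Φ x →+ (G.obj x ⟶ N))
    (hβ : ∀ ⦃x y : 𝔲⦄ (f : x ⟶ y) (s : Φ y), β x (r f s) = G.map f ≫ β y s)
    {z : 𝔲} (c : Π₀ s, z ⟶ o s) :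
    can (G := G) o z c ≫ Sigma.desc (fun s ↦ β (o s) (t s)) =
      β z (evalFinsupp Φ r r_add o t z c) := by
  classical
  induction c using DFinsupp.induction with
  | h0 => simp
  | ha s b c _ _ ih =>
    rw [map_add, map_add, map_add, Preadditive.add_comp, ih, can_single, evalFinsupp_single,
      hβ, Category.assoc, Sigma.ι_desc]

end

/-- Suppose that `G : 𝔲 ⥤ D` satisfies (G), (F) and (FF), where epimorphic families are coverings.
Then each additive presheaf `Φ` on `𝔲` has a universal morphism to a presheaf `Hom(G -, N)`, and
this morphism is locally injective and locally surjective. The object `N` is the tensor product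
`Φ ⊗ G`, constructed by generators and relations. -/
theorem exists_tensor (hG : SatisfiesG G (epiCoverings (𝟭 D)))
    (hF : SatisfiesF G (epiCoverings G)) (hFF : SatisfiesFF G (epiCoverings G))
    {I : Type v} (o : I → 𝔲) (ho : ∀ x, ∃ i, Nonempty (x ≅ o i))
    (r_id : ∀ (x : 𝔲) (s : Φ x), r (𝟙 x) s = s)
    (r_comp : ∀ ⦃x y z : 𝔲⦄ (f : x ⟶ y) (g : y ⟶ z) (s : Φ z), r (f ≫ g) s = r f (r g s))
    (r_add : ∀ ⦃x y : 𝔲⦄ (f g : x ⟶ y) (s : Φ y), r (f + g) s = r f s + r g s) :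
    ∃ (N : D) (α : ∀ x, Φ x →+ (G.obj x ⟶ N)),
      (∀ ⦃x y : 𝔲⦄ (f : x ⟶ y) (s : Φ y), α x (r f s) = G.map f ≫ α y s) ∧
      (∀ ⦃x : 𝔲⦄ (s : Φ x), α x s = 0 → EpiLocally G fun _ (f : _ ⟶ x) ↦ r f s = 0) ∧
      (∀ ⦃x : 𝔲⦄ (n : G.obj x ⟶ N),
        EpiLocally G fun z (f : z ⟶ x) ↦ ∃ t, α z t = G.map f ≫ n) ∧
      ∀ (N' : D) (β : ∀ x, Φ x →+ (G.obj x ⟶ N')),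
        (∀ ⦃x y : 𝔲⦄ (f : x ⟶ y) (s : Φ y), β x (r f s) = G.map f ≫ β y s) →
        ∃ n : N ⟶ N', ∀ (x : 𝔲) (s : Φ x), α x s ≫ n = β x s := by
  classical
  -- The generators of the tensor product are the sections of `Φ`, the relations are the finite
  -- families `c` of morphisms such that `∑ r (c s) s = 0`.
  let p : (Σ i, Φ (o i)) → 𝔲 := fun s ↦ o s.1
  let ev := evalFinsupp Φ r r_add p (fun s ↦ s.2)
  let ℛ : Type v := Σ j, {c : Π₀ s, (o j ⟶ p s) // ev (o j) c = 0}
  let q : ℛ → 𝔲 := fun s ↦ o s.1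
  let ρ : (∐ fun s ↦ G.obj (q s)) ⟶ ∐ fun s ↦ G.obj (p s) := Sigma.desc fun s ↦ can p _ s.2.1
  let π := cokernel.π ρ
  have ev_pre : ∀ {z z' : 𝔲} (f : z' ⟶ z) (c : Π₀ s, z ⟶ p s),
      ev z' (precompFinsupp p f c) = r f (ev z c) := fun f c ↦
    evalFinsupp_precompFinsupp Φ r r_add p _ r_comp f c
  have h1 : ∀ {z : 𝔲} (c : Π₀ s, z ⟶ p s), ev z c = 0 → can (G := G) p z c ≫ π = 0 := by
    intro z c hc
    obtain ⟨j, ⟨e⟩⟩ := ho z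
    have h : can (G := G) p (o j) (precompFinsupp p e.inv c) =
        Sigma.ι (fun s ↦ G.obj (q s)) (⟨j, precompFinsupp p e.inv c, by
          rw [ev_pre, hc, map_zero]⟩ : ℛ) ≫ ρ := by simp [ρ]; rfl
    rw [can_precompFinsupp] at h
    rw [← cancel_epi (G.map e.inv), ← Category.assoc, h, Category.assoc, cokernel.condition,
      comp_zero, comp_zero]
  -- Combining the relations with coefficients `d`.
  let flat : ∀ z : 𝔲, (Π₀ s, z ⟶ q s) →+ (Π₀ s, z ⟶ p s) := fun z ↦
    DFinsupp.sumAddHom fun s ↦ AddMonoidHom.mk' (fun f ↦ precompFinsupp p f s.2.1) fun f g ↦ by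
      ext s
      exact Preadditive.add_comp _ _ _ _ _ _
  have flat_single : ∀ {z : 𝔲} (s : ℛ) (f : z ⟶ q s),
      flat z (DFinsupp.single s f) = precompFinsupp p f s.2.1 := fun s f ↦ by simp [flat]
  have can_flat : ∀ {z : 𝔲} (d : Π₀ s, z ⟶ q s),
      can (G := G) p z (flat z d) = can (G := G) q z d ≫ ρ := by
    intro z d
    induction d using DFinsupp.induction with
    | h0 => simp
    | ha s b c _ _ ih =>
      rw [map_add, map_add, map_add, Preadditive.add_comp, ih, can_single, flat_single,
        can_precompFinsupp, Category.assoc, Sigma.ι_desc]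
  have ev_flat : ∀ {z : 𝔲} (d : Π₀ s, z ⟶ q s), ev z (flat z d) = 0 := by
    intro z d
    induction d using DFinsupp.induction with
    | h0 => simp
    | ha s b c _ _ ih =>
      rw [map_add, map_add, ih, flat_single, ev_pre, s.2.2, map_zero, add_zero]
  have h2 : ∀ {z : 𝔲} (c : Π₀ s, z ⟶ p s), can (G := G) p z c ≫ π = 0 →
      EpiLocally G fun _ (f : _ ⟶ z) ↦ r f (ev z c) = 0 := by
    intro z c hc Z a ha
    -- The morphism defined by `c` factors through the image of `ρ`, hence it lifts along `ρ` after
    -- passing to the pullback, where it is locally a combination `d` of relations by (F); the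
    -- difference of `c` and this combination is locally zero by (FF).
    obtain ⟨k, hk⟩ : ∃ k : G.obj z ⟶ Abelian.image ρ,
        k ≫ Abelian.image.ι ρ = can (G := G) p z c :=
      ⟨kernel.lift _ _ hc, kernel.lift_ι _ _ _⟩
    rw [← cancel_epi (pullback.snd (Abelian.factorThruImage ρ) k), comp_zero]
    refine comp_eq_zero_of_factorization hG hF _ a fun z' f t ht ↦ ?_
    refine (epiLocally_exists_can q hG hF (t ≫ pullback.fst _ _)).bind (Q' := fun w g ↦
      r (g ≫ f) (ev z c) = 0) (fun w g ⟨d, hd⟩ ↦ ?_) _ fun w g hg ↦ ?_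
    · refine (epiLocally_precompFinsupp_eq_zero p hFF
        (flat w d - precompFinsupp p (g ≫ f) c) ?_).mono fun w' g' h ↦ ?_
      · rw [map_sub, can_flat, hd, can_precompFinsupp, G.map_comp, ← ht, ← hk, sub_eq_zero]
        simp only [Category.assoc]
        rw [← pullback.condition_assoc, Abelian.image.fac]
      · have h' := congrArg (ev w') h
        rw [map_sub, map_sub, ev_pre, ev_flat, map_zero, zero_sub, map_zero, neg_eq_zero, ev_pre,
          ev_pre, ← r_comp] at h'
        rwa [Category.assoc]
    · rw [← Category.assoc, ← G.map_comp, ha _ hg]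
  have h3 : ∀ (z : 𝔲) (s : Φ z), ∃ c, ev z c = s := by
    intro z s
    obtain ⟨j, ⟨e⟩⟩ := ho z
    refine ⟨DFinsupp.single ⟨j, r e.inv s⟩ e.hom, ?_⟩
    refine (evalFinsupp_single Φ r r_add p _ _ _).trans ?_
    rw [← r_comp, e.hom_inv_id, r_id]
  -- Write a section `s` as `ev z (c z s)`; the class of `c z s` in the cokernel does not depend on
  -- choices.
  choose c hc using h3
  have h4 : ∀ {z : 𝔲} (d : Π₀ s, z ⟶ p s) (s : Φ z), ev z d = s →
      can (G := G) p z (c z s) ≫ π = can (G := G) p z d ≫ π := by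
    intro z d s hd
    rw [← sub_eq_zero, ← Preadditive.sub_comp, ← map_sub]
    exact h1 _ (by rw [map_sub, hc, hd, sub_self])
  refine ⟨cokernel ρ, fun x ↦ AddMonoidHom.mk' (fun s ↦ can p x (c x s) ≫ π) fun s s' ↦ ?_,
    fun x y f s ↦ ?_, fun x s hs ↦ ?_, fun x n ↦ ?_, fun N' β hβ ↦ ?_⟩
  · rw [h4 (c x s + c x s') _ (by rw [map_add, hc, hc]), map_add, Preadditive.add_comp]
  · refine (h4 (precompFinsupp p f (c y s)) _ (by rw [ev_pre, hc])).trans ?_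
    rw [can_precompFinsupp, Category.assoc]
    rfl
  · simpa only [hc] using h2 _ hs
  · intro Z a ha
    rw [← cancel_epi (pullback.snd π n), comp_zero]
    refine comp_eq_zero_of_factorization hG hF _ a fun z f t ht ↦ ?_
    refine epiLocally_exists_can p hG hF (t ≫ pullback.fst _ _) _ fun w g ⟨d, hd⟩ ↦ ?_
    rw [← Category.assoc, ← G.map_comp]
    refine ha _ ⟨ev w d, (h4 d _ rfl).trans ?_⟩
    rw [hd, G.map_comp, ← ht]
    simp only [Category.assoc]
    rw [pullback.condition]
  · have h5 : ∀ {z : 𝔲} (d : Π₀ s, z ⟶ p s), can (G := G) p z d ≫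
        Sigma.desc (fun s : (Σ i, Φ (o i)) ↦ β _ s.2) = β z (ev z d) := fun d ↦
      can_comp_desc Φ r r_add p _ β hβ d
    refine ⟨cokernel.desc ρ (Sigma.desc fun s ↦ β _ s.2) ?_, fun x s ↦ ?_⟩
    · ext s
      rw [Sigma.ι_desc_assoc, h5, s.2.2, map_zero, comp_zero]
    · refine (Category.assoc _ _ _).trans ?_
      rw [cokernel.π_desc, h5, hc]

/-- If (G), (F) and (FF) hold, the functor sending `N` to the presheaf `Hom(G -, N)` is full. -/
theorem exists_comp_eq_of_natural (hG : SatisfiesG G (epiCoverings (𝟭 D)))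
    (hF : SatisfiesF G (epiCoverings G)) (hFF : SatisfiesFF G (epiCoverings G))
    {I : Type v} (o : I → 𝔲) (ho : ∀ x, ∃ i, Nonempty (x ≅ o i)) {N N' : D}
    (θ : ∀ x, (G.obj x ⟶ N) →+ (G.obj x ⟶ N'))
    (hθ : ∀ ⦃x y : 𝔲⦄ (f : x ⟶ y) (s : G.obj y ⟶ N), θ x (G.map f ≫ s) = G.map f ≫ θ y s) :
    ∃ n : N ⟶ N', ∀ (x : 𝔲) (s : G.obj x ⟶ N), s ≫ n = θ x s := by
  -- The canonical morphism from the tensor product of `Hom(G -, N)` with `G` to `N` is an isomorphism.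
  obtain ⟨T, α, hα, hinj, hsurj, huniv⟩ := exists_tensor (fun x ↦ G.obj x ⟶ N)
    (fun x y f ↦ Preadditive.leftComp N (G.map f)) hG hF hFF o ho
    (fun x s ↦ (congrArg (· ≫ s) (G.map_id x)).trans (Category.id_comp s))
    (fun x y z f g s ↦ (congrArg (· ≫ s) (G.map_comp f g)).trans (Category.assoc _ _ _))
    (fun x y f g s ↦ (congrArg (· ≫ s) G.map_add).trans (Preadditive.add_comp _ _ _ _ _ _))
  obtain ⟨e, he⟩ := huniv N (fun x ↦ AddMonoidHom.id _) (fun _ _ _ _ ↦ rfl)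
  obtain ⟨n, hn⟩ := huniv N' θ hθ
  have he' : Mono e := Preadditive.mono_of_cancel_zero _ fun {K} k hk ↦ hG.eq_zero _ fun x f ↦ by
    refine hsurj (f ≫ k) (f ≫ k) (fun z g ⟨t, ht⟩ ↦ ?_)
    have h0 : t = 0 := by
      refine (he z t).symm.trans ?_
      rw [ht]
      simp only [Category.assoc, hk, comp_zero]
    rw [← ht, h0, map_zero]
  have he'' : Epi e := Preadditive.epi_of_cancel_zero _ fun {K} k hk ↦ hG.eq_zero _ fun x f ↦ by
    have := he x f
    simp only [AddMonoidHom.id_apply] at this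
    rw [← this, Category.assoc, hk, comp_zero]
  have := isIso_of_mono_of_epi e
  refine ⟨inv e ≫ n, fun x s ↦ ?_⟩
  have h1 : α x s = s ≫ inv e := by
    rw [← cancel_mono e, Category.assoc, IsIso.inv_hom_id, Category.comp_id]
    exact he x s
  rw [← Category.assoc, ← h1, hn]

end Tensor

end Finsupp

end

end

section

variable {X : Type v} [TopologicalSpace X]

/-! ### The restricted Yoneda functor under (G), (F) and (FF) -/

namespace Tot

variable {A : LocallyDiscrete (Opens X)ᵒᵖ ⥤ᵖ Cat.{v, u}}
  [∀ U, Preadditive (Fib A U)] [IsAdditive A] {U V W : Opens X}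

/-- The morphism of `𝔞_U` defined by a morphism of `A(V)`. -/
def ofHom (h : V ≤ U) {M M' : Fib A V} (a : M ⟶ M') : (⟨V, h, M⟩ : Tot A U) ⟶ ⟨V, h, M'⟩ :=
  homMk (x := ⟨V, h, M⟩) (y := ⟨V, h, M'⟩) le_rfl (a ≫ (resId A M').inv)

lemma ofHom_comp (h : V ≤ U) {M M' M'' : Fib A V} (a : M ⟶ M') (b : M' ⟶ M'') :
    ofHom h (a ≫ b) = ofHom h a ≫ ofHom h b := by
  refine hom_ext' (x := ⟨V, h, M⟩) (y := ⟨V, h, M''⟩) le_rfl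
    (Eq.trans ?_ (comp_hom (ofHom h a) (ofHom h b) le_rfl le_rfl).symm)
  change (a ≫ b) ≫ (resId A M'').inv =
    (a ≫ (resId A M').inv) ≫ (res A le_rfl).map (b ≫ (resId A M'').inv) ≫ _
  rw [Functor.map_comp, Category.assoc, Category.assoc, Category.assoc,
    map_resId_inv_resComp_inv, Category.comp_id, resId_naturality]

lemma ofHom_id (h : V ≤ U) (M : Fib A V) : ofHom h (𝟙 M) = 𝟙 _ :=
  hom_ext' (x := ⟨V, h, M⟩) (y := ⟨V, h, M⟩) le_rfl (Category.id_comp _)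

/-- Isomorphic objects of `A(V)` are isomorphic in `𝔞_U`. -/
def isoMk (h : V ≤ U) {M M' : Fib A V} (e : M ≅ M') : (⟨V, h, M⟩ : Tot A U) ≅ ⟨V, h, M'⟩ where
  hom := ofHom h e.hom
  inv := ofHom h e.inv
  hom_inv_id := by rw [← ofHom_comp, e.hom_inv_id, ofHom_id]
  inv_hom_id := by rw [← ofHom_comp, e.inv_hom_id, ofHom_id]

variable (A U) in
/-- The category `𝔞_U` is essentially small. -/
lemma exists_small_family [∀ U, EssentiallySmall.{v} (Fib A U)] :
    ∃ (I : Type v) (o : I → Tot A U), ∀ x, ∃ i, Nonempty (x ≅ o i) := by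
  refine ⟨Σ V : {V : Opens X // V ≤ U}, SmallModel.{v} (Fib A V.1),
    fun i ↦ ⟨i.1.1, i.1.2, (equivSmallModel (Fib A i.1.1)).inverse.obj i.2⟩, fun x ↦ ?_⟩
  exact ⟨⟨⟨x.V, x.le⟩, (equivSmallModel (Fib A x.V)).functor.obj x.obj⟩,
    ⟨isoMk x.le ((equivSmallModel (Fib A x.V)).unitIso.app x.obj)⟩⟩

end Tot

section

variable {A C : LocallyDiscrete (Opens X)ᵒᵖ ⥤ᵖ Cat.{v, u}} (R : Type v) [CommRing R]
  [∀ U, Preadditive (Fib A U)] [∀ U, Linear R (Fib A U)] [IsAdditive A]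
  [∀ U, Abelian (Fib C U)] [∀ U, Linear R (Fib C U)] [IsAdditive C] [IsLinear C R]
  [C.IsPrestack (Opens.grothendieckTopology X)] [IsComplemented C]
  (φ : Pseudofunctor.StrongTrans A C)
  [∀ U, (onFib φ U).Additive] [∀ U, (onFib φ U).Linear R] {U : Opens X}

include R in
/-- A morphism from `j_! φ(A_V)` vanishes if it vanishes on the members `j_! φ(A_V|_W)` of an open
covering. -/
lemma eq_zero_of_locally {N : Fib C U} {x : Tot A U} (n : (totFunctor φ U).obj x ⟶ N)
    (hn : ∀ p ∈ x.V, ∃ (W : Opens X) (k : W ≤ x.V), p ∈ W ∧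
      (totFunctor φ U).map (x.ι k) ≫ n = 0) : n = 0 := by
  apply (valEquiv R φ N x).injective
  rw [map_zero]
  refine SheafOn.eq_zero_of_locally _ x _ fun p hp ↦ ?_
  obtain ⟨W, k, hpW, h⟩ := hn p hp
  exact ⟨W, k, hpW, by rw [← valEquiv_pb, h, map_zero]⟩

lemma exists_restrict_of_mem_openCoverings {x : Tot A U} {P : Presieve x}
    (hP : P ∈ (openCoverings A U).coverings x) {p : X} (hp : p ∈ x.V) :
    ∃ (W : Opens X) (k : W ≤ x.V), p ∈ W ∧ ∃ (y : Tot A U) (f : y ⟶ x) (a : x.restrict k ⟶ y),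
      P f ∧ a ≫ f = x.ι k := by
  obtain ⟨W, k, hpW, y, f, e, hf, he⟩ := Tot.exists_mem_of_openCovering hP hp
  exact ⟨W, k, hpW, y, f, e.inv, hf, by rw [← he, Iso.inv_hom_id_assoc]⟩

include R in
/-- Since `C` is a prestack, open coverings are epimorphic. -/
lemma mem_epiCoverings_of_mem_openCoverings {x : Tot A U} {P : Presieve x}
    (hP : P ∈ (openCoverings A U).coverings x) :
    P ∈ (epiCoverings (totFunctor φ U)).coverings x := by
  intro Z a b hab
  rw [← sub_eq_zero]
  refine eq_zero_of_locally R φ _ fun p hp ↦ ?_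
  obtain ⟨W, k, hpW, y, f, c, hf, hc⟩ := exists_restrict_of_mem_openCoverings hP hp
  refine ⟨W, k, hpW, ?_⟩
  rw [← hc, Functor.map_comp, Category.assoc, Preadditive.comp_sub, hab hf, sub_self, comp_zero]

lemma faithful_of_satisfiesG (hG : SatisfiesG (totFunctor φ U) (epiCoverings (𝟭 (Fib C U)))) :
    (restrictedYoneda R φ U).Faithful where
  map_injective {N N'} b b' h := by
    rw [← sub_eq_zero]
    refine hG.eq_zero _ fun x n ↦ ?_
    rw [Preadditive.comp_sub, sub_eq_zero]
    apply (valEquiv R φ N' x).injective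
    rw [valEquiv_naturality, valEquiv_naturality, h]

variable [∀ U, EssentiallySmall.{v} (Fib A U)]
  (hG : SatisfiesG (totFunctor φ U) (epiCoverings (𝟭 (Fib C U))))
  (hF : SatisfiesF (totFunctor φ U) (epiCoverings (totFunctor φ U)))
  (hFF : SatisfiesFF (totFunctor φ U) (epiCoverings (totFunctor φ U)))

include hG hF hFF

lemma full_of_satisfies : (restrictedYoneda R φ U).Full where
  map_surjective {N N'} θ := by
    obtain ⟨I, o, ho⟩ := Tot.exists_small_family A U
    obtain ⟨n, hn⟩ := exists_comp_eq_of_natural hG hF hFF o ho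
      (fun x ↦ ((valEquiv R φ N' x).symm.toAddMonoidHom.comp
        (SheafOn.mapVal θ x).toAddMonoidHom).comp (valEquiv R φ N x).toAddMonoidHom)
      (fun x y f s ↦ by
        apply (valEquiv R φ N' x).injective
        refine ((valEquiv R φ N' x).apply_symm_apply _).trans
          (Eq.trans ?_ (valEquiv_pb R φ N' f _).symm)
        refine (congrArg (SheafOn.mapVal θ x) (valEquiv_pb R φ N f s)).trans
          ((SheafOn.mapVal_pb θ f _).trans (congrArg _ ?_))
        exact ((valEquiv R φ N' y).apply_symm_apply _).symm)
    refine ⟨n, SheafOn.hom_ext_val fun x s ↦ ?_⟩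
    obtain ⟨t, rfl⟩ := (valEquiv R φ N x).surjective s
    rw [← valEquiv_naturality, hn]
    exact (valEquiv R φ N' x).apply_symm_apply _

/-- If moreover epimorphic families and open coverings define the same topology, each sheaf `F` on
`A|_U` is isomorphic to the sheaf induced by its tensor product with `𝔞_U ⥤ C(U)`. -/
lemma essSurj_of_satisfies
    (hT : (epiCoverings (totFunctor φ U)).Equivalent (openCoverings A U)) :
    (restrictedYoneda R φ U).EssSurj where
  mem_essImage F := by
    obtain ⟨I, o, ho⟩ := Tot.exists_small_family A U
    obtain ⟨N, α, hα, hinj, hsurj, -⟩ := exists_tensor F.val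
      (fun x y f ↦ (F.pb f).toAddMonoidHom) hG hF hFF o ho (fun x s ↦ F.pb_id x s)
      (fun x y z f g s ↦ F.pb_comp f g s) (fun x y f g s ↦ F.pb_add f g s)
    have inj : ∀ (x : Tot A U), Function.Injective (α x) := fun x ↦ by
      rw [injective_iff_map_eq_zero]
      intro s hs
      -- The morphisms annihilating `s` form a sieve, which is covering for epimorphic families, hence
      -- for open coverings.
      let S : AdditiveSieve x :=
        { arrows z :=
            { carrier := {f | F.pb f s = 0}
              zero_mem' := F.pb_zero s
              add_mem' := fun {f g} hf hg ↦ (F.pb_add f g s).trans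
                ((congrArg₂ (· + ·) hf hg).trans (add_zero _))
              neg_mem' := fun {f} hf ↦ by
                have := F.pb_add f (-f) s
                rw [add_neg_cancel, F.pb_zero, show F.pb f s = 0 from hf, zero_add] at this
                exact this.symm }
          comp_mem g f hf := (F.pb_comp g f s).trans
            ((congrArg (F.pb g) hf).trans (_root_.map_zero _)) }
      have hS : (epiCoverings (totFunctor φ U)).Covers S := fun z f ↦ by
        obtain ⟨P, hP, h⟩ := (hinj (F.pb f s) ((hα f s).trans (by rw [hs, comp_zero]))).exists_mem
        exact ⟨P, hP, fun w g hg ↦ (F.pb_comp g f s).trans (h hg)⟩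
      obtain ⟨P, hP, h⟩ := (hT S).1 hS (𝟙 x)
      refine F.eq_zero_of_locally x s fun p hp ↦ ?_
      obtain ⟨W, k, hpW, y, f, c, hf, hc⟩ := exists_restrict_of_mem_openCoverings hP hp
      have h' : F.pb (f ≫ 𝟙 x) s = 0 := h hf
      rw [Category.comp_id] at h'
      exact ⟨W, k, hpW, by rw [← hc, F.pb_comp, h', _root_.map_zero]⟩
    have surj : ∀ (x : Tot A U), Function.Surjective (α x) := fun x n ↦ by
      -- The morphisms along which `n` comes from a section of `F` form a sieve, which is covering for
      -- open coverings; the sections obtained in this way glue by injectivity.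
      let S : AdditiveSieve x :=
        { arrows z :=
            { carrier := {f | ∃ t, α z t = (totFunctor φ U).map f ≫ n}
              zero_mem' := ⟨0, by rw [_root_.map_zero, Functor.map_zero, zero_comp]⟩
              add_mem' := by
                rintro f g ⟨t, ht⟩ ⟨t', ht'⟩
                exact ⟨t + t', by rw [_root_.map_add, ht, ht', Functor.map_add,
                  Preadditive.add_comp]⟩
              neg_mem' := by
                rintro f ⟨t, ht⟩
                exact ⟨-t, by rw [_root_.map_neg, ht, Functor.map_neg, Preadditive.neg_comp]⟩ }
          comp_mem := by
            rintro z z' g f ⟨t, ht⟩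
            exact ⟨F.pb g t, (hα g t).trans (by rw [ht, Functor.map_comp, Category.assoc])⟩ }
      have hS : (epiCoverings (totFunctor φ U)).Covers S := fun z f ↦ by
        obtain ⟨P, hP, h⟩ := (hsurj ((totFunctor φ U).map f ≫ n)).exists_mem
        refine ⟨P, hP, fun w g hg ↦ ?_⟩
        obtain ⟨t, ht⟩ := h hg
        exact ⟨t, by rw [ht, Functor.map_comp, Category.assoc]⟩
      obtain ⟨P, hP, h⟩ := (hT S).1 hS (𝟙 x)
      have h1 : ∀ p : x.V, ∃ (W : Opens X) (k : W ≤ x.V) (t : F.val (x.restrict k)), p.1 ∈ W ∧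
          α _ t = (totFunctor φ U).map (x.ι k) ≫ n := by
        intro p
        obtain ⟨W, k, hpW, y, f, c, hf, hc⟩ := exists_restrict_of_mem_openCoverings hP p.2
        obtain ⟨t, ht⟩ := h hf
        refine ⟨W, k, F.pb c t, hpW, (hα c t).trans ?_⟩
        rw [ht, Category.comp_id, ← hc, Functor.map_comp, Category.assoc]
      choose W k t hpW ht using h1
      obtain ⟨s, hs, -⟩ := F.existsUnique_glue x W k (fun p hp ↦ ⟨⟨p, hp⟩, hpW _⟩) t
        (fun i j z a b hab ↦ inj z (by
          refine (hα a _).trans (Eq.trans ?_ (hα b _).symm)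
          rw [ht, ht, ← Category.assoc, ← Category.assoc, ← Functor.map_comp, ← Functor.map_comp,
            hab]))
      refine ⟨s, ?_⟩
      rw [← sub_eq_zero]
      refine eq_zero_of_locally R φ _ fun p hp ↦ ⟨_, k ⟨p, hp⟩, hpW _, ?_⟩
      rw [Preadditive.comp_sub, sub_eq_zero, ← ht, ← hs ⟨p, hp⟩]
      exact (hα _ _).symm
    refine ⟨N, ⟨(SheafOn.isoMk (F := F) (fun x ↦ (AddEquiv.ofBijective (α x)
      ⟨inj x, surj x⟩).trans (valEquiv R φ N x)) fun {x y} f s ↦ ?_).symm⟩⟩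
    exact (congrArg (valEquiv R φ N x) (hα f s)).trans (valEquiv_pb R φ N f _)

lemma isEquivalence_of_satisfies
    (hT : (epiCoverings (totFunctor φ U)).Equivalent (openCoverings A U)) :
    (restrictedYoneda R φ U).IsEquivalence where
  faithful := faithful_of_satisfiesG R φ hG
  full := full_of_satisfies R φ hG hF hFF
  essSurj := essSurj_of_satisfies R φ hG hF hFF hT

end

end

section

variable {X : Type v} [TopologicalSpace X]

/-! ### Consequences of the equivalence with sheaves -/

section

variable {A C : LocallyDiscrete (Opens X)ᵒᵖ ⥤ᵖ Cat.{v, u}} (R : Type v) [CommRing R]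
  [∀ U, Preadditive (Fib A U)] [∀ U, Linear R (Fib A U)] [IsAdditive A]
  [∀ U, Abelian (Fib C U)] [∀ U, Linear R (Fib C U)] [IsAdditive C] [IsLinear C R]
  [C.IsPrestack (Opens.grothendieckTopology X)] [IsComplemented C]
  (φ : Pseudofunctor.StrongTrans A C)
  [∀ U, (onFib φ U).Additive] [∀ U, (onFib φ U).Linear R] {U : Opens X}

section

variable {φ} {N : Fib C U} (K : ∀ x : Tot A U, AddSubgroup ((totFunctor φ U).obj x ⟶ N))

/-- The morphism `n` from `j_! φ(A_V)` belongs to `K` after restriction to the members of an open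
covering of `V`. -/
def LocallyMem {x : Tot A U} (n : (totFunctor φ U).obj x ⟶ N) : Prop :=
  ∀ p ∈ x.V, ∃ (W : Opens X) (k : W ≤ x.V), p ∈ W ∧ (totFunctor φ U).map (x.ι k) ≫ n ∈ K _

variable (hK : ∀ {x y : Tot A U} (f : x ⟶ y) (n : (totFunctor φ U).obj y ⟶ N), n ∈ K y →
  (totFunctor φ U).map f ≫ n ∈ K x)

include hK

lemma mem_of_comp_eq {x y z : Tot A U} (n : (totFunctor φ U).obj x ⟶ N) (f : y ⟶ x)
    (hf : (totFunctor φ U).map f ≫ n ∈ K y) (g : z ⟶ x) (a : z ⟶ y) (h : a ≫ f = g) :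
    (totFunctor φ U).map g ≫ n ∈ K z := by
  rw [← h, Functor.map_comp, Category.assoc]
  exact hK _ _ hf

/-- The subsheaf of the sheaf on `A|_U` induced by `N` consisting of the sections which belong
locally to `K`. -/
def locallyMemSub : SheafOn.Sub ((restrictedYoneda R φ U).obj N) where
  carrier x :=
    { carrier := {s | LocallyMem K ((valEquiv R φ N x).symm s)}
      zero_mem' p hp := ⟨x.V, le_rfl, hp, by
        rw [_root_.map_zero, comp_zero]
        exact zero_mem _⟩
      add_mem' {s t} hs ht p hp := by
        obtain ⟨W, k, hpW, h⟩ := hs p hp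
        obtain ⟨W', k', hpW', h'⟩ := ht p hp
        refine ⟨W ⊓ W', inf_le_left.trans k, ⟨hpW, hpW'⟩, ?_⟩
        rw [_root_.map_add, Preadditive.comp_add]
        exact add_mem (mem_of_comp_eq K hK _ _ h _ _ (Tot.ιι_comp_ι x k inf_le_left))
          (mem_of_comp_eq K hK _ _ h' _ _ (Tot.ιι_comp_ι x k' inf_le_right))
      neg_mem' {s} hs p hp := by
        obtain ⟨W, k, hpW, h⟩ := hs p hp
        refine ⟨W, k, hpW, ?_⟩
        rw [_root_.map_neg, Preadditive.comp_neg]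
        exact neg_mem h }
  pb_mem {x y} f s hs p hp := by
    have h0 : (valEquiv R φ N x).symm (((restrictedYoneda R φ U).obj N).pb f s) =
        (totFunctor φ U).map f ≫ (valEquiv R φ N y).symm s := by
      rw [AddEquiv.symm_apply_eq, valEquiv_pb, AddEquiv.apply_symm_apply]
    rw [h0]
    by_cases hf : x.V ≤ y.V
    · obtain ⟨W, k, hpW, h⟩ := hs p (hf hp)
      refine ⟨x.V ⊓ W, inf_le_left, ⟨hp, hpW⟩, ?_⟩
      obtain ⟨a, ha⟩ := ((Tot.isCartesian_ι y k).2 (x.restrict (inf_le_left : x.V ⊓ W ≤ x.V))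
        inf_le_right).2 (x.ι inf_le_left ≫ f)
      rw [← Category.assoc, ← Functor.map_comp]
      exact mem_of_comp_eq K hK _ _ h _ a ha
    · refine ⟨x.V, le_rfl, hp, ?_⟩
      rw [Tot.eq_zero_of_not_le hf f, Functor.map_zero, zero_comp, comp_zero]
      exact zero_mem _
  local_mem {x} s hs p hp := by
    obtain ⟨W, k, hpW, h⟩ := hs p hp
    obtain ⟨W', k', hpW', h'⟩ := h p hpW
    have h0 : (valEquiv R φ N _).symm (((restrictedYoneda R φ U).obj N).pb (x.ι k) s) =
        (totFunctor φ U).map (x.ι k) ≫ (valEquiv R φ N x).symm s := by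
      rw [AddEquiv.symm_apply_eq, valEquiv_pb, AddEquiv.apply_symm_apply]
    rw [h0, ← Category.assoc, ← Functor.map_comp] at h'
    obtain ⟨a, ha⟩ := Tot.ι_comp_ι x k k'
    exact ⟨W', k'.trans k, hpW', mem_of_comp_eq K hK _ _ h' _ a.inv (by
      rw [← ha, Iso.inv_hom_id_assoc])⟩

variable [(restrictedYoneda R φ U).IsEquivalence]

include R in
/-- If `C(U)` is equivalent to `Mod(A|_U)`, each morphism to `N` belongs locally to `K` as soon as
the morphisms in `K` are jointly epimorphic. Indeed, the sections which belong locally to `K` form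
a subsheaf, which corresponds to a subobject of `N` through which the morphisms in `K` factor. -/
theorem locallyMem_of_isEquivalence
    (hK' : ∀ {Z : Fib C U} (a : N ⟶ Z), (∀ (x : Tot A U), ∀ n ∈ K x, n ≫ a = 0) → a = 0)
    {x : Tot A U} (n : (totFunctor φ U).obj x ⟶ N) : LocallyMem K n := by
  -- `m` is the subobject of `N` corresponding to the subsheaf.
  let I := locallyMemSub R K hK
  let e := (restrictedYoneda R φ U).objObjPreimageIso I.toSheafOn
  obtain ⟨m, hm⟩ := (restrictedYoneda R φ U).map_surjective (e.hom ≫ I.incl)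
  have hmono : Mono ((restrictedYoneda R φ U).map m) := by
    rw [hm]
    infer_instance
  have := (restrictedYoneda R φ U).mono_of_mono_map hmono
  have h1 : ∀ {y : Tot A U} (t : (totFunctor φ U).obj y ⟶ N), LocallyMem K t →
      ∃ t', t' ≫ m = t := by
    intro y t ht
    obtain ⟨s, hs⟩ := I.exists_mapVal_incl (x := y) (s := valEquiv R φ N y t) (by
      change LocallyMem K ((valEquiv R φ N y).symm _)
      rwa [AddEquiv.symm_apply_apply])
    refine ⟨(valEquiv R φ _ y).symm (SheafOn.mapVal e.inv y s), ?_⟩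
    apply (valEquiv R φ N y).injective
    rw [valEquiv_naturality, AddEquiv.apply_symm_apply, hm, ← SheafOn.mapVal_comp,
      Iso.inv_hom_id_assoc, hs]
  have : Epi m := Preadditive.epi_of_cokernel_zero (hK' _ fun y t ht ↦ by
    obtain ⟨t', rfl⟩ := h1 t fun p hp ↦ ⟨y.V, le_rfl, hp, hK _ _ ht⟩
    rw [Category.assoc, cokernel.condition, comp_zero])
  have := isIso_of_mono_of_epi m
  have h2 := I.mapVal_incl_mem x (SheafOn.mapVal e.hom x (valEquiv R φ _ x (n ≫ inv m)))
  rw [← SheafOn.mapVal_comp, ← hm, ← valEquiv_naturality, Category.assoc, IsIso.inv_hom_id,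
    Category.comp_id] at h2
  change LocallyMem K ((valEquiv R φ N x).symm _) at h2
  rwa [AddEquiv.symm_apply_apply] at h2

end

variable [(restrictedYoneda R φ U).IsEquivalence]

include R

lemma satisfiesG_of_isEquivalence :
    SatisfiesG (totFunctor φ U) (epiCoverings (𝟭 (Fib C U))) := fun M ↦ by
  refine ⟨Σ x : Tot A U, ((totFunctor φ U).obj x ⟶ M), fun i ↦ i.1, fun i ↦ i.2,
    fun Z a b h ↦ (restrictedYoneda R φ U).map_injective (SheafOn.hom_ext_val fun x s ↦ ?_)⟩
  obtain ⟨t, rfl⟩ := (valEquiv R φ M x).surjective s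
  refine (valEquiv_naturality R φ a x t).symm.trans (Eq.trans ?_ (valEquiv_naturality R φ b x t))
  exact congrArg _ (h (Presieve.ofArrows.mk
    (⟨x, t⟩ : Σ x : Tot A U, ((totFunctor φ U).obj x ⟶ M))))

lemma satisfiesF_of_isEquivalence : SatisfiesF (totFunctor φ U) (openCoverings A U) := by
  intro x y n
  have h := locallyMem_of_isEquivalence R
    (fun z ↦ ((totFunctor φ U).mapAddHom (X := z) (Y := y)).range)
    (by
      rintro z w f _ ⟨g, rfl⟩
      exact ⟨f ≫ g, (totFunctor φ U).map_comp f g⟩)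
    (fun a ha ↦ by simpa using ha y _ ⟨𝟙 y, (totFunctor φ U).map_id y⟩) n
  obtain ⟨P, hP, hP'⟩ := Tot.exists_openCovering x
    (fun W k ↦ ∃ g, (totFunctor φ U).map g = (totFunctor φ U).map (x.ι k) ≫ n)
    (fun p hp ↦ by
      obtain ⟨W, k, hpW, g, hg⟩ := h p hp
      exact ⟨W, k, hpW, g, hg⟩)
  refine ⟨P, hP, fun z f hf ↦ ?_⟩
  obtain ⟨k, e, ⟨g, hg⟩, rfl⟩ := hP' hf
  exact ⟨e.hom ≫ g, by rw [Functor.map_comp, hg, Functor.map_comp, Category.assoc]⟩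

/-- If `C(U)` is equivalent to `Mod(A|_U)`, morphisms from the objects `j_! φ(A_V)` lift locally
along epimorphic families. -/
lemma exists_local_lift_of_isEquivalence {ι : Type*} {N : ι → Fib C U} {N₀ : Fib C U}
    (f : ∀ i, N i ⟶ N₀) (hf : ∀ {Z : Fib C U} (a : N₀ ⟶ Z), (∀ i, f i ≫ a = 0) → a = 0)
    {x : Tot A U} (n : (totFunctor φ U).obj x ⟶ N₀) {p : X} (hp : p ∈ x.V) :
    ∃ (W : Opens X) (k : W ≤ x.V), p ∈ W ∧ ∃ (E : Finset ι)
      (t : ∀ i, (totFunctor φ U).obj (x.restrict k) ⟶ N i),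
      (totFunctor φ U).map (x.ι k) ≫ n = ∑ i ∈ E, t i ≫ f i := by
  classical
  obtain ⟨W, k, hpW, h⟩ := locallyMem_of_isEquivalence R
    (fun z ↦ ⨆ i, (Preadditive.rightComp ((totFunctor φ U).obj z) (f i)).range)
    (fun {z w} g n hn ↦ by
      refine AddSubgroup.iSup_induction _ (C := fun n ↦ (totFunctor φ U).map g ≫ n ∈
        ⨆ i, (Preadditive.rightComp ((totFunctor φ U).obj z) (f i)).range) hn ?_ ?_ ?_
      · rintro i _ ⟨t, rfl⟩
        exact AddSubgroup.mem_iSup_of_mem i ⟨(totFunctor φ U).map g ≫ t, Category.assoc _ _ _⟩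
      · rw [comp_zero]
        exact zero_mem _
      · intro n n' hn hn'
        rw [Preadditive.comp_add]
        exact add_mem hn hn')
    (fun a ha ↦ hf a fun i ↦ (satisfiesG_of_isEquivalence R φ).eq_zero _ fun z t ↦ by
      rw [← Category.assoc]
      exact ha z _ (AddSubgroup.mem_iSup_of_mem i ⟨t, rfl⟩)) n p hp
  refine ⟨W, k, hpW, ?_⟩
  refine AddSubgroup.iSup_induction _ (C := fun n ↦ ∃ (E : Finset ι)
    (t : ∀ i, (totFunctor φ U).obj (x.restrict k) ⟶ N i), n = ∑ i ∈ E, t i ≫ f i) h ?_ ?_ ?_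
  · rintro i _ ⟨t, rfl⟩
    refine ⟨{i}, Function.update 0 i t, ?_⟩
    simp [Preadditive.rightComp]
  · exact ⟨∅, 0, by simp⟩
  · rintro n n' ⟨E, t, rfl⟩ ⟨E', t', rfl⟩
    refine ⟨E ∪ E', fun i ↦ (if i ∈ E then t i else 0) + (if i ∈ E' then t' i else 0), ?_⟩
    simp only [Preadditive.add_comp, Finset.sum_add_distrib]
    congr 1
    · refine Finset.sum_subset_zero_on_sdiff Finset.subset_union_left (fun i hi ↦ ?_)
        fun i hi ↦ ?_
      · rw [if_neg (Finset.mem_sdiff.1 hi).2, zero_comp]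
      · rw [if_pos hi]
    · refine Finset.sum_subset_zero_on_sdiff Finset.subset_union_right (fun i hi ↦ ?_)
        fun i hi ↦ ?_
      · rw [if_neg (Finset.mem_sdiff.1 hi).2, zero_comp]
      · rw [if_pos hi]

end

section

variable (C : LocallyDiscrete (Opens X)ᵒᵖ ⥤ᵖ Cat.{v, u}) [∀ U, Abelian (Fib C U)] [IsComplemented C]
  {U V : Opens X} (h : V ≤ U)

/-- The restriction functors have right adjoints. -/
lemma res_isLeftAdjoint : (res C h).IsLeftAdjoint := by
  have := (IsFiberedCategoryOfLocalizations.isLocalizingSerre (C := C) h).isLeftAdjoint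
  have := IsFiberedCategoryOfLocalizations.isLocalization (C := C) h
  exact Functor.isLeftAdjoint_of_iso
    (Localization.compUniqFunctor (resKernel C h).isoModSerre.Q (res C h)
      (resKernel C h).isoModSerre)

variable {C} in
/-- Restriction preserves jointly epimorphic families. -/
lemma eq_zero_of_res_comp_eq_zero [IsAdditive C] {ι : Type*} {N : ι → Fib C U} {N₀ : Fib C U}
    (f : ∀ i, N i ⟶ N₀) (hf : ∀ {Z : Fib C U} (a : N₀ ⟶ Z), (∀ i, f i ≫ a = 0) → a = 0)
    {Z : Fib C V} (a : (res C h).obj N₀ ⟶ Z) (ha : ∀ i, (res C h).map (f i) ≫ a = 0) : a = 0 := by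
  have := res_isLeftAdjoint C h
  let adj := Adjunction.ofIsLeftAdjoint (res C h)
  have h0 : ∀ N, adj.homEquiv N Z 0 = 0 := fun N ↦ by
    have := adj.homEquiv_naturality_left (0 : N ⟶ N) (0 : (res C h).obj N ⟶ Z)
    rwa [comp_zero, zero_comp] at this
  apply (adj.homEquiv _ _).injective
  rw [h0]
  refine hf _ fun i ↦ ?_
  rw [← adj.homEquiv_naturality_left, ha, h0]

/-- A left adjoint of a localization functor is fully faithful. -/
lemma isIso_unit_of_isLocalization {D E : Type*} [Category D] [Category E] {L : D ⥤ E} {F : E ⥤ D}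
    (adj : F ⊣ L) (W : MorphismProperty D) [L.IsLocalization W] : IsIso adj.unit := by
  obtain ⟨δ, hδ⟩ := (Localization.fullyFaithfulWhiskeringLeft L W E).map_surjective
    (X := F ⋙ L) (Y := 𝟭 E) (Functor.whiskerRight adj.counit L)
  have h1 (Y : D) : δ.app (L.obj Y) = L.map (adj.counit.app Y) := congr_app hδ Y
  refine ⟨δ, Localization.natTrans_ext L W fun Y ↦ ?_, ?_⟩
  · exact (congrArg (_ ≫ ·) (h1 Y)).trans (adj.right_triangle_components Y)
  · ext Z
    refine (δ.naturality (adj.unit.app Z)).symm.trans ?_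
    refine (congrArg (_ ≫ ·) (h1 _)).trans ?_
    refine (L.map_comp _ _).symm.trans ?_
    exact (congrArg L.map (adj.left_triangle_components Z)).trans (L.map_id _)

instance : IsIso (extendAdj C h).unit :=
  have := IsFiberedCategoryOfLocalizations.isLocalization (C := C) h
  isIso_unit_of_isLocalization (extendAdj C h) (resKernel C h).isoModSerre

end

end

section

variable {X : Type v} [TopologicalSpace X]

/-! ### Condition (FF) and the sheaves associated to representable presheaves -/

section HomSheafification

variable {A : LocallyDiscrete (Opens X)ᵒᵖ ⥤ᵖ Cat.{v, u}} (R : Type v) [CommRing R]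
  [∀ U, Preadditive (Fib A U)] [∀ U, Linear R (Fib A U)] [IsAdditive A] [IsLinear A R]
  {U V W : Opens X}

/-- The presheaf `T ↦ Hom(M|_T, N|_T)` on `V` as a functor of `M` in `A(V)`, for `N` in `A(U)`. -/
def homPresheafFunctor (h : V ≤ U) (N : Fib A U) :
    (Fib A V)ᵒᵖ ⥤ (Over V)ᵒᵖ ⥤ ModuleCat.{v} R where
  obj M := homPresheaf A R h M.unop N
  map a :=
    { app T := ModuleCat.ofHom (Linear.leftComp R _ ((res A T.unop.hom.le).map a.unop))
      naturality T T' p := by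
        ext f
        exact (pull_map_comp (hU := T.unop.hom.le.trans h) p.unop.left.le a.unop f).symm }
  map_id M := by
    ext T f
    exact (congrArg (· ≫ f) (CategoryTheory.Functor.map_id _ _)).trans (Category.id_comp f)
  map_comp a a' := by
    ext T f
    exact (congrArg (· ≫ f) (Functor.map_comp _ _ _)).trans (Category.assoc _ _ _)

/-- The compatibility of `homPresheafFunctor` with restriction. -/
def homPresheafResIso (h : V ≤ U) (k : W ≤ V) (N : Fib A U) :
    homPresheafFunctor R h N ⋙
        (Functor.whiskeringLeft _ _ (ModuleCat.{v} R)).obj (Over.map (homOfLE k)).op ≅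
      (res A k).op ⋙ homPresheafFunctor R (k.trans h) N :=
  NatIso.ofComponents (fun M ↦ NatIso.ofComponents (fun T ↦
    { hom := ModuleCat.ofHom (Linear.leftComp R _ (resComp A k T.unop.hom.le M.unop).inv)
      inv := ModuleCat.ofHom (Linear.leftComp R _ (resComp A k T.unop.hom.le M.unop).hom)
      hom_inv_id := by
        ext f
        exact Iso.hom_inv_id_assoc _ _
      inv_hom_id := by
        ext f
        exact Iso.inv_hom_id_assoc _ _ })
    (by
      intro T T' p
      ext f
      exact (pull_resComp_comp (hW := T.unop.hom.le.trans (k.trans h)) k p.unop.left.le f).symm))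
    (by
      intro M M' a
      ext T f
      exact ((reassoc_of% (resComp_inv_naturality k T.unop.hom.le a.unop)) f).symm)

/-- The sheaf associated to `T ↦ Hom(M|_T, N|_T)`, as a functor of `M`. -/
def homSheafification (h : V ≤ U) (N : Fib A U) : (Fib A V)ᵒᵖ ⥤ ModSh R V :=
  homPresheafFunctor R h N ⋙ presheafToSheaf _ _

/-- The section of the associated sheaf defined by a morphism. -/
def toHomSheafification (h : V ≤ U) (N : Fib A U) (M : (Fib A V)ᵒᵖ) :
    (homPresheafFunctor R h N).obj M ⟶ ((homSheafification R h N).obj M).obj :=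
  toSheafify ((Opens.grothendieckTopology X).over V) ((homPresheafFunctor R h N).obj M)

lemma toHomSheafification_naturality (h : V ≤ U) (N : Fib A U) {M M' : (Fib A V)ᵒᵖ} (a : M ⟶ M') :
    toHomSheafification R h N M ≫ ((homSheafification R h N).map a).hom =
      (homPresheafFunctor R h N).map a ≫ toHomSheafification R h N M' :=
  (toSheafify_naturality _ _).symm

/-- The compatibility of `homSheafification` with restriction. -/
def homSheafificationResIso (h : V ≤ U) (k : W ≤ V) (N : Fib A U) :
    homSheafification R h N ⋙ modRes R k ≅
      (res A k).op ⋙ homSheafification R (k.trans h) N :=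
  Functor.isoWhiskerLeft (homPresheafFunctor R h N)
      ((Over.map (homOfLE k)).pushforwardContinuousSheafificationCompatibility (ModuleCat.{v} R)
        ((Opens.grothendieckTopology X).over W) ((Opens.grothendieckTopology X).over V)).symm ≪≫
    Functor.isoWhiskerRight (homPresheafResIso R h k N) (presheafToSheaf _ _)

lemma whisker_toHomSheafification_resIso (h : V ≤ U) (k : W ≤ V) (N : Fib A U) (M : (Fib A V)ᵒᵖ) :
    Functor.whiskerLeft (Over.map (homOfLE k)).op (toHomSheafification R h N M) ≫
        ((homSheafificationResIso R h k N).hom.app M).hom =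
      (homPresheafResIso R h k N).hom.app M ≫
        toHomSheafification R (k.trans h) N ((res A k).op.obj M) := by
  let e := ((Over.map (homOfLE k)).pushforwardContinuousSheafificationCompatibility
    (ModuleCat.{v} R)
        ((Opens.grothendieckTopology X).over W) ((Opens.grothendieckTopology X).over V)).app
        ((homPresheafFunctor R h N).obj M)
  have h1 : Functor.whiskerLeft (Over.map (homOfLE k)).op (toHomSheafification R h N M) ≫
      e.inv.hom = toSheafify _ _ := by
    refine (congrArg (· ≫ e.inv.hom)
      (Functor.toSheafify_pullbackSheafificationCompatibility _ _ _ _ _)).symm.trans ?_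
    refine (Category.assoc _ _ _).trans ?_
    exact (congrArg (toSheafify _ _ ≫ ·)
      (congrArg (fun f ↦ f.hom) e.hom_inv_id)).trans (Category.comp_id _)
  refine Eq.trans ?_ (toSheafify_naturality ((Opens.grothendieckTopology X).over W)
    ((homPresheafResIso R h k N).hom.app M)).symm
  exact (Category.assoc _ _ _).symm.trans (congrArg (· ≫ _) h1)

/-- Morphisms from the restriction of an associated sheaf are determined by the sections defined by
morphisms. -/
lemma homSheafification_hom_ext (h : V ≤ U) (k : W ≤ V) (N : Fib A U) (M : (Fib A V)ᵒᵖ)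
    {Q : ModSh R W} {f g : (modRes R k).obj ((homSheafification R h N).obj M) ⟶ Q}
    (w : Functor.whiskerLeft (Over.map (homOfLE k)).op (toHomSheafification R h N M) ≫ f.hom =
      Functor.whiskerLeft (Over.map (homOfLE k)).op (toHomSheafification R h N M) ≫ g.hom) :
    f = g := by
  rw [← cancel_epi ((homSheafificationResIso R h k N).inv.app M)]
  apply Sheaf.hom_ext
  refine sheafify_hom_ext _ _ _ Q.property ?_
  have h1 := (CommSq.horiz_inv (f := (homPresheafResIso R h k N).app M)
    (g := Functor.whiskerLeft (Over.map (homOfLE k)).op (toHomSheafification R h N M))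
    (h := toHomSheafification R (k.trans h) N ((res A k).op.obj M))
    (i := (sheafToPresheaf _ _).mapIso ((homSheafificationResIso R h k N).app M))
    ⟨(whisker_toHomSheafification_resIso R h k N M).symm⟩).w.symm
  refine (Category.assoc _ _ _).symm.trans (Eq.trans ?_ (Category.assoc _ _ _))
  refine (congrArg (· ≫ f.hom) h1).trans (Eq.trans ?_ (congrArg (· ≫ g.hom) h1).symm)
  refine (Category.assoc _ _ _).trans (Eq.trans ?_ (Category.assoc _ _ _).symm)
  exact congrArg ((homPresheafResIso R h k N).inv.app M ≫ ·) w

/-- The section over `T` of the associated sheaf defined by a morphism `M|_T ⟶ N|_T`. -/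
def toSec (h : V ≤ U) (N : Fib A U) (M : Fib A V) (T : (Over V)ᵒᵖ)
    (f : (res A T.unop.hom.le).obj M ⟶ (res A (T.unop.hom.le.trans h)).obj N) :
    (((homSheafification R h N).obj (op M)).obj.obj T : ModuleCat.{v} R) :=
  ((toHomSheafification R h N (op M)).app T).hom f

lemma map_toSec (h : V ≤ U) (N : Fib A U) (M : Fib A V) {T T' : (Over V)ᵒᵖ} (q : T ⟶ T')
    (f : (res A T.unop.hom.le).obj M ⟶ (res A (T.unop.hom.le.trans h)).obj N) :
    (((homSheafification R h N).obj (op M)).obj.map q).hom (toSec R h N M T f) =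
      toSec R h N M T'
        (pull (hV := T.unop.hom.le) (hU := T.unop.hom.le.trans h) q.unop.left.le f) :=
  (congrArg (fun t ↦ t.hom f) ((toHomSheafification R h N (op M)).naturality q)).symm

lemma act_toSec (h : V ≤ U) (N : Fib A U) {M M' : Fib A V} (a : M ⟶ M') (T : (Over V)ᵒᵖ)
    (f : (res A T.unop.hom.le).obj M' ⟶ (res A (T.unop.hom.le.trans h)).obj N) :
    (((homSheafification R h N).map a.op).hom.app T).hom (toSec R h N M' T f) =
      toSec R h N M T ((res A T.unop.hom.le).map a ≫ f) :=
  congrArg (fun t ↦ (t.app T).hom f) (toHomSheafification_naturality R h N a.op)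

lemma resIso_toSec (h : V ≤ U) (k : W ≤ V) (N : Fib A U) (M : Fib A V) (T : (Over W)ᵒᵖ)
    (f : (res A (T.unop.hom.le.trans k)).obj M ⟶ (res A (T.unop.hom.le.trans (k.trans h))).obj N) :
    (((homSheafificationResIso R h k N).hom.app (op M)).hom.app T).hom
        (toSec R h N M ((Over.map (homOfLE k)).op.obj T) f) =
      toSec R (k.trans h) N ((res A k).obj M) T ((resComp A k T.unop.hom.le M).inv ≫ f) :=
  congrArg (fun t ↦ (t.app T).hom f) (whisker_toHomSheafification_resIso R h k N (op M))

lemma homSheafification_hom_ext' (h : V ≤ U) (k : W ≤ V) (N : Fib A U) (M : Fib A V)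
    {Q : ModSh R W} {f g : (modRes R k).obj ((homSheafification R h N).obj (op M)) ⟶ Q}
    (w : ∀ (T : (Over W)ᵒᵖ) (s : (res A (T.unop.hom.le.trans k)).obj M ⟶
      (res A (T.unop.hom.le.trans (k.trans h))).obj N),
      (f.hom.app T).hom (toSec R h N M ((Over.map (homOfLE k)).op.obj T) s) =
        (g.hom.app T).hom (toSec R h N M ((Over.map (homOfLE k)).op.obj T) s)) :
    f = g :=
  homSheafification_hom_ext R h k N (op M) (by
    ext T s
    exact w T s)

lemma homSheafification_map_ext (h : V ≤ U) (N : Fib A U) (M : Fib A V)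
    {Q : (Over V)ᵒᵖ ⥤ ModuleCat.{v} R}
    (hQ : Presheaf.IsSheaf ((Opens.grothendieckTopology X).over V) Q)
    {f g : ((homSheafification R h N).obj (op M)).obj ⟶ Q}
    (w : ∀ (T : (Over V)ᵒᵖ) (s : (res A T.unop.hom.le).obj M ⟶
      (res A (T.unop.hom.le.trans h)).obj N),
      (f.app T).hom (toSec R h N M T s) = (g.app T).hom (toSec R h N M T s)) :
    f = g :=
  sheafify_hom_ext _ _ _ hQ (by
    ext T s
    exact w T s)

lemma toSec_add (h : V ≤ U) (N : Fib A U) (M : Fib A V) (T : (Over V)ᵒᵖ)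
    (f g : (res A T.unop.hom.le).obj M ⟶ (res A (T.unop.hom.le.trans h)).obj N) :
    toSec R h N M T (f + g) = toSec R h N M T f + toSec R h N M T g :=
  _root_.map_add ((toHomSheafification R h N (op M)).app T).hom f g

lemma toSec_smul (h : V ≤ U) (N : Fib A U) (M : Fib A V) (T : (Over V)ᵒᵖ) (r : R)
    (f : (res A T.unop.hom.le).obj M ⟶ (res A (T.unop.hom.le.trans h)).obj N) :
    toSec R h N M T (r • f) = r • toSec R h N M T f :=
  _root_.map_smul ((toHomSheafification R h N (op M)).app T).hom r f

lemma exists_restrict_eq_zero_of_toSec_eq_zero (h : V ≤ U) (N : Fib A U) (M : Fib A V)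
    {T : Opens X} (k : T ≤ V) (f : (res A k).obj M ⟶ (res A (k.trans h)).obj N)
    (hf : toSec R h N M (op (Over.mk (homOfLE k))) f = 0) {p : X} (hp : p ∈ T) :
    ∃ (W : Opens X) (l : W ≤ T), p ∈ W ∧ pull l f = 0 := by
  let P := homPresheaf A R h M N
  have := Presheaf.equalizerSieve_mem ((Opens.grothendieckTopology X).over V)
    (toSheafify ((Opens.grothendieckTopology X).over V) P)
    (X := op (Over.mk (homOfLE k))) f (0 : (res A k).obj M ⟶ (res A (k.trans h)).obj N)
    (hf.trans (_root_.map_zero ((toHomSheafification R h N (op M)).app _).hom).symm)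
  rw [GrothendieckTopology.mem_over_iff] at this
  obtain ⟨W, i, hi, hpW⟩ := this p hp
  rw [Sieve.overEquiv_iff] at hi
  exact ⟨W, i.le, hpW, hi.trans (_root_.map_zero (P.map _).hom)⟩

-- Only the lemmas above are used from now on; unfolding the sheafification is expensive.
attribute [irreducible] toSec homSheafificationResIso homSheafification

lemma homSheafificationResIso_comp {W' : Opens X} (h : V ≤ U) (k : W ≤ V) (l : W' ≤ W)
    (N : Fib A U) (M : Fib A V) :
    (modRes R l).map ((homSheafificationResIso R h k N).hom.app (op M)) ≫
        (homSheafificationResIso R (k.trans h) l N).hom.app (op ((res A k).obj M)) =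
      (modResComp R k l).hom.app ((homSheafification R h N).obj (op M)) ≫
        (homSheafificationResIso R h (l.trans k) N).hom.app (op M) ≫
          (homSheafification R ((l.trans k).trans h) N).map (resComp A k l M).inv.op := by
  refine (Iso.inv_comp_eq ((modResComp R k l).app ((homSheafification R h N).obj (op M)))).1 ?_
  refine homSheafification_hom_ext' R h (l.trans k) N M fun T s ↦ ?_
  refine (congrArg (fun t ↦ (((homSheafificationResIso R (k.trans h) l N).hom.app
    (op ((res A k).obj M))).hom.app T).hom ((((homSheafificationResIso R h k N).hom.app
      (op M)).hom.app ((Over.map (homOfLE l)).op.obj T)).hom t)) (map_toSec R h N M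
        (T := (Over.map (homOfLE (l.trans k))).op.obj T) _ s)).trans ?_
  refine (congrArg (((homSheafificationResIso R (k.trans h) l N).hom.app
    (op ((res A k).obj M))).hom.app T).hom (resIso_toSec R h k N M _ _)).trans ?_
  refine (resIso_toSec R (k.trans h) l N ((res A k).obj M) T _).trans ?_
  refine Eq.trans ?_ (congrArg
    (((homSheafification R ((l.trans k).trans h) N).map (resComp A k l M).inv.op).hom.app T).hom
    (resIso_toSec R h (l.trans k) N M T s)).symm
  refine Eq.trans ?_ (act_toSec R ((l.trans k).trans h) N _ T _).symm
  refine congrArg (toSec R ((l.trans k).trans h) N _ T) ?_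
  refine Eq.trans ?_ ((Category.assoc _ _ _).symm.trans
    ((congrArg (· ≫ s) (resComp_assoc_inv_inv k l T.unop.hom.le M)).trans (Category.assoc _ _ _)))
  refine congrArg (fun t ↦ _ ≫ _ ≫ t) ?_
  exact pull_refl s

/-- The sheaf on `A|_U` with values the sheaves associated to the presheaves `T ↦ Hom(M|_T, N|_T)`,
for `M` in `A(V)`. -/
def yonedaSheafOn (N : Fib A U) : SheafOn A R U where
  sheaf h := homSheafification R h N
  map_add h M M' a b T := by
    have : ((homSheafification R h N).map (a + b).op).hom =
        ((homSheafification R h N).map a.op).hom + ((homSheafification R h N).map b.op).hom := by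
      refine homSheafification_map_ext R h N M'
        ((homSheafification R h N).obj (op M)).property fun T s ↦ ?_
      refine (act_toSec R h N _ T s).trans ?_
      rw [Functor.map_add, Preadditive.add_comp, toSec_add, ← act_toSec, ← act_toSec]
      rfl
    exact congrArg (fun t ↦ t.app T) this
  map_smul h M M' r a T := by
    have : ((homSheafification R h N).map (r • a).op).hom =
        r • ((homSheafification R h N).map a.op).hom := by
      refine homSheafification_map_ext R h N M'
        ((homSheafification R h N).obj (op M)).property fun T s ↦ ?_
      refine (act_toSec R h N _ T s).trans ?_
      rw [Functor.map_smul, Linear.smul_comp, toSec_smul, ← act_toSec]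
      rfl
    exact congrArg (fun t ↦ t.app T) this
  resIso h k := homSheafificationResIso R h k N
  resIso_comp h k l M := homSheafificationResIso_comp R h k l N M

variable {R} in
/-- If `C(U)` is equivalent to `Mod(A|_U)`, morphisms of `A(U)` sent to zero by `φ` are locally
zero: they act by zero on each sheaf on `A|_U`, and in particular on the identity section of the
sheaf associated to `T ↦ Hom(M|_T, N|_T)`. -/
lemma exists_map_res_eq_zero {C : LocallyDiscrete (Opens X)ᵒᵖ ⥤ᵖ Cat.{v, u}}
    [∀ U, Abelian (Fib C U)] [∀ U, Linear R (Fib C U)] [IsAdditive C] [IsLinear C R]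
    [C.IsPrestack (Opens.grothendieckTopology X)] [IsComplemented C]
    (φ : Pseudofunctor.StrongTrans A C)
    [∀ U, (onFib φ U).Additive] [∀ U, (onFib φ U).Linear R]
    [(restrictedYoneda R φ U).EssSurj] {M N : Fib A U} (a : M ⟶ N) (ha : (onFib φ U).map a = 0)
    {p : X} (hp : p ∈ U) : ∃ (W : Opens X) (k : W ≤ U), p ∈ W ∧ (res A k).map a = 0 := by
  let e := (restrictedYoneda R φ U).objObjPreimageIso (yonedaSheafOn R N)
  let s : (yonedaSheafOn R N).sec (le_refl U) N :=
    toSec R le_rfl N N (op (Over.mk (homOfLE le_rfl))) (𝟙 _)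
  have h1 : (yonedaSheafOn R N).act le_rfl a s = 0 := by
    have h2 : Function.Injective (SheafOn.mapVal e.inv (⟨U, le_rfl, M⟩ : Tot A U)) :=
      Function.LeftInverse.injective (g := SheafOn.mapVal e.hom (⟨U, le_rfl, M⟩ : Tot A U))
        fun t ↦ by
          rw [← SheafOn.mapVal_comp, Iso.inv_hom_id, SheafOn.mapVal_id]
    apply h2
    rw [_root_.map_zero]
    refine (SheafOn.mapOver_actOver e.inv le_rfl a le_rfl s).trans ?_
    refine (restrictedYoneda_act R φ _ le_rfl a _).trans ?_
    rw [ha, Functor.map_zero]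
    exact zero_comp
  obtain ⟨W, k, hpW, h3⟩ := exists_restrict_eq_zero_of_toSec_eq_zero R le_rfl N M le_rfl _
    ((act_toSec R le_rfl N a (op (Over.mk (homOfLE le_rfl))) (𝟙 _)).symm.trans h1) hp
  refine ⟨W, k, hpW, ?_⟩
  have h4 := pull_map_comp (hV := le_rfl) (hU := le_rfl) k a (𝟙 ((res A le_rfl).obj N))
  have h5 : pull (hV := le_rfl) (hU := le_rfl) k (𝟙 ((res A le_rfl).obj N)) = 𝟙 _ := by
    rw [pull, CategoryTheory.Functor.map_id, Category.id_comp, Iso.hom_inv_id]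
  rw [h5] at h4
  exact (Category.comp_id _).symm.trans (h4.symm.trans h3)

end HomSheafification

section

variable {A C : LocallyDiscrete (Opens X)ᵒᵖ ⥤ᵖ Cat.{v, u}} (R : Type v) [CommRing R]
  [∀ U, Preadditive (Fib A U)] [∀ U, Linear R (Fib A U)] [IsAdditive A] [IsLinear A R]
  [∀ U, Abelian (Fib C U)] [∀ U, Linear R (Fib C U)] [IsAdditive C] [IsLinear C R]
  [C.IsPrestack (Opens.grothendieckTopology X)] [IsComplemented C]
  (φ : Pseudofunctor.StrongTrans A C)
  [∀ U, (onFib φ U).Additive] [∀ U, (onFib φ U).Linear R] {U : Opens X}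

/-- Since `j_!` is fully faithful, a morphism `A_W ⟶ A_V` of `𝔞_U` is sent to zero in `C(U)` only if
the corresponding morphism `A_W ⟶ A_V|_W` is sent to zero in `C(W)`. -/
lemma map_hom_eq_zero_of_totMap_eq_zero {x y : Tot A U} (f : x ⟶ y) (h : x.V ≤ y.V)
    (hf : totMap φ f = 0) : (onFib φ x.V).map (f.hom h) = 0 := by
  have h1 := homEquiv_totMap φ f h
  rw [hf, Adjunction.homEquiv_unit, Functor.map_zero, comp_zero, totTranspose] at h1
  rw [← cancel_mono ((compRes φ h y.obj).hom ≫
    (res C h).map ((extendAdj C y.le).unit.app _) ≫ (resComp C y.le h _).inv), zero_comp, ← h1]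

/-- Condition (FF) for `𝔞_U`, which only uses that sheaves on the categories `A|_V` are induced by objects
of `C(V)`. -/
lemma satisfiesFF_of_isEquivalence (hφ : ∀ U, (restrictedYoneda R φ U).EssSurj) :
    SatisfiesFF (totFunctor φ U) (openCoverings A U) := by
  intro x y f hf
  obtain ⟨P, hP, hP'⟩ := Tot.exists_openCovering x (fun W k ↦ x.ι k ≫ f = 0) (fun p hp ↦ by
    by_cases h : x.V ≤ y.V
    · have := hφ x.V
      obtain ⟨W, k, hpW, hW⟩ := exists_map_res_eq_zero (R := R) φ (f.hom h)
        (map_hom_eq_zero_of_totMap_eq_zero φ f h hf) hp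
      refine ⟨W, k, hpW, Tot.hom_ext' (k.trans h) ?_⟩
      refine (Tot.comp_hom (x.ι k) f k h).trans ?_
      rw [hW, zero_comp]
      exact comp_zero
    · exact ⟨x.V, le_rfl, hp, by rw [Tot.eq_zero_of_not_le h f, comp_zero]⟩)
  refine ⟨P, hP, fun z g hg ↦ ?_⟩
  obtain ⟨k, e, hk, rfl⟩ := hP' hg
  rw [Category.assoc, hk, comp_zero]

end

end

section

variable {X : Type v} [TopologicalSpace X]

/-! ### Local lifts along epimorphic families -/

section

variable {F : LocallyDiscrete (Opens X)ᵒᵖ ⥤ᵖ Cat.{v, u}} {U T T' : Opens X}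

lemma pull_map (h : T ≤ U) (k : T' ≤ T) {M N : Fib F U} (a : M ⟶ N) :
    pull k ((res F h).map a) = (res F (k.trans h)).map a := by
  rw [pull, ← Category.assoc, ← resComp_naturality, Category.assoc, resComp_hom_inv,
    Category.comp_id]

end

section

variable (C : LocallyDiscrete (Opens X)ᵒᵖ ⥤ᵖ Cat.{v, u}) [∀ U, Abelian (Fib C U)] {U : Opens X}

/-- Morphisms from the restrictions of `M` lift locally along epimorphic families, as finite sums of
morphisms to the members of the family. -/
def HasLocalLifts (M : Fib C U) : Prop :=
  ∀ ⦃ι : Type v⦄ ⦃N : ι → Fib C U⦄ ⦃N₀ : Fib C U⦄ (f : ∀ i, N i ⟶ N₀),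
    (∀ ⦃Z : Fib C U⦄ (a : N₀ ⟶ Z), (∀ i, f i ≫ a = 0) → a = 0) →
    ∀ ⦃T : Opens X⦄ (h : T ≤ U) (s : (res C h).obj M ⟶ (res C h).obj N₀), ∀ p ∈ T,
      ∃ (W : Opens X) (k : W ≤ T), p ∈ W ∧ ∃ (E : Finset ι)
        (t : ∀ i, (res C (k.trans h)).obj M ⟶ (res C (k.trans h)).obj (N i)),
        pull k s = ∑ i ∈ E, t i ≫ (res C (k.trans h)).map (f i)

variable {C}

lemma HasLocalLifts.of_iso {M M' : Fib C U} (hM : HasLocalLifts C M) (e : M ≅ M') :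
    HasLocalLifts C M' := by
  intro ι N N₀ f hf T h s p hp
  obtain ⟨W, k, hpW, E, t, ht⟩ := hM f hf h ((res C h).map e.hom ≫ s) p hp
  refine ⟨W, k, hpW, E, fun i ↦ (res C (k.trans h)).map e.inv ≫ t i, ?_⟩
  rw [pull_map_comp] at ht
  simp only [Category.assoc]
  rw [← Preadditive.comp_sum, ← ht, ← Functor.map_comp_assoc, e.inv_hom_id,
    CategoryTheory.Functor.map_id, Category.id_comp]

/-- If morphisms from the restrictions of `M` lift locally along epimorphisms, `Ext¹(M, -)` is
locally zero, since it is effaceable. -/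
lemma isLocallyProjective_of_hasLocalLifts [IsAdditive C] [IsFiberedCategoryOfLocalizations C]
    (M : Fib C U) (hM : ∀ ⦃V : Opens X⦄ (h : V ≤ U), HasLocalLifts C ((res C h).obj M)) :
    IsLocallyProjective C M := by
  intro N V h e p hp
  -- `e` is the image under the connecting map of a morphism to the cokernel of an embedding in an injective object, and
  -- it vanishes as soon as this morphism lifts.
  let K : ShortComplex (Fib C V) :=
    .mk (Injective.ι ((res C h).obj N)) (cokernel.π (Injective.ι ((res C h).obj N))) (by simp)
  have hK : K.ShortExact :=
    { exact := ShortComplex.exact_of_g_is_cokernel _ (cokernelIsCokernel _)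
      mono_f := by dsimp [K]; infer_instance
      epi_g := by dsimp [K]; infer_instance }
  obtain ⟨x, rfl⟩ := Ext.covariant_sequence_exact₁ _ hK e (Ext.eq_zero_of_injective _) rfl
  obtain ⟨s, rfl⟩ := (Ext.mk₀_bijective _ K.X₃).2 x
  have := hK.epi_g
  obtain ⟨W, k, hpW, E, t, ht⟩ := hM h (ι := PUnit) (fun _ ↦ K.g)
    (fun Z a ha ↦ by rw [← cancel_epi K.g, ha ⟨⟩, comp_zero]) le_rfl ((res C le_rfl).map s) p hp
  refine ⟨W, k, hpW, ?_⟩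
  rw [pull_map, ← Preadditive.sum_comp] at ht
  obtain ⟨t', ht'⟩ : ∃ t' : (res C k).obj ((res C h).obj M) ⟶ (K.map (res C k)).X₂,
      t' ≫ (K.map (res C k)).g = (res C k).map s := ⟨_, ht.symm⟩
  rw [Ext.mapExactFunctor_comp, Ext.mapExactFunctor_mk₀, Ext.mapExactFunctor_extClass]
  refine (congrArg (fun r ↦ (Ext.mk₀ r).comp (hK.map_of_exact (res C k)).extClass (zero_add 1))
    ht'.symm).trans ?_
  rw [← Ext.mk₀_comp_mk₀_assoc, (hK.map_of_exact (res C k)).comp_extClass, Ext.comp_zero]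
  rfl

end

section

variable {A C : LocallyDiscrete (Opens X)ᵒᵖ ⥤ᵖ Cat.{v, u}} (R : Type v) [CommRing R]
  [∀ U, Preadditive (Fib A U)] [∀ U, Linear R (Fib A U)] [IsAdditive A]
  [∀ U, Abelian (Fib C U)] [∀ U, Linear R (Fib C U)] [IsAdditive C] [IsLinear C R]
  [C.IsPrestack (Opens.grothendieckTopology X)] [IsComplemented C]
  (φ : Pseudofunctor.StrongTrans A C)
  [∀ U, (onFib φ U).Additive] [∀ U, (onFib φ U).Linear R] {U : Opens X}

include R in
lemma hasLocalLifts_of_isEquivalence [(restrictedYoneda R φ U).IsEquivalence] (M : Fib A U) :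
    HasLocalLifts C ((onFib φ U).obj M) := by
  intro ι N N₀ f hf T h s p hp
  let x : Tot A U := ⟨T, h, (res A h).obj M⟩
  obtain ⟨n, hn⟩ := (transpose φ N₀ x).surjective ((compRes φ h M).hom ≫ s)
  obtain ⟨W, k, hpW, E, t, ht⟩ := exists_local_lift_of_isEquivalence R φ f
    (fun a ha ↦ hf a ha) n hp
  refine ⟨W, k, hpW, E, fun i ↦ (compRes φ (k.trans h) M).inv ≫
    (onFib φ W).map (resComp A h k M).hom ≫ transpose φ (N i) (x.restrict k) (t i), ?_⟩
  simp only [Category.assoc]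
  rw [← Preadditive.comp_sum, ← Preadditive.comp_sum]
  have h1 := congrArg (transpose φ N₀ (x.restrict k)) ht
  rw [transpose_map_comp φ N₀ (x.ι k) k, hn, map_sum] at h1
  replace h1 := h1.trans (Finset.sum_congr rfl fun i _ ↦ transpose_comp φ _ (t i) (f i))
  rw [← cancel_epi (compRes φ (k.trans h) M).hom, Iso.hom_inv_id_assoc]
  refine Eq.trans ?_ (congrArg ((onFib φ W).map (resComp A h k M).hom ≫ ·) h1)
  have h2 := compRes_comp φ h k M
  rw [pull, reassoc_of% h2, Functor.map_comp]
  refine congrArg (_ ≫ ·) ?_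
  refine Eq.trans ?_ (congrArg (· ≫ _) ((onFib φ W).map_id _)).symm
  simp only [Category.assoc]
  exact (Category.id_comp _).symm

end

section

universe w' w v₁ u₁

open CategoryTheory.Functor

variable {D : Type u₁} [Category.{v₁} D] {J : GrothendieckTopology D} {E : Type w} [Category.{w'} E]
  {I : Type*} [Category I] {K : I ⥤ Sheaf J E}

/-- A cocone of sheaves is colimiting if and only if the canonical morphism from the colimit of
presheaves becomes invertible after sheafification. -/
lemma nonempty_isColimit_iff (c : Cocone K) {c' : Cocone (K ⋙ sheafToPresheaf J E)}
    (hc' : IsColimit c') :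
    Nonempty (IsColimit c) ↔ J.W (hc'.desc ((sheafToPresheaf J E).mapCocone c)) := by
  constructor
  · rintro ⟨hc⟩ Z hZ
    constructor
    · intro g g' h
      have : (⟨g⟩ : c.pt ⟶ ⟨Z, hZ⟩) = ⟨g'⟩ := hc.hom_ext fun j ↦ by
        apply Sheaf.hom_ext
        have := congrArg (c'.ι.app j ≫ ·) h
        dsimp only at this
        rwa [hc'.fac_assoc, hc'.fac_assoc] at this
      exact congrArg (fun f ↦ f.hom) this
    · intro g
      let s : Cocone K :=
        { pt := ⟨Z, hZ⟩
          ι :=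
            { app j := ⟨c'.ι.app j ≫ g⟩
              naturality j j' a := by
                apply Sheaf.hom_ext
                exact ((c'.w_assoc a g).trans (Category.comp_id _).symm) } }
      refine ⟨(hc.desc s).hom, hc'.hom_ext fun j ↦ ?_⟩
      dsimp only
      rw [hc'.fac_assoc]
      exact congrArg (fun f ↦ f.hom) (hc.fac s j)
  · intro hW
    have h (s : Cocone K) := (hW s.pt.obj s.pt.property).2
      (hc'.desc ((sheafToPresheaf J E).mapCocone s))
    choose d hd using h
    refine ⟨⟨fun s ↦ ⟨d s⟩, fun s j ↦ ?_, fun s m hm ↦ ?_⟩⟩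
    · apply Sheaf.hom_ext
      have := congrArg (c'.ι.app j ≫ ·) (hd s)
      dsimp only at this
      rwa [hc'.fac_assoc, hc'.fac] at this
    · apply Sheaf.hom_ext
      refine (hW s.pt.obj s.pt.property).1 ((hc'.hom_ext fun j ↦ ?_).trans (hd s).symm)
      dsimp only
      rw [hc'.fac_assoc, hc'.fac]
      exact congrArg (fun f ↦ f.hom) (hm j)

end

end

section

variable {X : Type v} [TopologicalSpace X]

/-! ### Local lifts and filtered colimits -/

section

universe w v₁ u₁

open IsGrothendieckAbelian.IsPresentable

/-- In a Grothendieck category, the kernel of a coprojection to a filtered colimit is the sum of the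
kernels of the transition morphisms. -/
lemma exists_epi_family_kernel {D : Type u₁} [Category.{v₁} D] [Abelian D]
    [IsGrothendieckAbelian.{w} D] {J : Type w} [SmallCategory J] [IsFiltered J] {K : J ⥤ D}
    {c : Cocone K} (hc : IsColimit c) (j : J) :
    ∃ (N : Under j → D) (f : ∀ t, N t ⟶ kernel (c.ι.app j)),
      (∀ ⦃Z : D⦄ (a : kernel (c.ι.app j) ⟶ Z), (∀ t, f t ≫ a = 0) → a = 0) ∧
      ∀ t, (f t ≫ kernel.ι (c.ι.app j)) ≫ K.map t.hom = 0 := by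
  let y : kernel (c.ι.app j) ⟶ K.obj j := kernel.ι (c.ι.app j)
  refine ⟨fun t ↦ (kernel (injectivity₀.g y)).obj t,
    fun t ↦ (kernel.ι (injectivity₀.g y)).app t, fun Z a ha ↦ ?_, fun t ↦ ?_⟩
  · have := injectivity₀.epi_f hc (kernel.condition (c.ι.app j))
    rw [← cancel_epi (injectivity₀.f y), comp_zero]
    refine colimit.hom_ext fun t ↦ ?_
    rw [comp_zero, ← Category.assoc, injectivity₀.hf]
    exact ha t
  · rw [Category.assoc]
    exact NatTrans.congr_app (kernel.condition (injectivity₀.g y)) t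

end

section

variable {C : LocallyDiscrete (Opens X)ᵒᵖ ⥤ᵖ Cat.{v, u}} (R : Type v) [CommRing R]
  [∀ U, Abelian (Fib C U)] [∀ U, Linear R (Fib C U)] [IsAdditive C] [IsLinear C R]
  [C.IsPrestack (Opens.grothendieckTopology X)] {U : Opens X}

section

variable {J : Type v} [SmallCategory J] (K : J ⥤ Fib C U)

/-- For a diagram `K` in `C(U)`, the colimit of the presheaves `T ↦ Hom(M|_T, (K j)|_T)`. -/
def colimitHom (M : Fib C U) : (Over U)ᵒᵖ ⥤ ModuleCat.{v} R :=
  colimit ((K ⋙ (homSheaf C R (le_refl U)).obj (op M)) ⋙ sheafToPresheaf _ _)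

/-- The coprojections to `colimitHom`. -/
def colimitHomι (M : Fib C U) (T : (Over U)ᵒᵖ) (j : J) :
    ((res C T.unop.hom.le).obj M ⟶ (res C T.unop.hom.le).obj (K.obj j)) →+
      (colimitHom R K M).obj T :=
  (((colimit.ι ((K ⋙ (homSheaf C R (le_refl U)).obj (op M)) ⋙ sheafToPresheaf _ _) j).app
    T).hom).toAddMonoidHom

variable {K}

lemma exists_colimitHomι_eq [IsFiltered J] (M : Fib C U) (T : (Over U)ᵒᵖ)
    (x : (colimitHom R K M).obj T) :
    ∃ j s, colimitHomι R K M T j s = x :=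
  Concrete.isColimit_exists_rep _ (isColimitOfPreserves ((evaluation _ _).obj T)
    (colimit.isColimit ((K ⋙ (homSheaf C R (le_refl U)).obj (op M)) ⋙ sheafToPresheaf _ _))) x

lemma colimitHomι_comp_map (M : Fib C U) (T : (Over U)ᵒᵖ) {j j' : J} (a : j ⟶ j')
    (s : (res C T.unop.hom.le).obj M ⟶ (res C T.unop.hom.le).obj (K.obj j)) :
    colimitHomι R K M T j' (s ≫ (res C T.unop.hom.le).map (K.map a)) =
      colimitHomι R K M T j s :=
  ConcreteCategory.congr_hom (NatTrans.congr_app (colimit.w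
    ((K ⋙ (homSheaf C R (le_refl U)).obj (op M)) ⋙ sheafToPresheaf _ _) a) T) s

lemma colimitHomι_map (M : Fib C U) {T T' : (Over U)ᵒᵖ} (g : T ⟶ T') {j : J}
    (s : (res C T.unop.hom.le).obj M ⟶ (res C T.unop.hom.le).obj (K.obj j)) :
    ((colimitHom R K M).map g).hom (colimitHomι R K M T j s) =
      colimitHomι R K M T' j (pull g.unop.left.le s) :=
  (ConcreteCategory.congr_hom ((colimit.ι
    ((K ⋙ (homSheaf C R (le_refl U)).obj (op M)) ⋙ sheafToPresheaf _ _) j).naturality g) s).symm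

/-- For a cocone `c` under `K`, the canonical morphism from `colimitHom` to the presheaf
`T ↦ Hom(M|_T, c|_T)`. -/
def colimitHomDesc (c : Cocone K) (M : Fib C U) :
    colimitHom R K M ⟶ homPresheaf C R (le_refl U) M c.pt :=
  (colimit.isColimit _).desc ((sheafToPresheaf _ _).mapCocone
    (((homSheaf C R (le_refl U)).obj (op M)).mapCocone c))

lemma colimitHomDesc_apply (c : Cocone K) (M : Fib C U) (T : (Over U)ᵒᵖ) (j : J)
    (s : (res C T.unop.hom.le).obj M ⟶ (res C T.unop.hom.le).obj (K.obj j)) :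
    ((colimitHomDesc R c M).app T).hom (colimitHomι R K M T j s) =
      s ≫ (res C T.unop.hom.le).map (c.ι.app j) :=
  ConcreteCategory.congr_hom (NatTrans.congr_app ((colimit.isColimit
    ((K ⋙ (homSheaf C R (le_refl U)).obj (op M)) ⋙ sheafToPresheaf _ _)).fac
      ((sheafToPresheaf _ _).mapCocone
        (((homSheaf C R (le_refl U)).obj (op M)).mapCocone c)) j) T) s

lemma nonempty_isColimit_mapCocone_homSheaf_iff (c : Cocone K) (M : Fib C U) :
    Nonempty (IsColimit (((homSheaf C R (le_refl U)).obj (op M)).mapCocone c)) ↔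
      ((Opens.grothendieckTopology X).over U).W (colimitHomDesc R c M) :=
  nonempty_isColimit_iff _ _

end

variable [IsFiberedCategoryOfLocalizations C]

/-- If `M` is locally finitely presented, morphisms from restrictions of `M` to a filtered colimit
factor locally through some stage of the colimit. -/
lemma IsLocallyFinitelyPresented.exists_fac {M : Fib C U} (hM : IsLocallyFinitelyPresented C R M)
    {J : Type v} [SmallCategory J] [IsFiltered J] {K : J ⥤ Fib C U} {c : Cocone K}
    (hc : IsColimit c) {T : Opens X} (h : T ≤ U) (s : (res C h).obj M ⟶ (res C h).obj c.pt)
    {p : X} (hp : p ∈ T) :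
    ∃ (W : Opens X) (k : W ≤ T) (j : J)
      (t : (res C (k.trans h)).obj M ⟶ (res C (k.trans h)).obj (K.obj j)),
      p ∈ W ∧ pull k s = t ≫ (res C (k.trans h)).map (c.ι.app j) := by
  have := hM.preserves_filtered_colimits J
  have h1 := (nonempty_isColimit_mapCocone_homSheaf_iff R c M).1
    ⟨isColimitOfPreserves ((homSheaf C R (le_refl U)).obj (op M)) hc⟩
  rw [GrothendieckTopology.W_iff_isLocallyBijective] at h1
  have := h1.2
  have h2 := Presheaf.imageSieve_mem ((Opens.grothendieckTopology X).over U)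
    (colimitHomDesc R c M) (U := op (Over.mk (homOfLE h))) s
  rw [GrothendieckTopology.mem_over_iff] at h2
  obtain ⟨W, i, hi, hpW⟩ := h2 p hp
  rw [Sieve.overEquiv_iff] at hi
  obtain ⟨x, hx⟩ := hi
  obtain ⟨j, t, rfl⟩ := exists_colimitHomι_eq R M _ x
  exact ⟨W, i.le, j, t, hpW, hx.symm.trans (colimitHomDesc_apply R c M _ j t)⟩

/-- If morphisms from the restrictions of `M` lift locally along epimorphic families, `M` is locally
finitely presented. Lifting along the coprojections `c.ι j` gives local surjectivity, and lifting
along the kernels of the transition morphisms gives local injectivity. -/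
lemma isLocallyFinitelyPresented_of_hasLocalLifts (M : Fib C U) (hM : HasLocalLifts C M) :
    IsLocallyFinitelyPresented C R M := by
  refine ⟨fun J _ _ ↦ ⟨fun {K} ↦ ⟨fun {c} hc ↦ ?_⟩⟩⟩
  rw [nonempty_isColimit_mapCocone_homSheaf_iff, GrothendieckTopology.W_iff_isLocallyBijective]
  constructor
  · constructor
    intro T x y hxy
    obtain ⟨j₁, x, rfl⟩ := exists_colimitHomι_eq R M T x
    obtain ⟨j₂, y, rfl⟩ := exists_colimitHomι_eq R M T y
    let j := IsFiltered.max j₁ j₂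
    rw [← colimitHomι_comp_map R M T (IsFiltered.leftToMax j₁ j₂) x,
      ← colimitHomι_comp_map R M T (IsFiltered.rightToMax j₁ j₂) y] at hxy ⊢
    generalize x ≫ _ = x at hxy ⊢
    generalize y ≫ _ = y at hxy ⊢
    have hxy' : (x - y) ≫ (res C T.unop.hom.le).map (c.ι.app j) = 0 := by
      rw [Preadditive.sub_comp, sub_eq_zero]
      exact (colimitHomDesc_apply R c M T j x).symm.trans
        (hxy.trans (colimitHomDesc_apply R c M T j y))
    obtain ⟨z, hz⟩ := KernelFork.IsLimit.lift' (isLimitForkMapOfIsLimit' (res C T.unop.hom.le)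
      (kernel.condition (c.ι.app j)) (kernelIsKernel _)) (x - y) hxy'
    obtain ⟨N, f, hf, hf'⟩ := exists_epi_family_kernel hc j
    rw [GrothendieckTopology.mem_over_iff]
    intro p hp
    obtain ⟨W, k, hpW, E, t, ht⟩ := hM f hf T.unop.hom.le z p hp
    refine ⟨W, homOfLE k, ?_, hpW⟩
    rw [Sieve.overEquiv_iff]
    let T' : (Over U)ᵒᵖ := op (Over.mk (homOfLE k ≫ T.unop.hom))
    let g : T ⟶ T' := (Over.homMk (homOfLE k)).op
    refine (colimitHomι_map R M g x).trans (Eq.trans ?_ (colimitHomι_map R M g y).symm)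
    have h1 : pull k x = pull k (x - y) + pull k y := by rw [← pull_add, sub_add_cancel]
    have h2 : pull k (x - y) =
        ∑ i ∈ E, t i ≫ (res C (k.trans T.unop.hom.le)).map (f i ≫ kernel.ι (c.ι.app j)) := by
      refine (congrArg (pull k) hz).symm.trans ((pull_comp_map k z _).trans ?_)
      refine (congrArg (· ≫ _) ht).trans ((Preadditive.sum_comp _ _ _).trans ?_)
      exact Finset.sum_congr rfl fun i _ ↦ by rw [Category.assoc, ← Functor.map_comp]
    refine (congrArg (colimitHomι R K M T' j) (h1.trans (congrArg (· + pull k y) h2))).trans ?_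
    refine (_root_.map_add _ _ _).trans ?_
    refine (congrArg (· + _) (map_sum (colimitHomι R K M T' j) _ _)).trans ?_
    refine (congrArg (· + _) (Finset.sum_eq_zero fun i _ ↦ ?_)).trans (zero_add _)
    refine (colimitHomι_comp_map R M T' i.hom _).symm.trans ?_
    refine (congrArg (colimitHomι R K M T' _) ?_).trans (_root_.map_zero _)
    refine (Category.assoc _ _ _).trans ((congrArg (_ ≫ ·) ?_).trans comp_zero)
    exact (Functor.map_comp _ _ _).symm.trans ((congrArg _ (hf' i)).trans (Functor.map_zero _ _ _))
  · constructor
    intro T s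
    rw [GrothendieckTopology.mem_over_iff]
    intro p hp
    obtain ⟨W, k, hpW, E, t, ht⟩ := hM (fun j ↦ c.ι.app j)
      (fun Z a ha ↦ hc.hom_ext fun j ↦ (ha j).trans comp_zero.symm) T.hom.le s p hp
    refine ⟨W, homOfLE k, ?_, hpW⟩
    rw [Sieve.overEquiv_iff]
    refine ⟨∑ j ∈ E, colimitHomι R K M _ j (t j), ?_⟩
    refine (map_sum ((colimitHomDesc R c M).app _).hom _ _).trans (Eq.trans ?_ ht.symm)
    exact Finset.sum_congr rfl fun j _ ↦
      colimitHomDesc_apply R c M (op (Over.mk (homOfLE k ≫ T.hom))) j (t j)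

end

end

section

variable {X : Type v} [TopologicalSpace X]

/-! ### Locally finitely presented and locally projective objects -/

section

universe w v₁ u₁

attribute [local instance] Abelian.hasFiniteBiproducts

/-- An object of a Grothendieck category with an epimorphic family to it is the filtered colimit of
the images of the finite subfamilies. -/
lemma exists_isColimit_image {D : Type u₁} [Category.{v₁} D] [Abelian D]
    [IsGrothendieckAbelian.{w} D] {ι : Type w} {N : ι → D} {M : D} (f : ∀ i, N i ⟶ M)
    (hf : ∀ ⦃Z : D⦄ (a : M ⟶ Z), (∀ i, f i ≫ a = 0) → a = 0) :
    ∃ (K : Finset ι ⥤ D) (c : Cocone K) (_ : IsColimit c) (e : c.pt ≅ M)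
      (q : ∀ E : Finset ι, (⨁ fun i : E ↦ N i) ⟶ K.obj E), (∀ E, Epi (q E)) ∧
      ∀ E, q E ≫ c.ι.app E ≫ e.hom = biproduct.desc fun i : E ↦ f i := by
  let P (E : Finset ι) : Subobject M := imageSubobject (biproduct.desc fun i : E ↦ f i)
  have hP : Monotone P := fun E E' h ↦ by
    have : biproduct.desc (fun i : E ↦ f i) =
        biproduct.desc (fun i : E ↦ biproduct.ι (fun i : E' ↦ N i) ⟨i, h i.2⟩) ≫
          biproduct.desc (fun i : E' ↦ f i) := by
      ext i
      simp
    dsimp only [P]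
    rw [this]
    exact imageSubobject_comp_le _ _
  have hfac (E : Finset ι) (i : E) : (P E).Factors (f i) := by
    have := (imageSubobject_factors_comp_self (f := biproduct.desc fun i : E ↦ f i)
      (biproduct.ι (fun i : E ↦ N i) i))
    rwa [biproduct.ι_desc] at this
  have htop : ⨆ E, P E = ⊤ := by
    rw [← Subobject.isIso_arrow_iff_eq_top]
    have : Epi (⨆ E, P E).arrow := Preadditive.epi_of_cokernel_zero (hf _ fun i ↦ by
      have := Subobject.factors_of_le (f i) (le_iSup P {i}) (hfac {i} ⟨i, by simp⟩)
      rw [← Subobject.factorThru_arrow _ _ this, Category.assoc, cokernel.condition, comp_zero])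
    exact isIso_of_mono_of_epi _
  let F : Finset ι ⥤ MonoOver M := hP.functor ⋙ Subobject.representative
  let c : Cocone (F ⋙ MonoOver.forget _) :=
    { pt := Over.mk (𝟙 M)
      ι :=
        { app E := Over.homMk (P E).arrow (Category.comp_id _)
          naturality E E' a := by
            ext
            exact (Over.w (F.map a).hom).trans (Category.comp_id _).symm } }
  have : Mono c.pt.hom := by dsimp [c]; infer_instance
  refine ⟨F ⋙ MonoOver.forget _ ⋙ Over.forget _, (Over.forget _).mapCocone c,
    IsGrothendieckAbelian.isColimitMapCoconeOfSubobjectMkEqISup F c ?_, Iso.refl _,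
    fun E ↦ factorThruImageSubobject _,
    fun E ↦ inferInstanceAs (Epi (factorThruImageSubobject _)), fun E ↦ ?_⟩
  · refine (Subobject.top_eq_id M).symm.trans (htop.symm.trans ?_)
    exact iSup_congr fun E ↦ (Subobject.mk_arrow (P E)).symm
  · exact (congrArg (_ ≫ ·) (Category.comp_id _)).trans (imageSubobject_arrow_comp _)

end

section

attribute [local instance] Abelian.hasFiniteBiproducts

variable {C : LocallyDiscrete (Opens X)ᵒᵖ ⥤ᵖ Cat.{v, u}} [∀ U, Abelian (Fib C U)]
  [IsAdditive C] [IsFiberedCategoryOfLocalizations C] {U : Opens X}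

/-- If `M` is locally projective, morphisms from restrictions of `M` lift locally along
epimorphisms. -/
lemma IsLocallyProjective.exists_lift {M : Fib C U} (hM : IsLocallyProjective C M)
    {N N' : Fib C U} (g : N ⟶ N') [Epi g] {V : Opens X} (h : V ≤ U)
    (s : (res C h).obj M ⟶ (res C h).obj N') {p : X} (hp : p ∈ V) :
    ∃ (W : Opens X) (k : W ≤ V) (t : (res C (k.trans h)).obj M ⟶ (res C (k.trans h)).obj N),
      p ∈ W ∧ pull k s = t ≫ (res C (k.trans h)).map g := by
  let K : ShortComplex (Fib C U) := .mk (kernel.ι g) g (by simp)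
  have hK : K.ShortExact :=
    { exact := ShortComplex.exact_of_f_is_kernel _ (kernelIsKernel _)
      mono_f := by dsimp [K]; infer_instance
      epi_g := by dsimp [K]; infer_instance }
  have hKV := hK.map_of_exact (res C h)
  have hs : ∃ s' : (res C h).obj M ⟶ (K.map (res C h)).X₃, s' = s := ⟨s, rfl⟩
  obtain ⟨s', hs'⟩ := hs
  obtain ⟨W, k, hpW, hk⟩ := hM (kernel g) h ((Ext.mk₀ s').comp hKV.extClass (zero_add 1)) p hp
  have hKW := hKV.map_of_exact (res C k)
  have hk' : (Ext.mk₀ ((res C k).map s')).comp hKW.extClass (zero_add 1) = 0 := by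
    refine Eq.trans ?_ hk
    refine Eq.trans ?_ (Ext.mapExactFunctor_comp (res C k) _ _ _).symm
    rw [Ext.mapExactFunctor_mk₀, Ext.mapExactFunctor_extClass]
    rfl
  obtain ⟨t, ht⟩ := Ext.covariant_sequence_exact₃ _ hKW _ rfl hk'
  obtain ⟨t, rfl⟩ := (Ext.mk₀_bijective _ _).2 t
  rw [Ext.mk₀_comp_mk₀] at ht
  obtain ⟨t', ht'⟩ : ∃ t' : (res C k).obj ((res C h).obj M) ⟶ (res C k).obj ((res C h).obj N),
      t' ≫ (res C k).map ((res C h).map g) = (res C k).map s :=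
    ⟨t, ((Ext.mk₀_bijective _ _).1 ht).trans (congrArg _ hs')⟩
  refine ⟨W, k, (resComp C h k M).hom ≫ t' ≫ (resComp C h k N).inv, hpW, ?_⟩
  simp only [Category.assoc]
  rw [pull, ← ht', Category.assoc, resComp_inv_naturality]

variable (R : Type v) [CommRing R] [∀ U, Linear R (Fib C U)] [IsLinear C R]
  [C.IsPrestack (Opens.grothendieckTopology X)]

/-- Morphisms from a locally finitely presented and locally projective object lift locally along
epimorphic families: they factor locally through the image of a finite subfamily. -/
lemma hasLocalLifts_of_isLocallyFinitelyPresented {M : Fib C U}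
    (hM : IsLocallyFinitelyPresented C R M) (hM' : IsLocallyProjective C M) :
    HasLocalLifts C M := by
  intro ι N N₀ f hf T h s p hp
  obtain ⟨K, c, hc, e, q, hq, hq'⟩ := exists_isColimit_image f hf
  obtain ⟨W, k, E, t, hpW, ht⟩ := hM.exists_fac R hc h (s ≫ (res C h).map e.inv) hp
  obtain ⟨W', l, t', hpW', ht'⟩ := hM'.exists_lift (q E) (k.trans h) t hpW
  refine ⟨W', l.trans k, hpW', E, fun i ↦ open Classical in if hi : i ∈ E then
    t' ≫ (res C _).map (biproduct.π (fun i : E ↦ N i) ⟨i, hi⟩) else 0, ?_⟩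
  rw [← pull_pull k l]
  have h1 : s = (s ≫ (res C h).map e.inv) ≫ (res C h).map e.hom := by
    rw [Category.assoc, ← Functor.map_comp, e.inv_hom_id, CategoryTheory.Functor.map_id,
      Category.comp_id]
  rw [h1, pull_comp_map, ht, pull_comp_map, pull_comp_map, ht', Category.assoc, Category.assoc,
    ← Functor.map_comp, ← Functor.map_comp, hq', ← Finset.sum_coe_sort]
  have h2 : biproduct.desc (fun i : E ↦ f i) = ∑ i : E, biproduct.π (fun i : E ↦ N i) i ≫ f i := by
    classical
    ext j
    simp [Preadditive.comp_sum, biproduct.ι_π_assoc, dite_comp]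
  refine (congrArg (fun b ↦ t' ≫ (res C ((l.trans k).trans h)).map b) h2).trans ?_
  rw [Functor.map_sum, Preadditive.comp_sum]
  refine Finset.sum_congr rfl fun i _ ↦ ?_
  dsimp only
  rw [dif_pos i.2, Functor.map_comp, Category.assoc]

end

end

section

variable {X : Type v} [TopologicalSpace X]

/-! ### Comparison of the topologies -/

section

variable {A C : LocallyDiscrete (Opens X)ᵒᵖ ⥤ᵖ Cat.{v, u}} (R : Type v) [CommRing R]
  [∀ U, Preadditive (Fib A U)] [∀ U, Linear R (Fib A U)] [IsAdditive A]
  [∀ U, Abelian (Fib C U)] [∀ U, Linear R (Fib C U)] [IsAdditive C] [IsLinear C R]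
  [C.IsPrestack (Opens.grothendieckTopology X)] [IsComplemented C]
  (φ : Pseudofunctor.StrongTrans A C)
  [∀ U, (onFib φ U).Additive] [∀ U, (onFib φ U).Linear R] {U : Opens X}

/-- If morphisms from `φ(A_V)` lift locally along epimorphic families in `C(V)`, then morphisms from
`j_! φ(A_V)` lift locally along epimorphic families in `C(U)`. -/
lemma HasLocalLifts.exists_lift_extendByZero {x : Tot A U}
    (hx : HasLocalLifts C ((onFib φ x.V).obj x.obj)) {ι : Type v} {N : ι → Fib C U} {N₀ : Fib C U}
    (f : ∀ i, N i ⟶ N₀) (hf : ∀ ⦃Z : Fib C U⦄ (a : N₀ ⟶ Z), (∀ i, f i ≫ a = 0) → a = 0)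
    (n : (totFunctor φ U).obj x ⟶ N₀) {p : X} (hp : p ∈ x.V) :
    ∃ (W : Opens X) (k : W ≤ x.V), p ∈ W ∧ ∃ (E : Finset ι)
      (t : ∀ i, (totFunctor φ U).obj (x.restrict k) ⟶ N i),
      (totFunctor φ U).map (x.ι k) ≫ n = ∑ i ∈ E, t i ≫ f i := by
  obtain ⟨W, k, hpW, E, t, ht⟩ := hx (fun i ↦ (res C x.le).map (f i))
    (fun Z a ha ↦ eq_zero_of_res_comp_eq_zero x.le f (fun a ha ↦ hf a ha) a ha) le_rfl
    ((res C le_rfl).map (transpose φ N₀ x n)) p hp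
  rw [pull_map] at ht
  choose m hm using fun i ↦ (transpose φ (N i) (x.restrict k)).surjective
    ((onFib φ W).map ((x.ι k).hom k) ≫ (compRes φ k x.obj).hom ≫ t i ≫
      (resComp C x.le k (N i)).inv)
  refine ⟨W, k, hpW, E, m, ?_⟩
  apply (transpose φ N₀ (x.restrict k)).injective
  refine (transpose_map_comp φ N₀ (x.ι k) k n).trans ?_
  rw [map_sum]
  refine Eq.trans ?_ (Finset.sum_congr rfl fun i _ ↦ (transpose_comp φ _ (m i) (f i)).symm)
  have h1 (i : ι) : transpose φ (N i) (x.restrict k) (m i) ≫ (res C (x.restrict k).le).map (f i) =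
      ((onFib φ W).map ((x.ι k).hom k) ≫ (compRes φ k x.obj).hom) ≫
        (t i ≫ (res C k).map ((res C x.le).map (f i))) ≫ (resComp C x.le k N₀).inv := by
    refine (congrArg (· ≫ _) (hm i)).trans ?_
    simp only [Category.assoc]
    rw [resComp_inv_naturality]
  refine Eq.trans ?_ (Finset.sum_congr rfl fun i _ ↦ (h1 i).symm)
  rw [← Preadditive.comp_sum, ← Preadditive.sum_comp, Category.assoc]
  exact congrArg (_ ≫ ·) (congrArg (_ ≫ ·) (congrArg (· ≫ _) ht))

variable {φ}

/-- If (F) and (FF) hold with respect to open coverings, and the objects `φ(A_V)` are locally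
finitely presented and locally projective, epimorphic families of `𝔞_U` are coverings for the
topology defined by open coverings. -/
lemma exists_openCovering_of_mem_epiCoverings [∀ U, EssentiallySmall.{v} (Fib A U)]
    (hF : SatisfiesF (totFunctor φ U) (openCoverings A U))
    (hFF : SatisfiesFF (totFunctor φ U) (openCoverings A U))
    (hφ : ∀ V (M : Fib A V), HasLocalLifts C ((onFib φ V).obj M))
    {x : Tot A U} {P : Presieve x} (hP : P ∈ (epiCoverings (totFunctor φ U)).coverings x)
    (S : AdditiveSieve x) (hS : ∀ ⦃z : Tot A U⦄ ⦃f : z ⟶ x⦄, P f → f ∈ S.arrows z) :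
    ∃ Q ∈ (openCoverings A U).coverings x, ∀ ⦃z : Tot A U⦄ ⦃f : z ⟶ x⦄, Q f → f ∈ S.arrows z := by
  obtain ⟨I, o, ho⟩ := Tot.exists_small_family A U
  -- The additive sieve `S` is replaced by a small family of generators.
  let ι : Type v := Σ i : I, {f : o i ⟶ x // f ∈ S.arrows _}
  have hι ⦃Z : Fib C U⦄ (a : (totFunctor φ U).obj x ⟶ Z)
      (ha : ∀ i : ι, (totFunctor φ U).map i.2.1 ≫ a = 0) : a = 0 := hP a 0 fun z f hf ↦ by
    obtain ⟨i, ⟨e⟩⟩ := ho z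
    rw [comp_zero, ← e.hom_inv_id_assoc f, Functor.map_comp, Category.assoc]
    exact (congrArg (_ ≫ ·) (ha ⟨i, e.inv ≫ f, S.comp_mem e.inv (hS hf)⟩)).trans comp_zero
  obtain ⟨Q, hQ, h⟩ := Tot.exists_openCovering x (fun W k ↦ x.ι k ∈ S.arrows _) fun p hp ↦ by
    obtain ⟨W, k, hpW, E, m, hm⟩ := HasLocalLifts.exists_lift_extendByZero φ (hφ x.V x.obj)
      (fun i : ι ↦ (totFunctor φ U).map i.2.1) hι (𝟙 _) hp
    rw [Category.comp_id] at hm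
    obtain ⟨Q, hQ, h⟩ := hF.finset E (fun i : ι ↦ o i.1) m
    obtain ⟨W', k', hpW', y, f, a, hf, ha⟩ := exists_restrict_of_mem_openCoverings hQ hpW
    choose! c hc using h hf
    have h0 : (totFunctor φ U).map (f ≫ x.ι k - ∑ i ∈ E, c i ≫ i.2.1) = 0 := by
      rw [Functor.map_sub, Functor.map_comp, hm, Functor.map_sum, sub_eq_zero,
        Preadditive.comp_sum]
      exact Finset.sum_congr rfl fun i hi ↦ by rw [Functor.map_comp, hc i hi, Category.assoc]
    -- By (F) and (FF), the decomposition `G (x.ι k) = ∑ m i ≫ G f i` lifts to `𝔞_U` after passing to a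
    -- smaller open set.
    obtain ⟨Q', hQ', h'⟩ := hFF (a ≫ (f ≫ x.ι k - ∑ i ∈ E, c i ≫ i.2.1))
      (by rw [Functor.map_comp, h0, comp_zero])
    obtain ⟨W'', k'', hpW'', y', f', a', hf', ha'⟩ :=
      exists_restrict_of_mem_openCoverings hQ' hpW'
    refine ⟨W'', (k''.trans k').trans k, hpW'', ?_⟩
    obtain ⟨e, he⟩ := Tot.ι_comp_ι (x.restrict k) k' k''
    obtain ⟨e', he'⟩ := Tot.ι_comp_ι x k (k''.trans k')
    have h1 : a' ≫ f' ≫ a ≫ (f ≫ x.ι k - ∑ i ∈ E, c i ≫ i.2.1) = 0 := by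
      rw [h' hf', comp_zero]
    rw [← Category.assoc, ha', Preadditive.comp_sub, Preadditive.comp_sub, sub_eq_zero,
      ← Category.assoc a, ha, ← Category.assoc, ← he, Category.assoc, ← he'] at h1
    rw [← e'.inv_hom_id_assoc (x.ι _), ← e.inv_hom_id_assoc (e'.hom ≫ _), h1]
    refine S.comp_mem _ (S.comp_mem _ (S.comp_mem _ (S.comp_mem _ ?_)))
    exact sum_mem fun i _ ↦ S.comp_mem _ i.2.2
  refine ⟨Q, hQ, fun z f hf ↦ ?_⟩
  obtain ⟨k, e, hk, rfl⟩ := h hf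
  exact S.comp_mem _ hk

include R in
/-- Under the same hypotheses, open coverings and epimorphic families define the same topology. -/
lemma epiCoverings_equivalent_openCoverings [∀ U, EssentiallySmall.{v} (Fib A U)]
    (hF : SatisfiesF (totFunctor φ U) (openCoverings A U))
    (hFF : SatisfiesFF (totFunctor φ U) (openCoverings A U))
    (hφ : ∀ V (M : Fib A V), HasLocalLifts C ((onFib φ V).obj M)) :
    (epiCoverings (totFunctor φ U)).Equivalent (openCoverings A U) := by
  intro x S
  refine ⟨fun h y f ↦ ?_, fun h y f ↦ ?_⟩
  · obtain ⟨P, hP, hPS⟩ := h f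
    exact exists_openCovering_of_mem_epiCoverings hF hFF hφ hP
      { arrows z := (S.arrows z).comap (Preadditive.rightComp z f)
        comp_mem g f' hf' := by
          change (g ≫ f') ≫ f ∈ S.arrows _
          rw [Category.assoc]
          exact S.comp_mem g hf' } hPS
  · obtain ⟨P, hP, hPS⟩ := h f
    exact ⟨P, mem_epiCoverings_of_mem_openCoverings R φ hP, hPS⟩

end

end

end FibCat

end

theorem mainTheorem6 {X : Type v} [TopologicalSpace X] (R : Type v) [CommRing R]
    (A C : LocallyDiscrete (Opens X)ᵒᵖ ⥤ᵖ Cat.{v, u})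
    [∀ U, Preadditive (Fib A U)] [∀ U, Linear R (Fib A U)] [IsAdditive A] [IsLinear A R]
    [∀ U, EssentiallySmall.{v} (Fib A U)]
    [∀ U, Abelian (Fib C U)] [∀ U, Linear R (Fib C U)] [IsAdditive C] [IsLinear C R]
    [C.IsStack (Opens.grothendieckTopology X)] [IsComplemented C]
    (φ : Pseudofunctor.StrongTrans A C)
    [∀ U, (onFib φ U).Additive] [∀ U, (onFib φ U).Linear R] :
    List.TFAE [
      ∀ U : Opens X, (restrictedYoneda R φ U).IsEquivalence,
      (∀ U : Opens X, SatisfiesG (totFunctor φ U) (epiCoverings (𝟭 (Fib C U))) ∧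
          SatisfiesF (totFunctor φ U) (epiCoverings (totFunctor φ U)) ∧
          SatisfiesFF (totFunctor φ U) (epiCoverings (totFunctor φ U))) ∧
        ∀ U : Opens X, (epiCoverings (totFunctor φ U)).Equivalent
          (openCoverings A U),
      (∀ U : Opens X, SatisfiesG (totFunctor φ U) (epiCoverings (𝟭 (Fib C U))) ∧
          SatisfiesF (totFunctor φ U) (openCoverings A U) ∧
          SatisfiesFF (totFunctor φ U) (openCoverings A U)) ∧
        ∀ (U : Opens X) (M : Fib A U), IsLocallyFinitelyPresented C R ((onFib φ U).obj M) ∧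
          IsLocallyProjective C ((onFib φ U).obj M)] := by
  tfae_have 1 → 3 := fun h ↦
    ⟨fun U ↦ ⟨satisfiesG_of_isEquivalence R φ, satisfiesF_of_isEquivalence R φ,
      satisfiesFF_of_isEquivalence R φ fun U ↦ inferInstance⟩,
    fun U M ↦ ⟨isLocallyFinitelyPresented_of_hasLocalLifts R _
        (hasLocalLifts_of_isEquivalence R φ M),
      isLocallyProjective_of_hasLocalLifts _ fun V h ↦
        (hasLocalLifts_of_isEquivalence R φ ((res A h).obj M)).of_iso (compRes φ h M)⟩⟩
  tfae_have 3 → 2 := fun ⟨h, hφ⟩ ↦ by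
    refine ⟨fun U ↦ ⟨(h U).1, fun x y n ↦ ?_, fun x y a ha ↦ ?_⟩, fun U ↦
      epiCoverings_equivalent_openCoverings R (h U).2.1 (h U).2.2 fun V M ↦
        hasLocalLifts_of_isLocallyFinitelyPresented R (hφ V M).1 (hφ V M).2⟩
    · obtain ⟨P, hP, hn⟩ := (h U).2.1 n
      exact ⟨P, mem_epiCoverings_of_mem_openCoverings R φ hP, hn⟩
    · obtain ⟨P, hP, hP'⟩ := (h U).2.2 a ha
      exact ⟨P, mem_epiCoverings_of_mem_openCoverings R φ hP, hP'⟩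
  tfae_have 2 → 1 := fun ⟨h, hT⟩ U ↦
    isEquivalence_of_satisfies R φ (h U).1 (h U).2.1 (h U).2.2 (hT U)
  tfae_finish
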